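/- Let $0<a<b$, let $N\ge 1$ be an integer, let $\alpha_1,\dots,\alpha_N>0$ and let $l_1<\dots<l_N$ be real numbers such that $$f(x)=\frac{\sqrt{(b-x)(x-a)}}{x}\sum_{k=1}^N\frac{\alpha_k}{x^{l_k}}\,1_{(a,b)}(x)$$ satisfies $\int_a^b f(x)\,dx=1$. Let $X$ be a real random variable with density $f$. If there is a real number $t\ge 0$ with $l_1,\dots,l_N\in[t,t+1]$, then for every real $r\ge 1$ the distribution of $X^r$ belongs to the class UI, and hence is freely infinitely divisible. Here, for a probability measure $\mu$ on $\mathbb R$, put $G_\mu(z)=\int_{\mathbb R}\frac{1}{z-x}\,d\mu(x)$ for $\operatorname{Im}z>0$. There are a truncated cone $\Gamma=\{z:\operatorname{Im}z>M,\ \operatorname{Im}z>\lambda|\operatorname{Re}z|\}$ and a triangular domain $\Lambda=\{w: -\delta<\operatorname{Im}w<0,\ \gamma|\operatorname{Re}w|<-\operatorname{Im}w\}$ ($\lambda,M,\gamma,\delta>0$) such that $G_\mu$ is injective on $\Gamma$ and $\Lambda\subset G_\mu(\Gamma)$; let $G_\mu^{-1}:\Lambda\to\Gamma$ be the corresponding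 right inverse. The measure $\mu$ is in the class UI if $G_\mu^{-1}$ extends to an injective analytic function on $\{w:\operatorname{Im}w<0\}$. With $\phi_\mu(z)=G_\mu^{-1}(1/z)-z$, the free convolution $\mu\boxplus\nu$ is the unique probability measure with $\phi_{\mu\boxplus\nu}=\phi_\mu+\phi_\nu$ on the common domain, and $\mu$ is freely infinitely divisible if for every integer $n\ge1$ there is a probability measure $\rho_n$ on $\mathbb R$ with $\mu=\rho_n\boxplus\dots\boxplus\rho_n$ ($n$ terms). -/

import Mathlib

open MeasureTheory ProbabilityTheory Set

namespace FreeProb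

noncomputable section

/-- The Cauchy transform `G_μ(z) = ∫ 1 / (z - x) dμ(x)` of a measure on the real line. -/
def cauchyTransform (μ : Measure ℝ) (z : ℂ) : ℂ :=
  ∫ x : ℝ, 1 / (z - (x : ℂ)) ∂μ

/-- Mathlib's resolvent transform is the Cauchy transform with the opposite sign. -/
theorem cauchyTransform_eq_neg_resolventTransform (μ : Measure ℝ) (z : ℂ) :
    cauchyTransform μ z = - resolventTransform μ z := by
  rw [resolventTransform_apply, ← integral_neg, cauchyTransform]
  congr 1
  funext x
  rw [resolvent, Ring.inverse_eq_inv', ← inv_neg, one_div]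
  simp

/-- The open lower half-plane. -/
def lowerHalfPlane : Set ℂ := {z | z.im < 0}

/-- The truncated cone `Γ_{lam, M}` in the upper half-plane. -/
def truncatedCone (lam M : ℝ) : Set ℂ :=
  {z | 0 < z.im ∧ lam * |z.re| < z.im ∧ M < z.im}

/-- The triangular domain `Λ_{γ, δ}` in the lower half-plane. -/
def triangularDomain (γ δ : ℝ) : Set ℂ :=
  {w | w.im < 0 ∧ γ * |w.re| < -w.im ∧ -δ < w.im}

/-- On `Λ_{γ, δ}` the function `g` is the right inverse of the Cauchy transform `G_μ`, that is,
the inverse of the restriction of `G_μ` to some truncated cone on which `G_μ` is univalent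
and whose image contains `Λ_{γ, δ}`. -/
def IsRightInverseCauchy (μ : Measure ℝ) (γ δ : ℝ) (g : ℂ → ℂ) : Prop :=
  ∃ lam > 0, ∃ M > 0, InjOn (cauchyTransform μ) (truncatedCone lam M) ∧
    ∀ w ∈ triangularDomain γ δ, g w ∈ truncatedCone lam M ∧ cauchyTransform μ (g w) = w

/-- The class UI (univalent inverse Cauchy transform): probability measures `μ` for which the right
inverse of `G_μ`, defined on some triangular domain, has a univalent analytic continuation to the
lower half-plane. -/
def IsUI (μ : Measure ℝ) : Prop :=
  IsProbabilityMeasure μ ∧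
    ∃ g : ℂ → ℂ, AnalyticOnNhd ℂ g lowerHalfPlane ∧ InjOn g lowerHalfPlane ∧
      ∃ γ > 0, ∃ δ > 0, IsRightInverseCauchy μ γ δ g

/-- The Voiculescu transform `φ(z) = g(1 / z) - z` built from a right inverse `g` of the Cauchy
transform; it is meaningful where `1 / z` lies in the domain of `g`. -/
def voiculescuTransform (g : ℂ → ℂ) (z : ℂ) : ℂ := g (1 / z) - z

/-- `ρ = μ ⊞ ν`: the Voiculescu transforms satisfy `φ_ρ = φ_μ + φ_ν` on a common domain (they are
analytic and their domains are nested, so the choice of the common domain is immaterial). For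
probability measures `μ, ν` such a probability measure `ρ` exists and is unique. -/
def IsFreeConvolution (μ ν ρ : Measure ℝ) : Prop :=
  ∃ γ > 0, ∃ δ > 0, ∃ g₁ g₂ g₃ : ℂ → ℂ,
    IsRightInverseCauchy μ γ δ g₁ ∧ IsRightInverseCauchy ν γ δ g₂ ∧
    IsRightInverseCauchy ρ γ δ g₃ ∧
    ∀ z : ℂ, 1 / z ∈ triangularDomain γ δ →
      voiculescuTransform g₃ z = voiculescuTransform g₁ z + voiculescuTransform g₂ z

/-- `μ = ρ ⊞ ⋯ ⊞ ρ` with `n` terms; the empty free convolution is the point mass at zero. -/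
def IsFreeConvolutionPower (ρ : Measure ℝ) : ℕ → Measure ℝ → Prop
  | 0, μ => μ = Measure.dirac 0
  | n + 1, μ => ∃ ν : Measure ℝ, IsProbabilityMeasure ν ∧
      IsFreeConvolutionPower ρ n ν ∧ IsFreeConvolution ν ρ μ

/-- Free infinite divisibility: for each `n ≥ 1` the probability measure `μ` is the `n`-fold free
convolution of some probability measure with itself. -/
def IsFreelyInfinitelyDivisible (μ : Measure ℝ) : Prop :=
  IsProbabilityMeasure μ ∧
    ∀ n : ℕ, 1 ≤ n → ∃ ρ : Measure ℝ, IsProbabilityMeasure ρ ∧ IsFreeConvolutionPower ρ n μ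

/-- The density `√((b-x)(x-a)) / x * ∑ k, α k / x ^ (l k)` on `(a, b)`, extended by zero. -/
def gpfpDensity (a b : ℝ) (N : ℕ) (α l : Fin N → ℝ) (x : ℝ) : ℝ :=
  (Ioo a b).indicator
    (fun x => Real.sqrt ((b - x) * (x - a)) / x * ∑ k, α k / x ^ (l k)) x

/-- The measure `GPFP(a, b, N, α, l)` on the real line. -/
def gpfp (a b : ℝ) (N : ℕ) (α l : Fin N → ℝ) : Measure ℝ :=
  volume.withDensity fun x => ENNReal.ofReal (gpfpDensity a b N α l x)

end

end FreeProb

/-!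
Put `q = 1 / r`. The law `μ` of `X ^ r` lives on `[A, B]` with `A = a ^ r`, `B = b ^ r`, and its
density extends from `(A, B)` to a function `g`, holomorphic off the real axis, which in terms of
`ζ = z ^ q` is `q √(b - ζ) √(ζ - a) ∑ α_k z ^ (-(1 + q l_k))`. The Cauchy transform `G` on the upper
half-plane therefore continues through `(A, B)` to a function `H`, and `H = G - 2πi g` below the
real axis (`HasContinuedDensity.exists_continuation`). Let `D` be the upper half-plane joined
through `(A, B)` to the sector `-θ < arg z < 0` with `θ = π / (1 + q t)`, the angle at which the
power `z ^ (-(1 + q t))` has turned by `π`.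

The map `H` on `D` is proper over the lower half-plane. From above this is because the density
vanishes at the endpoints of `[A, B]`. From below, `Im G > 0` gives `Im H ≥ -2π Re g`, and `Re g` is
asymptotically nonpositive along `∂D`: it vanishes on the real axis outside `(A, B)` and tends to
zero at infinity, and on the ray `arg z = -θ` the condition `l_k ∈ [t, t + 1]` puts the argument of
each term of `g` into `[π / 2, 3π / 2]` (`PowerParams.re_logDensity_nonpos_of_ray`). At the vertex
`|g|` explodes while `G` is bounded.

A proper holomorphic map takes all values equally often, so univalence needs only one value (here,
uncountably many, which allows critical values to be avoided) that is taken once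
(`ProperOver.exists_inverse`). Values far down the imaginary axis are taken only near the vertex,
where `H` is a constant times `z ^ (-p)` up to a factor near `1`, with `p = 1 + q max l_k`. As
`p θ ≤ 2π`, the branch of the logarithm is determined and the preimage is unique
(`PowerParams.exists_unique_preimage`). So `H` has a univalent inverse on the lower half-plane that
extends the right inverse of `G`, and `μ` is in UI.

For free infinite divisibility, the inverse `h` gives `φ z = h (1 / z) - z` on the upper half-plane,
with `Im φ ≤ 0` because `Im (1 / G z) ≥ Im z`. For `0 < s ≤ 1` the map `z + s φ z` is proper over
the upper half-plane and has a univalent inverse `F` by the same principle; a Cauchy integral and a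
compactness argument show that `1 / F` is the Cauchy transform of a probability measure
(`exists_measure_cauchyTransform_eq`). These measures have Voiculescu transforms `s φ`, and those
with `s = k / n` are the free convolution powers of the one with `s = 1 / n`.
-/

namespace FreeProb

open Filter Topology ComplexConjugate

/-! ### Proper holomorphic maps with one uniqueness value are univalent -/

/-- `H` is proper over `V` as a map on `D`: an ultrafilter on `D` along which `H` converges to a
point of `V` converges to a point of `D`. -/
def ProperOver (H : ℂ → ℂ) (D V : Set ℂ) : Prop :=
  ∀ F : Ultrafilter ℂ, D ∈ F → ∀ w ∈ V, Tendsto H F (𝓝 w) → ∃ z ∈ D, (F : Filter ℂ) ≤ 𝓝 z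

/-- A holomorphic function on a connected set that is not identically zero has countably many zeros:
they form a discrete subspace of the plane. -/
theorem countable_setOf_eq_zero {f : ℂ → ℂ} {D : Set ℂ} (hf : AnalyticOnNhd ℂ f D)
    (hD : IsPreconnected D) (hne : ∃ z ∈ D, f z ≠ 0) : {z ∈ D | f z = 0}.Countable := by
  set Z := {z ∈ D | f z = 0}
  have hdisc : DiscreteTopology Z := by
    rw [discreteTopology_subtype_iff]
    intro z hz
    rw [← disjoint_iff, Filter.disjoint_principal_right]
    rcases (hf z hz.1).eventually_eq_zero_or_eventually_ne_zero with h | h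
    · obtain ⟨z', hz', hne'⟩ := hne
      exact absurd (hf.eqOn_zero_of_preconnected_of_eventuallyEq_zero hD hz.1 h hz') hne'
    · filter_upwards [h] with y hy hyZ using hy hyZ.2
  exact (HereditarilyLindelofSpace.isLindelof Z).countable hdisc

/-- A non-constant holomorphic map on a connected domain `D` that is proper over `V`, and takes the
values of some uncountable set `T ⊆ V` at most once, is a bijection from `D ∩ H ⁻¹' V` onto `V`
with holomorphic inverse. Properness makes the image closed in `V`, hence all of `V`; it also makes
the set of multiple values open and, away from the countable set of critical values, closed. As `V`
minus a countable set is connected, multiple values would be everything but a countable set, which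
`T` excludes; being open, the set of multiple values is then empty. -/
theorem ProperOver.exists_inverse {H : ℂ → ℂ} {D V T : Set ℂ} (hP : ProperOver H D V)
    (hDo : IsOpen D) (hDc : IsPreconnected D) (hH : DifferentiableOn ℂ H D) (hV : IsOpen V)
    (hVc : ∀ C : Set ℂ, C.Countable → IsPreconnected (V \ C))
    (hne : ∃ z ∈ D, H z ∈ V) (hnc : ¬ ∃ c, ∀ z ∈ D, H z = c)
    (hT : ¬ T.Countable) (hTV : T ⊆ V)
    (hT1 : ∀ z₁ ∈ D, ∀ z₂ ∈ D, H z₁ ∈ T → H z₁ = H z₂ → z₁ = z₂) :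
    InjOn H (D ∩ H ⁻¹' V) ∧
      ∃ h : ℂ → ℂ, AnalyticOnNhd ℂ h V ∧ ∀ w ∈ V, h w ∈ D ∧ H (h w) = w := by
  have hA : AnalyticOnNhd ℂ H D := hH.analyticOnNhd hDo
  have hopen : ∀ s ⊆ D, IsOpen s → IsOpen (H '' s) :=
    (hA.is_constant_or_isOpen hDc).resolve_left hnc
  have hcont : ∀ z ∈ D, ContinuousAt H z := fun z hz => (hA z hz).continuousAt
  have hsurj : V ⊆ H '' D := by
    have hVp : IsPreconnected V := by simpa using hVc ∅ countable_empty
    refine hVp.subset_of_closure_inter_subset (hopen D subset_rfl hDo) ?_ ?_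
    · obtain ⟨z, hz, hzV⟩ := hne
      exact ⟨H z, hzV, z, hz, rfl⟩
    · rintro w ⟨hw, hwV⟩
      obtain ⟨G, hG, hGw⟩ := mem_closure_iff_ultrafilter.1 hw
      have : (comap H G ⊓ 𝓟 D).NeBot := by
        rw [← Filter.map_neBot_iff H, Filter.push_pull']
        rw [Filter.map_principal]
        have : (G : Filter ℂ) ⊓ 𝓟 (H '' D) = G := inf_eq_left.2 (by simpa using hG)
        rw [this]; infer_instance
      have hF := Ultrafilter.of_le (comap H (G : Filter ℂ) ⊓ 𝓟 D)
      have hF1 : D ∈ Ultrafilter.of (comap H (G : Filter ℂ) ⊓ 𝓟 D) :=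
        hF (mem_inf_of_right (mem_principal_self D))
      have hF2 : Tendsto H (Ultrafilter.of (comap H (G : Filter ℂ) ⊓ 𝓟 D)) (𝓝 w) :=
        (tendsto_comap.mono_left (hF.trans inf_le_left)).mono_right hGw
      obtain ⟨z, hz, hle⟩ := hP _ hF1 w hwV hF2
      exact ⟨z, hz, tendsto_nhds_unique ((hcont z hz).tendsto.mono_left hle) hF2⟩
  have hdA : AnalyticOnNhd ℂ (deriv H) D := hA.deriv
  set Z := {z ∈ D | deriv H z = 0} with hZ
  have hZc : Z.Countable := by
    refine countable_setOf_eq_zero hdA hDc ?_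
    by_contra! hcon
    refine hnc ?_
    exact hDo.exists_is_const_of_deriv_eq_zero hDc hH hcon
  have hCc : (H '' Z).Countable := hZc.image H
  set S := {w ∈ V | ∃ z₁ ∈ D, ∃ z₂ ∈ D, z₁ ≠ z₂ ∧ H z₁ = w ∧ H z₂ = w} with hS
  have hSo : IsOpen S := by
    rw [isOpen_iff_mem_nhds]
    rintro w ⟨hwV, z₁, hz₁, z₂, hz₂, hne12, h1, h2⟩
    obtain ⟨u, v, hu, hv, hzu, hzv, huv⟩ := t2_separation hne12
    have e1 : H '' (D ∩ u) ∈ 𝓝 w :=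
      (hopen _ inter_subset_left (hDo.inter hu)).mem_nhds ⟨z₁, ⟨hz₁, hzu⟩, h1⟩
    have e2 : H '' (D ∩ v) ∈ 𝓝 w :=
      (hopen _ inter_subset_left (hDo.inter hv)).mem_nhds ⟨z₂, ⟨hz₂, hzv⟩, h2⟩
    filter_upwards [hV.mem_nhds hwV, e1, e2]
    rintro y hyV ⟨x₁, ⟨hx₁, hx₁u⟩, e₁⟩ ⟨x₂, ⟨hx₂, hx₂v⟩, e₂⟩
    refine ⟨hyV, x₁, hx₁, x₂, hx₂, ?_, e₁, e₂⟩
    rintro rfl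
    exact huv.le_bot ⟨hx₁u, hx₂v⟩
  have hloc : ∀ z ∈ D, H z ∉ H '' Z → ∃ u ∈ 𝓝 z, InjOn H u := by
    intro z hz hzZ
    have hd : deriv H z ≠ 0 := fun h0 => hzZ ⟨z, ⟨hz, h0⟩, rfl⟩
    have hs : HasStrictDerivAt H (deriv H z) z := (hA z hz).hasStrictDerivAt
    refine ⟨_, (hs.hasStrictFDerivAt_equiv hd).eventually_left_inverse, ?_⟩
    intro x hx y hy hxy
    rw [← hx, hxy, hy]
  -- distinct preimages converge along an ultrafilter; a common limit would be a critical point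
  have hScl : ∀ w ∈ V \ H '' Z, w ∈ closure S → w ∈ S := by
    rintro w ⟨hwV, hwZ⟩ hw
    obtain ⟨G, hG, hGw⟩ := mem_closure_iff_ultrafilter.1 hw
    choose! a ha b hb hab hHa hHb using fun y (hy : y ∈ S) => hy.2
    have key : ∀ c : ℂ → ℂ, (∀ y ∈ S, c y ∈ D) → (∀ y ∈ S, H (c y) = y) →
        ∃ z ∈ D, Tendsto c G (𝓝 z) ∧ H z = w := by
      intro c hc hHc
      have t : Tendsto H (G.map c) (𝓝 w) := by
        rw [Ultrafilter.coe_map, tendsto_map'_iff]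
        refine (tendsto_id.mono_right hGw).congr' ?_
        filter_upwards [hG] with y hy using (hHc y hy).symm
      obtain ⟨z, hz, hle⟩ := hP (G.map c) (by
        rw [Ultrafilter.mem_map]; filter_upwards [hG] with y hy using hc y hy) w hwV t
      exact ⟨z, hz, hle, tendsto_nhds_unique ((hcont z hz).tendsto.mono_left hle) t⟩
    obtain ⟨z₁, hz₁, t₁, e₁⟩ := key a ha hHa
    obtain ⟨z₂, hz₂, t₂, e₂⟩ := key b hb hHb
    refine ⟨hwV, z₁, hz₁, z₂, hz₂, ?_, e₁, e₂⟩
    rintro rfl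
    obtain ⟨u, hu, hinj⟩ := hloc z₁ hz₁ (by rwa [e₁])
    have : ∀ᶠ y in (G : Filter ℂ), False := by
      filter_upwards [hG, t₁ hu, t₂ hu] with y hy h1 h2
      exact hab y hy (hinj h1 h2 ((hHa y hy).trans (hHb y hy).symm))
    exact G.neBot.ne (by simpa using this)
  -- an open set of multiple values inside a countable set is empty
  have hS0 : S = ∅ := by
    have hsub : S ⊆ H '' Z := by
      by_contra hcon
      obtain ⟨w, hwS, hwZ⟩ := not_subset.1 hcon
      have hall : V \ H '' Z ⊆ S :=
        (hVc _ hCc).subset_of_closure_inter_subset hSo ⟨w, ⟨hwS.1, hwZ⟩, hwS⟩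
          fun y hy => hScl y hy.2 hy.1
      refine hT (hCc.mono fun y hy => ?_)
      by_contra hyZ
      obtain ⟨-, z₁, hz₁, z₂, hz₂, hne12, h1, h2⟩ := hall ⟨hTV hy, hyZ⟩
      exact hne12 (hT1 z₁ hz₁ z₂ hz₂ (h1 ▸ hy) (h1.trans h2.symm))
    by_contra hcon
    obtain ⟨w, hw⟩ := nonempty_iff_ne_empty.2 hcon
    have := (hCc.mono hsub).dense_compl ℝ
    obtain ⟨y, hyS, hyc⟩ := this.inter_open_nonempty S hSo ⟨w, hw⟩
    exact hyc hyS
  have hinj : ∀ z₁ ∈ D, ∀ z₂ ∈ D, H z₁ ∈ V → H z₁ = H z₂ → z₁ = z₂ := by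
    intro z₁ hz₁ z₂ hz₂ h1 h12
    by_contra hne12
    have : H z₁ ∈ S := ⟨h1, z₁, hz₁, z₂, hz₂, hne12, rfl, h12.symm⟩
    rw [hS0] at this
    exact this
  refine ⟨fun z₁ hz₁ z₂ hz₂ h12 => hinj z₁ hz₁.1 z₂ hz₂.1 hz₁.2 h12, ?_⟩
  have hsurj' : ∀ w ∈ V, ∃ z ∈ D, H z = w := fun w hw => hsurj hw
  choose! h hhD hhH using hsurj'
  refine ⟨h, ?_, fun w hw => ⟨hhD w hw, hhH w hw⟩⟩
  have hhc : ∀ w ∈ V, ContinuousAt h w := by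
    intro w hw N hN
    have : H '' (D ∩ interior N) ∈ 𝓝 w :=
      (hopen _ inter_subset_left (hDo.inter isOpen_interior)).mem_nhds
        ⟨h w, ⟨hhD _ hw, mem_interior_iff_mem_nhds.2 hN⟩, hhH _ hw⟩
    rw [mem_map]
    filter_upwards [this, hV.mem_nhds hw]
    rintro y ⟨x, ⟨hxD, hxN⟩, rfl⟩ hy
    have : h (H x) = x := hinj _ (hhD _ hy) x hxD (by rwa [hhH _ hy]) (hhH _ hy)
    rw [mem_preimage, this]
    exact interior_subset hxN
  have hhd : ∀ w ∈ V \ H '' Z, DifferentiableAt ℂ h w := by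
    rintro w ⟨hwV, hwZ⟩
    have hd : deriv H (h w) ≠ 0 := fun h0 => hwZ ⟨h w, ⟨hhD _ hwV, h0⟩, hhH _ hwV⟩
    refine (HasDerivAt.of_local_left_inverse (hhc w hwV)
      (hA _ (hhD _ hwV)).differentiableAt.hasDerivAt hd ?_).differentiableAt
    filter_upwards [hV.mem_nhds hwV] with y hy using hhH _ hy
  -- the exceptional countable set of critical values is removable
  intro w hw
  obtain ⟨r, hr, hball⟩ := Metric.nhds_basis_closedBall.mem_iff.1 (hV.mem_nhds hw)
  lift r to NNReal using hr.le
  refine (Complex.hasFPowerSeriesOnBall_of_differentiable_off_countable hCc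
    (fun y hy => (hhc y (hball hy)).continuousWithinAt) (fun y hy => hhd y ⟨hball
      (Metric.ball_subset_closedBall hy.1), hy.2⟩) (by exact_mod_cast hr)).analyticAt

/-- Removing countably many points from a half-plane leaves a connected set. -/
theorem isPreconnected_halfPlane_diff {C : Set ℂ} (hC : C.Countable) {σ : ℝ} (hσ : σ ≠ 0) :
    IsPreconnected ({z : ℂ | 0 < σ * z.im} \ C) := by
  -- the half-plane is homeomorphic to the plane, whose countable subsets have connected complement
  let e : ℂ → ℂ := fun z => ⟨z.re, Real.exp z.im / σ⟩
  have he : Continuous e := by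
    have : e = fun z => (z.re : ℂ) + ((Real.exp z.im / σ : ℝ) : ℂ) * Complex.I := by
      funext z
      apply Complex.ext <;> simp [e, -Complex.ofReal_exp]
    rw [this]
    fun_prop
  have hinj : Function.Injective e := by
    intro z w h
    have h1 := congrArg Complex.re h
    have h2 := congrArg Complex.im h
    simp only [e] at h1 h2
    rw [div_left_inj' hσ] at h2
    exact Complex.ext h1 (Real.exp_injective h2)
  have himg : {z : ℂ | 0 < σ * z.im} \ C = e '' (e ⁻¹' C)ᶜ := by
    ext z
    constructor
    · rintro ⟨hz, hzC⟩
      have : e ⟨z.re, Real.log (σ * z.im)⟩ = z := by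
        apply Complex.ext
        · rfl
        · simp only [e]
          rw [Real.exp_log hz]
          field_simp
      exact ⟨_, by rwa [mem_compl_iff, mem_preimage, this], this⟩
    · rintro ⟨y, hy, rfl⟩
      refine ⟨?_, hy⟩
      have : σ * (e y).im = Real.exp y.im := by simp only [e]; field_simp
      show 0 < σ * (e y).im
      rw [this]; positivity
  rw [himg]
  refine ((hC.preimage_of_injOn hinj.injOn).isConnected_compl_of_one_lt_rank
    (by simp)).isPreconnected.image e he.continuousOn

/-! ### Cauchy integrals over the boundary of a half-plane -/

theorem integrable_of_norm_le_div_sq {f : ℝ → ℂ} (hf : Continuous f) {R C : ℝ}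
    (hb : ∀ x, R ≤ |x| → ‖f x‖ ≤ C / x ^ 2) : Integrable f := by
  refine hf.locallyIntegrable.integrable_of_isBigO_cocompact (g := fun x => (1 + x ^ 2)⁻¹) ?_
    (integrable_inv_one_add_sq.integrableAtFilter _)
  refine Asymptotics.IsBigO.of_bound (2 * |C|) ?_
  have h1 : ∀ᶠ x : ℝ in cocompact ℝ, max R 1 ≤ ‖x‖ :=
    tendsto_norm_cocompact_atTop.eventually_ge_atTop _
  filter_upwards [h1] with x hx
  rw [Real.norm_eq_abs] at hx
  have hx1 : 1 ≤ x ^ 2 := by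
    rw [← sq_abs]; nlinarith [le_max_right R 1, abs_nonneg x]
  refine (hb x ((le_max_left _ _).trans hx)).trans ?_
  rw [Real.norm_of_nonneg (by positivity), ← div_eq_mul_inv, div_le_div_iff₀ (by positivity)
    (by positivity)]
  nlinarith [le_abs_self C, abs_nonneg C]

/-- Cauchy's theorem for a half-plane. -/
theorem integral_eq_zero_of_norm_le_div_sq {f : ℂ → ℂ} {δ R C : ℝ} (hδ : 0 < δ)
    (hf : DifferentiableOn ℂ f {z | -δ < z.im})
    (hb : ∀ z : ℂ, 0 ≤ z.im → R ≤ ‖z‖ → ‖f z‖ ≤ C / ‖z‖ ^ 2) :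
    ∫ x : ℝ, f x = 0 := by
  have hcont : Continuous fun x : ℝ => f x := by
    rw [← continuousOn_univ]
    refine hf.continuousOn.comp Complex.continuous_ofReal.continuousOn fun x _ => ?_
    simpa using hδ
  have hint : Integrable fun x : ℝ => f x := by
    refine integrable_of_norm_le_div_sq hcont (R := R) (C := C) fun x hx => ?_
    simpa using hb x (by simp) (by simpa using hx)
  have hlim := intervalIntegral_tendsto_integral hint tendsto_neg_atTop_atBot tendsto_id
  refine tendsto_nhds_unique hlim (squeeze_zero_norm' (a := fun T : ℝ => 4 * |C| / T) ?_
    (tendsto_const_nhds.div_atTop tendsto_id))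
  filter_upwards [eventually_ge_atTop (max R 1)] with T hT
  have hT1 : 1 ≤ T := (le_max_right _ _).trans hT
  have hTR : R ≤ T := (le_max_left _ _).trans hT
  -- the three other sides of the square `[-T, T] × [0, T]` contribute `O(1 / T)`
  have hrect := Complex.integral_boundary_rect_eq_zero_of_differentiableOn f ⟨-T, 0⟩ ⟨T, T⟩
    (hf.mono (by
      rintro z ⟨-, hz⟩
      simp only [mem_preimage, uIcc_of_le (zero_le_one.trans hT1), mem_Icc] at hz
      simp only [mem_ofPred_eq]
      linarith [hz.1]))
  have hbd : ∀ z : ℂ, 0 ≤ z.im → T ≤ ‖z‖ → ‖f z‖ ≤ |C| / T ^ 2 := by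
    intro z hz hzT
    refine (hb z hz (hTR.trans hzT)).trans ?_
    gcongr
    exact le_abs_self C
  have htop : ‖∫ x : ℝ in (-T)..T, f (x + T * Complex.I)‖ ≤ |C| / T ^ 2 * |T - -T| := by
    refine intervalIntegral.norm_integral_le_of_norm_le_const fun x _ => hbd _ (by simp; linarith) ?_
    refine le_trans ?_ (Complex.abs_im_le_norm _)
    simp [abs_of_nonneg (zero_le_one.trans hT1)]
  have hside : ∀ s : ℝ, |s| = T →
      ‖∫ y : ℝ in (0 : ℝ)..T, f (s + y * Complex.I)‖ ≤ |C| / T ^ 2 * |T - 0| := by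
    intro s hs
    refine intervalIntegral.norm_integral_le_of_norm_le_const fun y hy => hbd _ ?_ ?_
    · rw [uIoc_of_le (zero_le_one.trans hT1)] at hy
      simpa using hy.1.le
    · refine le_trans ?_ (Complex.abs_re_le_norm _)
      simp [hs]
  have h1 := hside T (abs_of_nonneg (zero_le_one.trans hT1))
  have h2 := hside (-T) (by rw [abs_neg, abs_of_nonneg (zero_le_one.trans hT1)])
  have heq : ∫ x : ℝ in (-T)..T, f x = (∫ x : ℝ in (-T)..T, f (x + T * Complex.I))
      - Complex.I • (∫ y : ℝ in (0 : ℝ)..T, f (T + y * Complex.I))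
      + Complex.I • ∫ y : ℝ in (0 : ℝ)..T, f ((-T : ℝ) + y * Complex.I) := by
    simp only [Complex.ofReal_zero, zero_mul, add_zero] at hrect
    linear_combination hrect
  simp only [id]
  rw [heq]
  refine (norm_add_le _ _).trans ((add_le_add_left (norm_sub_le _ _) _).trans ?_)
  rw [norm_smul, norm_smul, Complex.norm_I, one_mul, one_mul]
  have e1 : |T - -T| = 2 * T := by rw [abs_of_nonneg] <;> linarith
  have e2 : |T - 0| = T := by rw [sub_zero, abs_of_nonneg]; linarith
  rw [e1] at htop
  rw [e2] at h1 h2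
  have e3 : |C| / T ^ 2 * T = |C| / T := by field_simp
  have e4 : |C| / T ^ 2 * (2 * T) = 2 * (|C| / T) := by field_simp
  rw [e3] at h1 h2
  rw [e4] at htop
  have : 4 * |C| / T = 4 * (|C| / T) := by ring
  rw [this]
  linarith

theorem integral_poisson_kernel (u : ℝ) {v : ℝ} (hv : 0 < v) :
    ∫ x : ℝ, v / ((x - u) ^ 2 + v ^ 2) = Real.pi := by
  rw [integral_sub_right_eq_self (fun x => v / (x ^ 2 + v ^ 2)) u]
  have h := Measure.integral_comp_div (fun x : ℝ => (1 + x ^ 2)⁻¹) v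
  rw [integral_univ_inv_one_add_sq, abs_of_pos hv, smul_eq_mul] at h
  have : (fun x : ℝ => v / (x ^ 2 + v ^ 2)) = fun x => v⁻¹ * (1 + (x / v) ^ 2)⁻¹ := by
    funext x
    have : (1 + (x / v) ^ 2) ≠ 0 := by positivity
    field_simp
    ring
  rw [this, integral_const_mul, h]
  field_simp

/-- A function with decay at infinity that is holomorphic near the closed upper half-plane is the
Cauchy integral of its boundary imaginary part: the Cauchy integral formula at `z` combined with
the conjugate of Cauchy's theorem for the reflected pole `conj z`. -/
theorem eq_integral_im_of_decay {g : ℂ → ℂ} {δ R C : ℝ} (hδ : 0 < δ)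
    (hg : DifferentiableOn ℂ g {z | -δ < z.im})
    (hb : ∀ z : ℂ, 0 ≤ z.im → R ≤ ‖z‖ → ‖g z‖ ≤ C / ‖z‖) {z : ℂ} (hz : 0 < z.im) :
    g z = ∫ x : ℝ, ((-(g x).im / Real.pi : ℝ) : ℂ) * (1 / (z - x)) := by
  have hconj : ∀ w : ℂ, -z.im < w.im → w - conj z ≠ 0 := by
    intro w hw h0
    have := congrArg Complex.im h0
    simp at this
    linarith
  have hxz : ∀ x : ℝ, (x : ℂ) - z ≠ 0 := by
    intro x h0
    have := congrArg Complex.im h0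
    simp at this
    linarith
  have hxz' : ∀ x : ℝ, (x : ℂ) - conj z ≠ 0 := fun x => hconj x (by simpa using hz)
  set δ' := min δ z.im with hδ'
  have hδ'0 : 0 < δ' := lt_min hδ hz
  have hsub : {w : ℂ | -δ' < w.im} ⊆ {w | -δ < w.im} := fun w hw => by
    simp only [mem_ofPred_eq] at hw ⊢
    linarith [min_le_left δ z.im]
  have hsub' : ∀ w : ℂ, -δ' < w.im → w - conj z ≠ 0 := fun w hw => hconj w (by
    linarith [min_le_right δ z.im])
  have hfar : ∀ w : ℂ, 2 * ‖z‖ + 1 ≤ ‖w‖ → 0 < ‖w‖ ∧ ‖w‖ / 2 ≤ ‖w - z‖ ∧ ‖w‖ / 2 ≤ ‖w - conj z‖ := by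
    intro w hw
    have h1 := norm_sub_norm_le w z
    have h2 := norm_sub_norm_le w (conj z)
    rw [Complex.norm_conj] at h2
    have := norm_nonneg z
    refine ⟨by linarith, by linarith, by linarith⟩
  set R' := max (max R 1) (2 * ‖z‖ + 1)
  have hR'R : R ≤ R' := (le_max_left _ _).trans (le_max_left _ _)
  have hR'z : 2 * ‖z‖ + 1 ≤ R' := le_max_right _ _
  have hdec : ∀ k : ℂ → ℂ, ∀ c : ℝ, ∀ w v : ℂ, R' ≤ ‖w‖ → ‖k w‖ ≤ c / ‖w‖ → ‖w‖ / 2 ≤ ‖v‖ →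
      ‖k w / v‖ ≤ 2 * c / ‖w‖ ^ 2 := by
    intro k c w v hw hk hv
    have hw0 := (hfar w (hR'z.trans hw)).1
    rw [norm_div, div_le_div_iff₀ (by linarith) (by positivity)]
    rw [le_div_iff₀ hw0] at hk
    have hc : 0 ≤ c := by nlinarith [norm_nonneg (k w)]
    nlinarith [norm_nonneg (k w)]
  -- the reflected pole contributes nothing
  have hB : ∫ x : ℝ, g x / (x - conj z) = 0 := by
    refine integral_eq_zero_of_norm_le_div_sq (f := fun w => g w / (w - conj z)) (R := R')
      (C := 2 * C) hδ'0 ?_ ?_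
    · exact (hg.mono hsub).div (by fun_prop) hsub'
    · intro w hw hwR
      exact hdec g C w _ hwR (hb w hw (hR'R.trans hwR)) (hfar w (hR'z.trans hwR)).2.2
  -- the pole at `z` is removed by subtracting a multiple of `1 / (w - conj z)`
  set k : ℂ → ℂ := fun w => g w - g z * (z - conj z) / (w - conj z) with hk
  have hkz : k z = 0 := by
    simp only [hk]
    rw [mul_div_assoc, div_self (hconj z (by linarith)), mul_one, sub_self]
  have hkd : DifferentiableOn ℂ k {w | -δ' < w.im} :=
    (hg.mono hsub).sub ((differentiableOn_const _).div (by fun_prop) hsub')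
  have hzmem : {w : ℂ | -δ' < w.im} ∈ 𝓝 z :=
    (isOpen_lt continuous_const Complex.continuous_im).mem_nhds (by
      simp only [mem_ofPred_eq]; linarith)
  have hA : ∫ x : ℝ, dslope k z x = 0 := by
    refine integral_eq_zero_of_norm_le_div_sq (R := R')
      (C := 2 * (C + 2 * ‖g z * (z - conj z)‖)) hδ'0
      ((Complex.differentiableOn_dslope hzmem).2 hkd) ?_
    intro w hw hwR
    have hf := hfar w (hR'z.trans hwR)
    have hwz : w ≠ z := by
      rintro rfl
      have := hf.2.1
      simp at this
      linarith [hf.1]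
    rw [dslope_of_ne _ hwz, slope_def_field, hkz, sub_zero]
    refine hdec k _ w _ hwR ?_ hf.2.1
    have h1 := hb w hw (hR'R.trans hwR)
    have h2 : ‖g z * (z - conj z) / (w - conj z)‖ ≤ 2 * ‖g z * (z - conj z)‖ / ‖w‖ := by
      rw [norm_div, div_le_div_iff₀ (by linarith) hf.1]
      nlinarith [norm_nonneg (g z * (z - conj z))]
    calc ‖k w‖ ≤ _ := norm_sub_le _ _
      _ ≤ C / ‖w‖ + 2 * ‖g z * (z - conj z)‖ / ‖w‖ := add_le_add h1 h2
      _ = _ := by ring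
  have hgc : Continuous fun x : ℝ => g x := by
    rw [← continuousOn_univ]
    refine hg.continuousOn.comp Complex.continuous_ofReal.continuousOn fun x _ => ?_
    simpa using hδ
  have hi1 : Integrable fun x : ℝ => g x / (x - z) := by
    refine integrable_of_norm_le_div_sq (R := R') (C := 2 * C)
      (hgc.div (by fun_prop) hxz) fun x hx => ?_
    have hx' : R' ≤ ‖(x : ℂ)‖ := by simpa using hx
    have := hdec g C x (x - z) hx' (hb x (by simp) (hR'R.trans hx')) (hfar x (hR'z.trans hx')).2.1
    simpa using this
  have hpois : ∀ x : ℝ, (z - conj z) / ((x - conj z) * (x - z)) =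
      ((z.im / ((x - z.re) ^ 2 + z.im ^ 2) : ℝ) : ℂ) * (2 * Complex.I) := by
    intro x
    have h1 : ((x : ℂ) - conj z) * (x - z) = (((x - z.re) ^ 2 + z.im ^ 2 : ℝ) : ℂ) := by
      apply Complex.ext <;> simp [pow_two] <;> ring
    have h2 : z - conj z = (z.im : ℂ) * (2 * Complex.I) := by
      apply Complex.ext <;> simp <;> ring
    rw [h1, h2]
    push_cast
    ring
  have hi2 : Integrable fun x : ℝ => g z * ((z - conj z) / ((x - conj z) * (x - z))) := by
    refine (integrable_of_norm_le_div_sq (R := R') (C := 4 * ‖z - conj z‖)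
      (continuous_const.div (by fun_prop) fun x => mul_ne_zero (hxz' x) (hxz x))
        fun x hx => ?_).const_mul _
    have hx' : R' ≤ ‖(x : ℂ)‖ := by simpa using hx
    obtain ⟨h0, h1, h2⟩ := hfar x (hR'z.trans hx')
    simp only [Pi.div_apply]
    rw [norm_div, norm_mul, ← sq_abs x, ← Real.norm_eq_abs x, ← Complex.norm_real,
      div_le_div_iff₀ (mul_pos (by linarith) (by linarith)) (by positivity)]
    have := mul_le_mul h1 h2 (by positivity) (norm_nonneg _)
    nlinarith [norm_nonneg (z - conj z)]
  have hA' : ∫ x : ℝ, g x / (x - z) = 2 * Real.pi * Complex.I * g z := by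
    have h1 : ∀ x : ℝ, dslope k z x =
        g x / (x - z) - g z * ((z - conj z) / ((x - conj z) * (x - z))) := by
      intro x
      rw [dslope_of_ne _ (sub_ne_zero.1 (hxz x)), slope_def_field, hkz, sub_zero]
      simp only [hk]
      field_simp [hxz x, hxz' x]
    simp_rw [h1] at hA
    rw [integral_sub hi1 hi2, sub_eq_zero] at hA
    rw [hA, integral_const_mul]
    simp_rw [hpois]
    rw [integral_mul_const, integral_complex_ofReal, integral_poisson_kernel z.re hz]
    ring
  have hB' : ∫ x : ℝ, conj (g x) / (x - z) = 0 := by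
    have h1 : ∀ x : ℝ, conj (g x) / (x - z) = conj (g x / (x - conj z)) := by
      intro x; simp
    simp_rw [h1]
    rw [integral_conj, hB, map_zero]
  have hi3 : Integrable fun x : ℝ => conj (g x) / (x - z) := by
    refine integrable_of_norm_le_div_sq (R := R') (C := 2 * C)
      ((Complex.continuous_conj.comp hgc).div (by fun_prop) hxz) fun x hx => ?_
    have hx' : R' ≤ ‖(x : ℂ)‖ := by simpa using hx
    have := hdec g C x (x - z) hx' (hb x (by simp) (hR'R.trans hx')) (hfar x (hR'z.trans hx')).2.1
    simpa using this
  have h2 : ∀ x : ℝ, ((-(g x).im / Real.pi : ℝ) : ℂ) * (1 / (z - x)) =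
      (2 * Real.pi * Complex.I)⁻¹ * (g x / (x - z) - conj (g x) / (x - z)) := by
    intro x
    have hsub : g x - conj (g x) = ((g x).im : ℂ) * (2 * Complex.I) := by
      apply Complex.ext <;> simp <;> ring
    rw [← sub_div, hsub, ← neg_sub (x : ℂ) z]
    have := hxz x
    have hpi : (Real.pi : ℂ) ≠ 0 := by exact_mod_cast Real.pi_ne_zero
    push_cast
    field_simp [Complex.I_ne_zero]
  simp_rw [h2]
  rw [integral_const_mul, integral_sub hi1 hi3, hA', hB', sub_zero]
  have hpi : (Real.pi : ℂ) ≠ 0 := by exact_mod_cast Real.pi_ne_zero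
  field_simp [Complex.I_ne_zero]

/-! ### Cauchy transforms of probability measures from their analytic properties -/

theorem sub_ofReal_ne_zero {z : ℂ} (hz : z.im ≠ 0) (x : ℝ) : z - (x : ℂ) ≠ 0 := by
  intro h0
  have := congrArg Complex.im h0
  simp at this
  exact hz this

theorem norm_one_div_sub_le {z : ℂ} (hz : z.im ≠ 0) (x : ℝ) : ‖1 / (z - (x : ℂ))‖ ≤ 1 / |z.im| := by
  rw [norm_div, norm_one]
  refine one_div_le_one_div_of_le (abs_pos.2 hz) ?_
  simpa using Complex.abs_im_le_norm (z - x)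

theorem continuous_one_div_sub {z : ℂ} (hz : z.im ≠ 0) : Continuous fun x : ℝ => 1 / (z - (x : ℂ)) :=
  continuous_const.div (by fun_prop) (sub_ofReal_ne_zero hz)

theorem integrable_one_div_sub (μ : Measure ℝ) [IsFiniteMeasure μ] {z : ℂ} (hz : z.im ≠ 0) :
    Integrable (fun x : ℝ => 1 / (z - (x : ℂ))) μ :=
  Integrable.of_bound (continuous_one_div_sub hz).aestronglyMeasurable (1 / |z.im|)
    (ae_of_all _ (norm_one_div_sub_le hz))

theorem im_one_div_sub (z : ℂ) (x : ℝ) :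
    (1 / (z - (x : ℂ))).im = -z.im / ‖z - x‖ ^ 2 := by
  rw [one_div, Complex.inv_im, Complex.normSq_eq_norm_sq]
  simp

theorem tendsto_mul_cauchyTransform (μ : Measure ℝ) [IsFiniteMeasure μ] :
    Tendsto (fun y : ℝ => (y * Complex.I : ℂ) * cauchyTransform μ (y * Complex.I)) atTop
      (𝓝 (μ.real univ : ℂ)) := by
  have h : ∀ y : ℝ, (y * Complex.I : ℂ) * cauchyTransform μ (y * Complex.I) =
      ∫ x : ℝ, (y * Complex.I : ℂ) * (1 / (y * Complex.I - x)) ∂μ := by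
    intro y; rw [cauchyTransform, integral_const_mul]
  simp_rw [h]
  have h1 : (μ.real univ : ℂ) = ∫ _ : ℝ, (1 : ℂ) ∂μ := by simp
  rw [h1]
  refine tendsto_integral_filter_of_dominated_convergence (fun _ => 1) ?_ ?_
    (integrable_const _) ?_
  · filter_upwards [eventually_gt_atTop 0] with y hy
    exact ((continuous_one_div_sub (z := y * Complex.I) (by simpa using hy.ne')).const_mul
      _).aestronglyMeasurable
  · filter_upwards [eventually_gt_atTop 0] with y hy
    refine ae_of_all _ fun x => ?_
    have h1 := norm_one_div_sub_le (z := y * Complex.I) (by simpa using hy.ne') x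
    rw [norm_mul]
    have h2 : ‖(y * Complex.I : ℂ)‖ = y := by simp [abs_of_pos hy]
    have h3 : |(y * Complex.I : ℂ).im| = y := by simp [abs_of_pos hy]
    rw [h3] at h1
    rw [h2]
    calc y * _ ≤ y * (1 / y) := by gcongr
      _ = 1 := by field_simp
  · refine ae_of_all _ fun x => ?_
    have h2 : Tendsto (fun y : ℝ => (1 : ℂ) / (1 - x * ((y⁻¹ : ℝ) : ℂ) * (-Complex.I))) atTop
        (𝓝 (1 / (1 - x * ((0 : ℝ) : ℂ) * (-Complex.I)))) := by
      refine tendsto_const_nhds.div (tendsto_const_nhds.sub ((tendsto_const_nhds.mul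
        ((Complex.continuous_ofReal.tendsto _).comp tendsto_inv_atTop_zero)).mul_const _)) ?_
      simp
    simp only [Complex.ofReal_zero, mul_zero, zero_mul, sub_zero, div_one] at h2
    refine h2.congr' ?_
    filter_upwards [eventually_gt_atTop 0] with y hy
    have hy' : (y : ℂ) ≠ 0 := by exact_mod_cast hy.ne'
    have hne := sub_ofReal_ne_zero (z := y * Complex.I) (by simpa using hy.ne') x
    have e : (y * Complex.I : ℂ) * (1 - x * ((y⁻¹ : ℝ) : ℂ) * (-Complex.I)) = y * Complex.I - x := by
      push_cast
      field_simp
      linear_combination (x : ℂ) * Complex.I_sq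
    have hne' : (1 - x * ((y⁻¹ : ℝ) : ℂ) * (-Complex.I)) ≠ 0 := by
      intro h0; rw [h0, mul_zero] at e; exact hne e.symm
    rw [mul_one_div, div_eq_div_iff hne' hne, ← e]
    ring

/-- The measure with density `-Im g / π` has Cauchy transform `g`; the normalization at `i∞` makes
it a probability measure. -/
theorem exists_measure_of_decay {g : ℂ → ℂ} {δ R C : ℝ} (hδ : 0 < δ)
    (hg : DifferentiableOn ℂ g {z | -δ < z.im})
    (hb : ∀ z : ℂ, 0 ≤ z.im → R ≤ ‖z‖ → ‖g z‖ ≤ C / ‖z‖)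
    (him : ∀ x : ℝ, (g x).im ≤ 0) (himb : ∀ x : ℝ, R ≤ |x| → |(g x).im| ≤ C / x ^ 2)
    (hlim : Tendsto (fun y : ℝ => (y * Complex.I : ℂ) * g (y * Complex.I)) atTop (𝓝 1)) :
    ∃ ρ : Measure ℝ, IsProbabilityMeasure ρ ∧ ∀ z : ℂ, 0 < z.im → cauchyTransform ρ z = g z := by
  have hgc : Continuous fun x : ℝ => g x := by
    rw [← continuousOn_univ]
    refine hg.continuousOn.comp Complex.continuous_ofReal.continuousOn fun x _ => ?_
    simpa using hδ
  have himc : Continuous fun x : ℝ => (g x).im := Complex.continuous_im.comp hgc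
  set d : ℝ → ℝ := fun x => -(g x).im / Real.pi with hd
  have hdc : Continuous d := himc.neg.div_const _
  have hd0 : ∀ x, 0 ≤ d x := fun x => div_nonneg (neg_nonneg.2 (him x)) Real.pi_pos.le
  have hdi : Integrable d := by
    have : Integrable fun x : ℝ => (((g x).im : ℝ) : ℂ) := by
      refine integrable_of_norm_le_div_sq (R := R) (C := C)
        (Complex.continuous_ofReal.comp himc) fun x hx => ?_
      simpa using himb x hx
    have h2 : Integrable fun x : ℝ => (g x).im := by simpa using this.re
    exact h2.neg.div_const _
  set ρ : Measure ℝ := volume.withDensity fun x => ENNReal.ofReal (d x)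
  have hfin : IsFiniteMeasure ρ := isFiniteMeasure_withDensity_ofReal hdi.2
  have hct : ∀ z : ℂ, 0 < z.im → cauchyTransform ρ z = g z := by
    intro z hz
    rw [cauchyTransform, integral_withDensity_eq_integral_toReal_smul
      hdc.measurable.ennreal_ofReal (ae_of_all _ fun _ => ENNReal.ofReal_lt_top),
      eq_integral_im_of_decay hδ hg hb hz]
    refine integral_congr_ae (ae_of_all _ fun x => ?_)
    show (ENNReal.ofReal (d x)).toReal • (1 / (z - (x : ℂ))) = ((d x : ℝ) : ℂ) * (1 / (z - x))
    rw [ENNReal.toReal_ofReal (hd0 x), Complex.real_smul]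
  refine ⟨ρ, ?_, hct⟩
  have h1 := tendsto_mul_cauchyTransform ρ
  have h2 : (ρ.real univ : ℂ) = 1 := by
    refine tendsto_nhds_unique h1 (hlim.congr' ?_)
    filter_upwards [eventually_gt_atTop 0] with y hy
    rw [hct _ (by simpa using hy)]
  have h3 : ρ.real univ = 1 := by exact_mod_cast h2
  exact isProbabilityMeasure_iff_real.2 h3

/-- The imaginary part of the Cauchy transform at `iy` controls the mass outside `[-y, y]`. -/
theorem measureReal_compl_Icc_le (ρ : Measure ℝ) [IsProbabilityMeasure ρ] {y : ℝ} (hy : 0 < y) :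
    ρ.real (Icc (-y) y)ᶜ ≤ 2 * (1 + y * (cauchyTransform ρ (y * Complex.I)).im) := by
  have hyI : (y * Complex.I : ℂ).im ≠ 0 := by simpa using hy.ne'
  have hint := integrable_one_div_sub ρ hyI
  have him : (cauchyTransform ρ (y * Complex.I)).im =
      ∫ x : ℝ, (1 / (y * Complex.I - (x : ℂ))).im ∂ρ := (integral_im hint).symm
  have hint' : Integrable (fun x : ℝ => (1 / (y * Complex.I - (x : ℂ))).im) ρ := hint.im
  have h1 : 1 + y * (cauchyTransform ρ (y * Complex.I)).im =
      ∫ x : ℝ, (1 + y * (1 / (y * Complex.I - (x : ℂ))).im) ∂ρ := by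
    rw [integral_add (integrable_const _) (hint'.const_mul y), integral_const_mul, him]
    simp
  have hval : ∀ x : ℝ, 1 + y * (1 / (y * Complex.I - (x : ℂ))).im = x ^ 2 / (x ^ 2 + y ^ 2) := by
    intro x
    have h2 : ‖(y * Complex.I - (x : ℂ))‖ ^ 2 = x ^ 2 + y ^ 2 := by
      rw [← Complex.normSq_eq_norm_sq, Complex.normSq_apply]; simp; ring
    rw [im_one_div_sub, h2]
    have : x ^ 2 + y ^ 2 ≠ 0 := by positivity
    simp
    field_simp
    ring
  simp_rw [hval] at h1
  have hint2 : Integrable (fun x : ℝ => x ^ 2 / (x ^ 2 + y ^ 2)) ρ := by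
    simp_rw [← hval]
    exact (integrable_const _).add (hint'.const_mul y)
  have h3 := mul_meas_ge_le_integral_of_nonneg (μ := ρ)
    (f := fun x : ℝ => x ^ 2 / (x ^ 2 + y ^ 2)) (ae_of_all _ fun x => by positivity) hint2 (1 / 2)
  have h4 : ρ.real (Icc (-y) y)ᶜ ≤ ρ.real {x : ℝ | 1 / 2 ≤ x ^ 2 / (x ^ 2 + y ^ 2)} := by
    refine measureReal_mono fun x hx => ?_
    have : y ^ 2 < x ^ 2 := by
      by_contra hcon
      exact hx (abs_le.1 (abs_le_of_sq_le_sq (not_lt.1 hcon) hy.le))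
    rw [mem_ofPred_eq, div_le_div_iff₀ (by norm_num) (by positivity)]
    linarith
  rw [h1]
  linarith

/-- A holomorphic map from the upper half-plane to the closed lower half-plane that is `1 / z` up to
`O(1 / z ^ 2)` is the Cauchy transform of a probability measure: the translates `G (z + iε)` are
Cauchy integrals of their boundary values, the resulting measures are tight, and a limit point as
`ε → 0` represents `G`. -/
theorem exists_measure_cauchyTransform_eq {G : ℂ → ℂ} (hG : DifferentiableOn ℂ G {z | 0 < z.im})
    (him : ∀ z : ℂ, 0 < z.im → (G z).im ≤ 0)
    (hb : ∀ ε : ℝ, 0 < ε → ∃ C, ∀ z : ℂ, ε ≤ z.im → ‖G z - 1 / z‖ ≤ C / ‖z‖ ^ 2) :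
    ∃ ρ : Measure ℝ, IsProbabilityMeasure ρ ∧ ∀ z : ℂ, 0 < z.im → cauchyTransform ρ z = G z := by
  have happrox : ∀ ε : ℝ, 0 < ε → ∃ ρ : Measure ℝ, IsProbabilityMeasure ρ ∧
      ∀ z : ℂ, 0 < z.im → cauchyTransform ρ z = G (z + ε * Complex.I) := by
    intro ε hε
    obtain ⟨C, hC⟩ := hb ε hε
    set R := max 1 (2 * ε) with hR
    have key : ∀ z : ℂ, 0 ≤ z.im → R ≤ ‖z‖ →
        ‖G (z + ε * Complex.I) - 1 / (z + ε * Complex.I)‖ ≤ 4 * |C| / ‖z‖ ^ 2 ∧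
        ‖z‖ / 2 ≤ ‖z + ε * Complex.I‖ := by
      intro z hz hzR
      have h0 : 1 ≤ ‖z‖ := (le_max_left _ _).trans hzR
      have h1 : ‖z‖ / 2 ≤ ‖z + ε * Complex.I‖ := by
        have h2 := norm_sub_le (z + ε * Complex.I) (ε * Complex.I)
        have h3 : ‖(ε * Complex.I : ℂ)‖ = ε := by simp [abs_of_pos hε]
        rw [add_sub_cancel_right, h3] at h2
        have := (le_max_right _ _).trans hzR
        linarith
      refine ⟨(hC (z + ε * Complex.I) (by simpa using hz)).trans ?_, h1⟩
      rw [div_le_div_iff₀ (pow_pos (by linarith) 2) (by positivity)]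
      have h4 : ‖z‖ ^ 2 ≤ 4 * ‖z + ε * Complex.I‖ ^ 2 := by nlinarith
      nlinarith [le_abs_self C, abs_nonneg C, sq_nonneg ‖z‖,
        mul_le_mul_of_nonneg_left h4 (abs_nonneg C)]
    have himaps : ∀ z : ℂ, -ε < z.im → 0 < (z + ε * Complex.I).im := fun z hz => by
      simp; linarith
    refine exists_measure_of_decay (g := fun z => G (z + ε * Complex.I)) (R := R)
      (C := 4 * |C| + 4 * ε + 2) hε ?_ ?_ ?_ ?_ ?_
    · exact hG.comp (by fun_prop) fun z hz => himaps z hz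
    · intro z hz hzR
      obtain ⟨h1, h2⟩ := key z hz hzR
      have h0 : 1 ≤ ‖z‖ := (le_max_left _ _).trans hzR
      have h3 : ‖1 / (z + ε * Complex.I)‖ ≤ 2 / ‖z‖ := by
        rw [norm_div, norm_one, div_le_div_iff₀ (by linarith) (by linarith)]; linarith
      have h4 : 4 * |C| / ‖z‖ ^ 2 ≤ 4 * |C| / ‖z‖ := by
        gcongr
        nlinarith
      calc ‖G (z + ε * Complex.I)‖
          ≤ ‖G (z + ε * Complex.I) - 1 / (z + ε * Complex.I)‖ + ‖1 / (z + ε * Complex.I)‖ := by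
            simpa using norm_add_le (G (z + ε * Complex.I) - 1 / (z + ε * Complex.I))
              (1 / (z + ε * Complex.I))
        _ ≤ 4 * |C| / ‖z‖ + 2 / ‖z‖ := add_le_add (h1.trans h4) h3
        _ ≤ (4 * |C| + 4 * ε + 2) / ‖z‖ := by
            rw [← add_div]; gcongr; linarith
    · intro x
      exact him _ (himaps _ (by simpa using hε))
    · intro x hx
      have hx' : R ≤ ‖(x : ℂ)‖ := by simpa using hx
      obtain ⟨h1, h2⟩ := key x (by simp) hx'
      have h0 : 1 ≤ ‖(x : ℂ)‖ := (le_max_left _ _).trans hx'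
      have h3 : |(1 / (x + ε * Complex.I : ℂ)).im| ≤ 4 * ε / ‖(x : ℂ)‖ ^ 2 := by
        rw [one_div, Complex.inv_im, Complex.normSq_eq_norm_sq]
        have e : (x + ε * Complex.I : ℂ).im = ε := by simp
        rw [e, abs_div, abs_neg, abs_of_pos hε, abs_of_nonneg (by positivity),
          div_le_div_iff₀ (pow_pos (by linarith) 2) (by positivity)]
        have h4 : ‖(x : ℂ)‖ ^ 2 ≤ 4 * ‖(x + ε * Complex.I : ℂ)‖ ^ 2 := by nlinarith
        nlinarith
      have h5 := (Complex.abs_im_le_norm _).trans h1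
      rw [Complex.sub_im] at h5
      have h6 := abs_sub_abs_le_abs_sub (G (x + ε * Complex.I)).im
        (1 / (x + ε * Complex.I : ℂ)).im
      have e2 : x ^ 2 = ‖(x : ℂ)‖ ^ 2 := by simp
      rw [e2]
      calc |(G (x + ε * Complex.I)).im| ≤ 4 * |C| / ‖(x : ℂ)‖ ^ 2 + 4 * ε / ‖(x : ℂ)‖ ^ 2 := by
            linarith
        _ ≤ _ := by
            rw [← add_div]
            exact div_le_div_of_nonneg_right (by linarith) (by positivity)
    · have h1 : Tendsto (fun y : ℝ => 4 * |C| / y) atTop (𝓝 0) :=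
        tendsto_const_nhds.div_atTop tendsto_id
      have h2 : Tendsto (fun y : ℝ => (y * Complex.I : ℂ) * (G (y * Complex.I + ε * Complex.I) -
          1 / (y * Complex.I + ε * Complex.I))) atTop (𝓝 0) := by
        refine squeeze_zero_norm' ?_ h1
        filter_upwards [eventually_ge_atTop R] with y hy
        have hy0 : 0 < y := lt_of_lt_of_le one_pos ((le_max_left _ _).trans hy)
        have hn : ‖(y * Complex.I : ℂ)‖ = y := by simp [abs_of_pos hy0]
        have := (key (y * Complex.I) (by simpa using hy0.le) (by rwa [hn])).1
        rw [hn] at this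
        rw [norm_mul, hn]
        calc y * _ ≤ y * (4 * |C| / y ^ 2) := by gcongr
          _ = _ := by field_simp
      have h3 : Tendsto (fun y : ℝ => ((1 - ε / (y + ε) : ℝ) : ℂ)) atTop (𝓝 ((1 - 0 : ℝ) : ℂ)) :=
        (Complex.continuous_ofReal.tendsto _).comp (tendsto_const_nhds.sub
          (tendsto_const_nhds.div_atTop (tendsto_atTop_add_const_right _ _ tendsto_id)))
      have h4 := h2.add h3
      simp only [sub_zero, Complex.ofReal_one, zero_add] at h4
      refine h4.congr' ?_
      filter_upwards [eventually_gt_atTop 0] with y hy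
      have e1 : (y + ε : ℂ) ≠ 0 := by
        have : y + ε ≠ 0 := by positivity
        exact_mod_cast this
      have e2 : (y * Complex.I + ε * Complex.I : ℂ) = (y + ε) * Complex.I := by ring
      rw [e2]
      push_cast
      field_simp [Complex.I_ne_zero]
      ring
  choose! ρ hρ1 hρ2 using happrox
  -- tightness: the mass of every approximant outside `[-y, y]` is at most `2 (1 + |C|) / y`
  obtain ⟨C, hC⟩ := hb 1 one_pos
  have hεpos : ∀ n : ℕ, (0 : ℝ) < 1 / (n + 1) := fun n => by positivity
  set m : ℕ → ProbabilityMeasure ℝ := fun n => ⟨ρ (1 / (n + 1)), hρ1 _ (hεpos n)⟩ with hm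
  set u : ℕ → NNReal := fun k => (2 * (1 + |C|) / (k + 1)).toNNReal with hu
  have hu0 : Tendsto u atTop (𝓝 0) := by
    rw [← Real.toNNReal_zero]
    refine (continuous_real_toNNReal.tendsto _).comp ?_
    exact tendsto_const_nhds.div_atTop (tendsto_atTop_add_const_right _ _ tendsto_natCast_atTop_atTop)
  have hcomp := isCompact_setOfPred_probabilityMeasure_mass_eq_compl_isCompact_le
    (K := fun k : ℕ => Icc (-((k : ℝ) + 1)) (k + 1)) hu0 (fun _ => isCompact_Icc)
    (Or.inl inferInstance)
  have hmem : ∀ n, m n ∈ {μ : ProbabilityMeasure ℝ |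
      ∀ k : ℕ, μ (Icc (-((k : ℝ) + 1)) (k + 1))ᶜ ≤ u k} := by
    intro n k
    set y : ℝ := k + 1 with hy
    have hy1 : 1 ≤ y := by simp [hy]
    set ε : ℝ := 1 / (n + 1) with hε
    have hε0 : 0 < ε := hεpos n
    have hε1 : ε ≤ 1 := by
      rw [hε, div_le_one (by positivity)]; simp
    have := hρ1 ε hε0
    have h1 := measureReal_compl_Icc_le (ρ ε) (y := y) (by linarith)
    rw [hρ2 ε hε0 _ (by simp; linarith)] at h1
    have e2 : (y * Complex.I + ε * Complex.I : ℂ) = ((y + ε : ℝ) : ℂ) * Complex.I := by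
      push_cast; ring
    rw [e2] at h1
    have h2 := (Complex.abs_im_le_norm _).trans (hC (((y + ε : ℝ) : ℂ) * Complex.I) (by
      simp; linarith))
    have e3 : (1 / (((y + ε : ℝ) : ℂ) * Complex.I)).im = -1 / (y + ε) := by
      rw [one_div, Complex.inv_im, Complex.normSq_apply]
      simp only [Complex.mul_im, Complex.mul_re, Complex.ofReal_re, Complex.ofReal_im,
        Complex.I_re, Complex.I_im]
      have : y + ε ≠ 0 := by positivity
      field_simp
      ring
    have e4 : ‖((y + ε : ℝ) : ℂ) * Complex.I‖ = y + ε := by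
      rw [norm_mul, Complex.norm_I, mul_one, Complex.norm_real, Real.norm_of_nonneg (by linarith)]
    rw [Complex.sub_im, e3, e4] at h2
    have h3 := (le_abs_self _).trans h2
    have h4 : (G (((y + ε : ℝ) : ℂ) * Complex.I)).im ≤ -1 / (y + ε) + |C| / y ^ 2 := by
      have : C / (y + ε) ^ 2 ≤ |C| / y ^ 2 := by
        gcongr
        · exact le_abs_self C
        · linarith
      linarith
    have h5 : 1 + y * (G (((y + ε : ℝ) : ℂ) * Complex.I)).im ≤ (1 + |C|) / y := by
      have hy0 : 0 < y := by linarith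
      calc 1 + y * (G (((y + ε : ℝ) : ℂ) * Complex.I)).im
          ≤ 1 + y * (-1 / (y + ε) + |C| / y ^ 2) := by gcongr
        _ = ε / (y + ε) + |C| / y := by
            have : y + ε ≠ 0 := by positivity
            field_simp
            ring
        _ ≤ 1 / y + |C| / y := by
            gcongr
            linarith
        _ = _ := by rw [← add_div]
    have h6 : (ρ ε).real (Icc (-y) y)ᶜ ≤ 2 * (1 + |C|) / y := by
      refine h1.trans ?_
      rw [mul_div_assoc]
      linarith
    rw [← NNReal.coe_le_coe, hu]
    simp only
    rw [Real.coe_toNNReal _ (by positivity)]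
    exact h6
  -- the limit along a nonprincipal ultrafilter avoids passing to a subsequence
  let F : Ultrafilter ℕ := hyperfilter ℕ
  obtain ⟨ν, -, hν⟩ := hcomp.ultrafilter_le_nhds (F.map m) (by
    rw [le_principal_iff]
    exact Filter.Eventually.of_forall (f := (F : Filter ℕ)) hmem)
  have hνt : Tendsto m F (𝓝 ν) := hν
  refine ⟨ν, inferInstance, fun z hz => ?_⟩
  rw [ProbabilityMeasure.tendsto_iff_forall_integral_rclike_tendsto ℂ] at hνt
  have h1 := hνt (BoundedContinuousFunction.ofNormedAddCommGroup _
    (continuous_one_div_sub hz.ne') _ (norm_one_div_sub_le hz.ne'))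
  simp only [BoundedContinuousFunction.coe_ofNormedAddCommGroup] at h1
  have h2 : Tendsto (fun n : ℕ => G (z + ((1 / (n + 1) : ℝ) : ℂ) * Complex.I)) F (𝓝 (G z)) := by
    have hc : ContinuousAt G z := (hG.differentiableAt
      ((isOpen_lt continuous_const Complex.continuous_im).mem_nhds hz)).continuousAt
    refine hc.tendsto.comp (Tendsto.mono_left ?_ Nat.hyperfilter_le_atTop)
    have h3 : Tendsto (fun n : ℕ => z + ((1 / (n + 1) : ℝ) : ℂ) * Complex.I) atTop
        (𝓝 (z + ((0 : ℝ) : ℂ) * Complex.I)) :=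
      tendsto_const_nhds.add (((Complex.continuous_ofReal.tendsto _).comp
        tendsto_one_div_add_atTop_nhds_zero_nat).mul_const _)
    simpa using h3
  refine tendsto_nhds_unique h1 (h2.congr fun n => ?_)
  exact (hρ2 _ (hεpos n) z hz).symm

/-! ### Free infinite divisibility from the Voiculescu transform -/

theorem isOpen_upperHalfPlane : IsOpen {z : ℂ | 0 < z.im} :=
  isOpen_lt continuous_const Complex.continuous_im

theorem one_div_im (z : ℂ) : (1 / z).im = -z.im / ‖z‖ ^ 2 := by
  rw [one_div, Complex.inv_im, Complex.normSq_eq_norm_sq]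

theorem one_div_re (z : ℂ) : (1 / z).re = z.re / ‖z‖ ^ 2 := by
  rw [one_div, Complex.inv_re, Complex.normSq_eq_norm_sq]

/-- A perturbation of the identity by a bounded function that inverts `G_ρ` high up in the upper
half-plane gives a right inverse of `G_ρ` on a triangular domain whose size depends only on the
bounds. -/
theorem isRightInverseCauchy_of_bounded {ρ : Measure ℝ} {ψ : ℂ → ℂ} {T C : ℝ}
    (hinj : InjOn (cauchyTransform ρ) {z | 0 < z.im})
    (hb : ∀ z : ℂ, T < z.im → ‖ψ z‖ ≤ C)
    (hψ : ∀ z : ℂ, T < z.im → cauchyTransform ρ (z + ψ z) = 1 / z) :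
    IsRightInverseCauchy ρ 1 (1 / (4 * (|T| + 5 * |C| + 2))) fun w => 1 / w + ψ (1 / w) := by
  refine ⟨1 / 4, by norm_num, 1, one_pos, hinj.mono fun z hz => hz.1, ?_⟩
  rintro w ⟨hw1, hw2, hw3⟩
  set δ := 1 / (4 * (|T| + 5 * |C| + 2)) with hδ
  have hpos : 0 < |T| + 5 * |C| + 2 := by positivity
  have hw0 : w ≠ 0 := by rintro rfl; simp at hw1
  have hwn : 0 < ‖w‖ := norm_pos_iff.2 hw0
  set z := 1 / w with hz
  have hzw : 1 / z = w := by rw [hz, one_div_one_div]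
  have h1 : ‖w‖ < 2 * δ := by
    have := Complex.norm_le_abs_re_add_abs_im w
    rw [abs_of_neg hw1] at this
    linarith
  have h2 : 2 * (|T| + 5 * |C| + 2) ≤ ‖z‖ := by
    rw [hz, norm_div, norm_one, le_div_iff₀ hwn]
    have : 2 * (|T| + 5 * |C| + 2) * (2 * δ) = 1 := by rw [hδ]; field_simp; norm_num
    nlinarith
  have h3 : |z.re| < z.im := by
    rw [hz, one_div_re, one_div_im, abs_div, abs_of_nonneg (sq_nonneg ‖w‖)]
    have : 0 < ‖w‖ ^ 2 := by positivity
    exact div_lt_div_of_pos_right (by linarith) this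
  have h4 : ‖z‖ ≤ 2 * z.im := by
    have := Complex.norm_le_abs_re_add_abs_im z
    rw [abs_of_pos ((abs_nonneg _).trans_lt h3)] at this
    linarith
  have hT : T < z.im := by linarith [le_abs_self T, abs_nonneg C]
  have hψb := (hb z hT).trans (le_abs_self C)
  have h5 := (abs_le.1 ((Complex.abs_im_le_norm (ψ z)).trans hψb)).1
  have h6 := abs_add_le z.re (ψ z).re
  have h7 := (Complex.abs_re_le_norm (ψ z)).trans hψb
  have h8 := abs_nonneg T
  have h9 := abs_nonneg C
  refine ⟨⟨?_, ?_, ?_⟩, ?_⟩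
  · rw [Complex.add_im]; linarith
  · rw [Complex.add_im, Complex.add_re]; linarith
  · rw [Complex.add_im]; linarith
  · show cauchyTransform ρ (z + ψ z) = w
    rw [hψ z hT, hzw]

/-- If `φ` maps the upper half-plane to the closed lower half-plane and is bounded near infinity,
then `z ↦ z + φ z` is the inverse of the reciprocal Cauchy transform of a probability measure.
The map is proper over the upper half-plane, since `Im (z + φ z) ≤ Im z`, and values with large
imaginary part are taken once, since `φ` is a contraction there; so it has an inverse `F`, and
`1 / F` is a Cauchy transform. -/
theorem exists_measure_of_bounded_voiculescu {φ : ℂ → ℂ} {R C : ℝ} (hR : 0 < R)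
    (hφ : DifferentiableOn ℂ φ {z | 0 < z.im}) (him : ∀ z : ℂ, 0 < z.im → (φ z).im ≤ 0)
    (hb : ∀ z : ℂ, 0 < z.im → R ≤ ‖z‖ → ‖φ z‖ ≤ C) :
    ∃ ρ : Measure ℝ, IsProbabilityMeasure ρ ∧ InjOn (cauchyTransform ρ) {z | 0 < z.im} ∧
      ∀ z : ℂ, R + 2 * C + 1 < z.im → cauchyTransform ρ (z + φ z) = 1 / z := by
  have hC : 0 ≤ C := by
    refine (norm_nonneg _).trans (hb (R * Complex.I) (by simpa using hR) ?_)
    simp [abs_of_pos hR]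
  have hfar : ∀ z : ℂ, R ≤ z.im → ‖φ z‖ ≤ C := fun z hz =>
    hb z (hR.trans_le hz) (hz.trans ((le_abs_self _).trans (Complex.abs_im_le_norm z)))
  set Ψ : ℂ → ℂ := fun z => z + φ z with hΨ
  have hΨd : DifferentiableOn ℂ Ψ {z | 0 < z.im} := differentiableOn_id.add hφ
  have hΨim : ∀ z : ℂ, 0 < z.im → (Ψ z).im ≤ z.im := fun z hz => by
    simp only [hΨ, Complex.add_im]; linarith [him z hz]
  set Y := R + 2 * C + 1 with hY
  have hΨpos : ∀ z : ℂ, Y < z.im → 0 < (Ψ z).im := by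
    intro z hz
    have h1 := (abs_le.1 ((Complex.abs_im_le_norm (φ z)).trans (hfar z (by linarith)))).1
    simp only [hΨ, Complex.add_im]
    linarith
  have hproper : ProperOver Ψ {z | 0 < z.im} {z | 0 < z.im} := by
    intro F hF w hw hlim
    set K : Set ℂ := {z | w.im / 2 ≤ z.im} ∩ Metric.closedBall 0 (max R (‖w‖ + 1 + C)) with hK
    have hKc : IsCompact K := (isCompact_closedBall _ _).inter_left
      (isClosed_le continuous_const Complex.continuous_im)
    have h1 : ∀ᶠ z in (F : Filter ℂ), w.im / 2 < (Ψ z).im :=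
      ((Complex.continuous_im.tendsto w).comp hlim).eventually_const_lt (half_lt_self hw)
    have h2 : ∀ᶠ z in (F : Filter ℂ), ‖Ψ z‖ < ‖w‖ + 1 :=
      ((continuous_norm.tendsto w).comp hlim).eventually_lt_const (lt_add_one _)
    have hFK : (F : Filter ℂ) ≤ 𝓟 K := by
      rw [le_principal_iff]
      filter_upwards [hF, h1, h2] with z hz hz1 hz2
      refine ⟨hz1.le.trans (hΨim z hz), ?_⟩
      rw [mem_closedBall_zero_iff]
      rcases le_total R ‖z‖ with h | h
      · refine le_trans ?_ (le_max_right _ _)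
        have h3 : z = Ψ z - φ z := by simp [hΨ]
        calc ‖z‖ = ‖Ψ z - φ z‖ := by rw [← h3]
          _ ≤ ‖Ψ z‖ + ‖φ z‖ := norm_sub_le _ _
          _ ≤ ‖w‖ + 1 + C := add_le_add hz2.le (hb z hz h)
      · exact h.trans (le_max_left _ _)
    obtain ⟨z, hz, hle⟩ := hKc.ultrafilter_le_nhds F hFK
    have hw0 : 0 < w.im := hw
    have hz0 : w.im / 2 ≤ z.im := hz.1
    exact ⟨z, show 0 < z.im by linarith, hle⟩
  have hupper : ∀ y : ℝ, ((y : ℂ) * Complex.I).im = y := fun y => by simp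
  have hY0 : 0 < Y := by linarith
  have hderiv : ∀ z ∈ {z : ℂ | Y < z.im}, ‖deriv φ z‖ ≤ 1 / 2 := by
    intro z hz
    simp only [mem_ofPred_eq] at hz
    have hr : 0 < 2 * C + 1 := by linarith
    have hsub : ∀ w ∈ Metric.closedBall z (2 * C + 1), R < w.im := by
      intro w hw
      have h1 := (abs_le.1 ((Complex.abs_im_le_norm (w - z)).trans
        (mem_closedBall_iff_norm.1 hw))).1
      rw [Complex.sub_im] at h1
      linarith
    refine (Complex.norm_deriv_le_of_forall_mem_sphere_norm_le (C := C) hr ?_ ?_).trans ?_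
    · refine DifferentiableOn.diffContOnCl (hφ.mono ?_)
      rw [closure_ball z hr.ne']
      exact fun w hw => hR.trans (hsub w hw)
    · exact fun w hw => hfar w (hsub w (Metric.sphere_subset_closedBall hw)).le
    · rw [div_le_iff₀ hr]; linarith
  have huniq : ∀ z₁ ∈ {z : ℂ | 0 < z.im}, ∀ z₂ ∈ {z : ℂ | 0 < z.im}, Ψ z₁ ∈ {z : ℂ | Y < z.im} →
      Ψ z₁ = Ψ z₂ → z₁ = z₂ := by
    intro z₁ hz₁ z₂ hz₂ h1 h12
    simp only [mem_ofPred_eq] at h1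
    have h1' : Y < z₁.im := h1.trans_le (hΨim z₁ hz₁)
    have h2' : Y < z₂.im := by rw [h12] at h1; exact h1.trans_le (hΨim z₂ hz₂)
    have hlip := Convex.norm_image_sub_le_of_norm_deriv_le (f := φ) (s := {z : ℂ | Y < z.im})
      (fun z hz => hφ.differentiableAt (isOpen_upperHalfPlane.mem_nhds (hY0.trans hz))) hderiv
      (convex_halfSpace_im_gt Y) h2' h1'
    have h3 : φ z₁ - φ z₂ = -(z₁ - z₂) := by
      simp only [hΨ] at h12
      linear_combination h12
    rw [h3, norm_neg] at hlip
    have : ‖z₁ - z₂‖ = 0 := by linarith [norm_nonneg (z₁ - z₂)]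
    exact sub_eq_zero.1 (norm_eq_zero.1 this)
  have hconn : ∀ Z : Set ℂ, Z.Countable → IsPreconnected ({z : ℂ | 0 < z.im} \ Z) := by
    intro Z hZ
    simpa using isPreconnected_halfPlane_diff hZ (one_ne_zero (α := ℝ))
  have hTunc : ¬ {z : ℂ | Y < z.im}.Countable := by
    intro hcount
    have hdense := hcount.dense_compl ℝ
    obtain ⟨z, hz1, hz2⟩ := hdense.inter_open_nonempty {z : ℂ | Y < z.im}
      (isOpen_lt continuous_const Complex.continuous_im)
      ⟨((Y + 1 : ℝ) : ℂ) * Complex.I, by rw [mem_ofPred_eq, hupper]; linarith⟩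
    exact hz2 hz1
  obtain ⟨hinj, F, hFa, hF⟩ := hproper.exists_inverse (T := {z : ℂ | Y < z.im})
    isOpen_upperHalfPlane (by simpa using hconn ∅ countable_empty) hΨd isOpen_upperHalfPlane hconn
    ⟨((Y + 1 : ℝ) : ℂ) * Complex.I, by rw [mem_ofPred_eq, hupper]; linarith,
      hΨpos _ (by rw [hupper]; linarith)⟩
    (by
      rintro ⟨c, hc⟩
      have h1 := hc (((R + C + ‖c‖ + 1 : ℝ) : ℂ) * Complex.I) (by
        rw [mem_ofPred_eq, hupper]; positivity)
      have h2 := hfar (((R + C + ‖c‖ + 1 : ℝ) : ℂ) * Complex.I) (by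
        rw [hupper]; linarith [norm_nonneg c])
      have h3 := congrArg Complex.im h1
      simp only [hΨ] at h3
      rw [Complex.add_im, hupper] at h3
      have h4 := (abs_le.1 ((Complex.abs_im_le_norm _).trans h2)).1
      have h5 := (le_abs_self _).trans (Complex.abs_im_le_norm c)
      linarith)
    hTunc (fun z hz => hY0.trans hz) huniq
  have hFim : ∀ z : ℂ, 0 < z.im → z.im ≤ (F z).im := fun z hz => by
    have h1 := hΨim (F z) (hF z hz).1
    rwa [(hF z hz).2] at h1
  have hF0 : ∀ z : ℂ, 0 < z.im → F z ≠ 0 := fun z hz h0 => by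
    have := (hF z hz).1
    rw [h0] at this
    simp at this
  obtain ⟨ρ, hρ, hρF⟩ := exists_measure_cauchyTransform_eq (G := fun z => 1 / F z)
    (fun z hz => ((differentiableAt_const _).div (hFa z hz).differentiableAt
      (hF0 z hz)).differentiableWithinAt)
    (fun z hz => by
      rw [one_div_im]
      exact div_nonpos_of_nonpos_of_nonneg (by
        have : 0 < (F z).im := (hF z hz).1
        linarith) (by positivity))
    (by
      intro ε hε
      set K : Set ℂ := {z | ε ≤ z.im} ∩ Metric.closedBall 0 R with hK
      have hKc : IsCompact K := (isCompact_closedBall _ _).inter_left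
        (isClosed_le continuous_const Complex.continuous_im)
      obtain ⟨C₁, hC₁⟩ := hKc.exists_bound_of_continuousOn
        (hφ.continuousOn.mono fun z hz => hε.trans_le hz.1)
      set C₂ := max C C₁ with hC₂
      have hC₂0 : 0 ≤ C₂ := hC.trans (le_max_left _ _)
      have hbd : ∀ z : ℂ, ε ≤ z.im → ‖φ z‖ ≤ C₂ := by
        intro z hz
        rcases le_total R ‖z‖ with h | h
        · exact (hb z (hε.trans_le hz) h).trans (le_max_left _ _)
        · exact (hC₁ z ⟨hz, by simpa using h⟩).trans (le_max_right _ _)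
      refine ⟨C₂ * (1 + C₂ / ε), fun z hz => ?_⟩
      have hz0 : 0 < z.im := hε.trans_le hz
      have hzn : z ≠ 0 := by rintro rfl; simp at hz0
      have h1 : ε ≤ (F z).im := hz.trans (hFim z hz0)
      have h2 : z - F z = φ (F z) := by
        have := (hF z hz0).2
        simp only [hΨ] at this
        linear_combination -this
      have h3 : ‖z - F z‖ ≤ C₂ := by rw [h2]; exact hbd _ h1
      have h4 : ε ≤ ‖F z‖ := h1.trans ((le_abs_self _).trans (Complex.abs_im_le_norm _))
      have h5 : ‖z‖ ≤ ‖F z‖ * (1 + C₂ / ε) := by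
        have h6 : ‖z‖ ≤ ‖z - F z‖ + ‖F z‖ := by simpa using norm_add_le (z - F z) (F z)
        have h7 : C₂ ≤ ‖F z‖ * (C₂ / ε) := by
          rw [mul_div_assoc', le_div_iff₀ hε]
          nlinarith
        linarith
      have hFn : 0 < ‖F z‖ := hε.trans_le h4
      have hzp : 0 < ‖z‖ := norm_pos_iff.2 hzn
      have h8 : 1 / F z - 1 / z = (z - F z) / (F z * z) := by
        have := hF0 z hz0
        field_simp
      rw [h8, norm_div, norm_mul, div_le_div_iff₀ (by positivity) (by positivity)]
      calc ‖z - F z‖ * ‖z‖ ^ 2 ≤ C₂ * (‖z‖ * ‖z‖) := by rw [sq]; gcongr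
        _ ≤ C₂ * (‖F z‖ * (1 + C₂ / ε) * ‖z‖) := by gcongr
        _ = _ := by ring)
  refine ⟨ρ, hρ, ?_, ?_⟩
  · intro z₁ hz₁ z₂ hz₂ h12
    rw [hρF z₁ hz₁, hρF z₂ hz₂] at h12
    have h3 : F z₁ = F z₂ := by simpa using h12
    rw [← (hF z₁ hz₁).2, ← (hF z₂ hz₂).2, h3]
  · intro z hz
    have h1 := hΨpos z hz
    rw [hρF _ h1]
    congr 1
    exact hinj ⟨(hF _ h1).1, by rw [mem_preimage, (hF _ h1).2]; exact h1⟩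
      ⟨hY0.trans hz, h1⟩ (hF _ h1).2

theorem cauchyTransform_dirac (z : ℂ) : cauchyTransform (Measure.dirac 0) z = 1 / z := by
  rw [cauchyTransform, integral_dirac]
  simp

/-- Free infinite divisibility follows from a Voiculescu transform `φ` that is bounded at infinity
and has nonpositive imaginary part: each multiple `(k / n) φ` with `k ≤ n` is again the Voiculescu
transform of a probability measure, which is the `k`-fold free convolution of the one with
`k = 1`. -/
theorem isFreelyInfinitelyDivisible_of_bounded_voiculescu {μ : Measure ℝ} [IsProbabilityMeasure μ]
    {φ : ℂ → ℂ} {R C : ℝ} (hR : 0 < R)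
    (hφ : DifferentiableOn ℂ φ {z | 0 < z.im}) (him : ∀ z : ℂ, 0 < z.im → (φ z).im ≤ 0)
    (hb : ∀ z : ℂ, 0 < z.im → R ≤ ‖z‖ → ‖φ z‖ ≤ C)
    (hinj : InjOn (cauchyTransform μ) {z | 0 < z.im})
    (hμ : ∀ z : ℂ, R + 2 * C + 1 < z.im → cauchyTransform μ (z + φ z) = 1 / z) :
    IsFreelyInfinitelyDivisible μ := by
  have hC : 0 ≤ C := by
    refine (norm_nonneg _).trans (hb (R * Complex.I) (by simpa using hR) ?_)
    simp [abs_of_pos hR]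
  refine ⟨inferInstance, fun n hn => ?_⟩
  have hn0 : (0 : ℝ) < n := by exact_mod_cast hn
  set T := R + 2 * C + 1 with hT
  have hbT : ∀ s : ℝ, 0 ≤ s → s ≤ 1 → ∀ z : ℂ, T < z.im → ‖(s : ℂ) * φ z‖ ≤ C := by
    intro s hs0 hs1 z hz
    have h1 := hb z (by linarith) (by
      have := (le_abs_self _).trans (Complex.abs_im_le_norm z)
      linarith)
    rw [norm_mul, Complex.norm_real, Real.norm_of_nonneg hs0]
    nlinarith [norm_nonneg (φ z)]
  have hex : ∀ k : ℕ, k ≤ n → ∃ ρ : Measure ℝ, (k = 0 → ρ = Measure.dirac 0) ∧ (k = n → ρ = μ) ∧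
      IsProbabilityMeasure ρ ∧ InjOn (cauchyTransform ρ) {z | 0 < z.im} ∧
      ∀ z : ℂ, T < z.im → cauchyTransform ρ (z + ((k / n : ℝ) : ℂ) * φ z) = 1 / z := by
    intro k hk
    rcases Nat.eq_zero_or_pos k with rfl | hk0
    · refine ⟨Measure.dirac 0, fun _ => rfl, fun h => absurd h (by omega), inferInstance, ?_, ?_⟩
      · intro z _ w _ h
        rw [cauchyTransform_dirac, cauchyTransform_dirac] at h
        simpa using h
      · intro z _
        rw [cauchyTransform_dirac]
        simp
    rcases eq_or_lt_of_le hk with rfl | hkn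
    · refine ⟨μ, fun h => absurd h (by omega), fun _ => rfl, inferInstance, hinj, ?_⟩
      intro z hz
      rw [div_self hn0.ne', Complex.ofReal_one, one_mul]
      exact hμ z hz
    · have hs0 : (0 : ℝ) ≤ k / n := by positivity
      have hs1 : (k / n : ℝ) ≤ 1 := by
        rw [div_le_one hn0]; exact_mod_cast hk
      obtain ⟨ρ, h1, h2, h3⟩ := exists_measure_of_bounded_voiculescu (R := R) (C := C)
        (φ := fun z => ((k / n : ℝ) : ℂ) * φ z) hR (hφ.const_mul _)
        (fun z hz => by
          rw [Complex.im_ofReal_mul]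
          exact mul_nonpos_of_nonneg_of_nonpos hs0 (him z hz))
        (fun z hz hzR => by
          rw [norm_mul, Complex.norm_real, Real.norm_of_nonneg hs0]
          nlinarith [norm_nonneg (φ z), hb z hz hzR])
      exact ⟨ρ, fun h => absurd h hk0.ne', fun h => absurd h hkn.ne, h1, h2, h3⟩
  choose! ρ hρ0 hρn hρ1 hρ2 hρ3 using hex
  refine ⟨ρ 1, hρ1 1 hn, ?_⟩
  have hri : ∀ k : ℕ, k ≤ n → IsRightInverseCauchy (ρ k) 1 (1 / (4 * (|T| + 5 * |C| + 2)))
      fun w => 1 / w + ((k / n : ℝ) : ℂ) * φ (1 / w) := fun k hk =>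
    isRightInverseCauchy_of_bounded (ψ := fun z => ((k / n : ℝ) : ℂ) * φ z) (hρ2 k hk)
      (hbT _ (by positivity) (by rw [div_le_one hn0]; exact_mod_cast hk)) (hρ3 k hk)
  have hpow : ∀ k : ℕ, k ≤ n → IsFreeConvolutionPower (ρ 1) k (ρ k) := by
    intro k
    induction k with
    | zero => intro _; exact hρ0 0 (Nat.zero_le _) rfl
    | succ k ih =>
      intro hk
      have hk' : k ≤ n := by omega
      refine ⟨ρ k, hρ1 k hk', ih hk', 1, one_pos, _, by positivity, _, _, _, hri k hk', hri 1 hn,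
        hri (k + 1) hk, fun z _ => ?_⟩
      simp only [voiculescuTransform, one_div_one_div]
      push_cast
      ring
  rw [← hρn n le_rfl rfl]
  exact hpow n le_rfl

/-! ### Cauchy transforms of compactly supported measures -/

theorem differentiableAt_cauchyTransform {μ : Measure ℝ} [IsFiniteMeasure μ] {z : ℂ}
    (hz : ∀ x ∈ μ.support, z ≠ x) : DifferentiableAt ℂ (cauchyTransform μ) z := by
  have h : cauchyTransform μ = fun z => -resolventTransform μ z :=
    funext (cauchyTransform_eq_neg_resolventTransform μ)
  rw [h]
  refine (hasDerivAt_resolventTransform z ?_).differentiableAt.neg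
  rintro ⟨x, hx, hxz⟩
  exact hz x hx hxz.symm

theorem im_cauchyTransform {μ : Measure ℝ} [IsFiniteMeasure μ] {z : ℂ} (hz : z.im ≠ 0) :
    (cauchyTransform μ z).im = -z.im * ∫ x : ℝ, ‖1 / (z - (x : ℂ))‖ ^ 2 ∂μ := by
  rw [cauchyTransform, ← integral_const_mul]
  refine (integral_im (integrable_one_div_sub μ hz)).symm.trans ?_
  refine integral_congr_ae (ae_of_all _ fun x => ?_)
  show (1 / (z - (x : ℂ))).im = -z.im * ‖1 / (z - (x : ℂ))‖ ^ 2
  rw [im_one_div_sub, norm_div, norm_one, div_pow, one_pow, mul_one_div]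

theorem integrable_norm_one_div_sub_sq (μ : Measure ℝ) [IsFiniteMeasure μ] {z : ℂ} (hz : z.im ≠ 0) :
    Integrable (fun x : ℝ => ‖1 / (z - (x : ℂ))‖ ^ 2) μ :=
  Integrable.of_bound ((continuous_one_div_sub hz).norm.pow 2).aestronglyMeasurable
    ((1 / |z.im|) ^ 2) (ae_of_all _ fun x => by
      rw [Real.norm_of_nonneg (by positivity)]
      exact pow_le_pow_left₀ (norm_nonneg _) (norm_one_div_sub_le hz x) 2)

/-- The inequality `Im (1 / G_μ(z)) ≥ Im z`, in multiplied-out form. -/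
theorem im_mul_norm_cauchyTransform_sq_le {μ : Measure ℝ} [IsProbabilityMeasure μ] {z : ℂ}
    (hz : 0 < z.im) : z.im * ‖cauchyTransform μ z‖ ^ 2 ≤ -(cauchyTransform μ z).im := by
  rw [im_cauchyTransform hz.ne', neg_mul, neg_neg]
  refine mul_le_mul_of_nonneg_left ?_ hz.le
  set p : ℝ → ℝ := fun x => ‖1 / (z - (x : ℂ))‖ with hp
  have hp1 : Integrable p μ := (integrable_one_div_sub μ hz.ne').norm
  have hp2 : Integrable (fun x => p x ^ 2) μ := integrable_norm_one_div_sub_sq μ hz.ne'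
  set c := ∫ x, p x ∂μ with hc
  have h1 : ‖cauchyTransform μ z‖ ≤ c := norm_integral_le_integral_norm _
  have h2 : 0 ≤ ∫ x, (p x - c) ^ 2 ∂μ := integral_nonneg fun x => sq_nonneg _
  have h3 : ∫ x, (p x - c) ^ 2 ∂μ = (∫ x, p x ^ 2 ∂μ) - c ^ 2 := by
    have : ∀ x, (p x - c) ^ 2 = p x ^ 2 - (2 * c * p x - c ^ 2) := fun x => by ring
    simp_rw [this]
    have hq : Integrable (fun x => 2 * c * p x - c ^ 2) μ :=
      (hp1.const_mul _).sub (integrable_const _)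
    rw [integral_sub hp2 hq,
      integral_sub (hp1.const_mul _) (integrable_const _), integral_const_mul]
    simp
    ring
  calc ‖cauchyTransform μ z‖ ^ 2 ≤ c ^ 2 := pow_le_pow_left₀ (norm_nonneg _) h1 2
    _ ≤ _ := by linarith

section CompactSupport

variable {μ : Measure ℝ} [IsProbabilityMeasure μ] {B : ℝ}

theorem norm_sub_ge_of_abs_le {z : ℂ} {x : ℝ} (hz : 2 * B ≤ ‖z‖) (hx : |x| ≤ B) :
    ‖z‖ / 2 ≤ ‖z - x‖ := by
  have := norm_sub_norm_le z x
  rw [Complex.norm_real, Real.norm_eq_abs] at this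
  linarith

theorem norm_cauchyTransform_sub_le (hB : ∀ᵐ x ∂μ, |x| ≤ B) {z : ℂ} (hz : 2 * B ≤ ‖z‖)
    (hz0 : z ≠ 0) : ‖cauchyTransform μ z - 1 / z‖ ≤ 2 * B / ‖z‖ ^ 2 := by
  have hzp : 0 < ‖z‖ := norm_pos_iff.2 hz0
  have hint : Integrable (fun x : ℝ => 1 / (z - (x : ℂ))) μ := by
    refine Integrable.of_bound (Measurable.aestronglyMeasurable (by fun_prop)) (2 / ‖z‖) ?_
    filter_upwards [hB] with x hx
    have := norm_sub_ge_of_abs_le hz hx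
    rw [norm_div, norm_one, div_le_div_iff₀ (by linarith) hzp]
    linarith
  have h1 : cauchyTransform μ z - 1 / z = ∫ x : ℝ, (1 / (z - (x : ℂ)) - 1 / z) ∂μ := by
    rw [integral_sub hint (integrable_const _), cauchyTransform]
    simp
  rw [h1]
  refine (norm_integral_le_of_norm_le_const (C := 2 * B / ‖z‖ ^ 2) ?_).trans (by simp)
  filter_upwards [hB] with x hx
  have h2 := norm_sub_ge_of_abs_le hz hx
  have h3 : z - (x : ℂ) ≠ 0 := norm_pos_iff.1 (by linarith)
  have h4 : 1 / (z - (x : ℂ)) - 1 / z = x / ((z - x) * z) := by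
    field_simp
    ring
  rw [h4, norm_div, norm_mul, Complex.norm_real, Real.norm_eq_abs,
    div_le_div_iff₀ (mul_pos (by linarith) hzp) (by positivity)]
  have h5 := mul_le_mul h2 hx (abs_nonneg x) (norm_nonneg _)
  nlinarith

theorem im_cauchyTransform_nonneg (hB : ∀ᵐ x ∂μ, |x| ≤ B) {z : ℂ} (hz : 2 * B ≤ ‖z‖)
    (hz0 : z ≠ 0) (him : z.im ≤ 0) : 0 ≤ (cauchyTransform μ z).im := by
  have hzp : 0 < ‖z‖ := norm_pos_iff.2 hz0
  have hint : Integrable (fun x : ℝ => 1 / (z - (x : ℂ))) μ := by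
    refine Integrable.of_bound (Measurable.aestronglyMeasurable (by fun_prop)) (2 / ‖z‖) ?_
    filter_upwards [hB] with x hx
    have := norm_sub_ge_of_abs_le hz hx
    rw [norm_div, norm_one, div_le_div_iff₀ (by linarith) hzp]
    linarith
  have h1 : (cauchyTransform μ z).im = ∫ x : ℝ, (1 / (z - (x : ℂ))).im ∂μ := (integral_im hint).symm
  rw [h1]
  refine integral_nonneg fun x => ?_
  rw [im_one_div_sub]
  exact div_nonneg (by linarith) (by positivity)

/-- The Cauchy transform of a compactly supported measure, read in the coordinate `1 / z` at
infinity, is open at `0`; so it takes every small value near infinity. -/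
theorem exists_cauchyTransform_eq (hB : ∀ᵐ x ∂μ, |x| ≤ B) :
    ∃ r > 0, ∃ C, ∀ w : ℂ, w.im < 0 → ‖w‖ < r →
      ∃ z : ℂ, 0 < z.im ∧ cauchyTransform μ z = w ∧ ‖z - 1 / w‖ ≤ C := by
  have hB0 : 0 ≤ B := by
    obtain ⟨x, hx⟩ := hB.exists
    exact (abs_nonneg x).trans hx
  -- the value `0` at `ζ = 0` removes the singularity at infinity
  set g : ℂ → ℂ := fun ζ => if ζ = 0 then 0 else cauchyTransform μ (1 / ζ) with hg
  set η : ℝ := 1 / (4 * B + 1) with hη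
  have hη0 : 0 < η := by positivity
  have hfar : ∀ ζ : ℂ, ζ ≠ 0 → ‖ζ‖ < η → 4 * B + 1 ≤ ‖1 / ζ‖ := by
    intro ζ hζ hζη
    have h0 : 0 < ‖ζ‖ := norm_pos_iff.2 hζ
    rw [norm_div, norm_one, le_div_iff₀ h0]
    rw [hη, lt_div_iff₀ (by positivity)] at hζη
    linarith
  have hest : ∀ ζ : ℂ, ‖ζ‖ < η → ‖g ζ - ζ‖ ≤ 2 * B * ‖ζ‖ ^ 2 := by
    intro ζ hζη
    by_cases hζ : ζ = 0
    · simp [hg, hζ]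
    · have := norm_cauchyTransform_sub_le hB (z := 1 / ζ) (by linarith [hfar ζ hζ hζη])
        (one_div_ne_zero hζ)
      simp only [hg, hζ, if_false]
      rw [one_div_one_div, norm_div, norm_one] at this
      refine this.trans (le_of_eq ?_)
      field_simp
  have hsupp : ∀ x ∈ μ.support, |x| ≤ B := by
    have h1 : Icc (-B) B ∈ ae μ := by
      filter_upwards [hB] with x hx using abs_le.1 hx
    intro x hx
    exact abs_le.2 (Measure.support_subset_of_isClosed isClosed_Icc h1 hx)
  have hdiff : ∀ ζ : ℂ, ζ ≠ 0 → ‖ζ‖ < η → DifferentiableAt ℂ g ζ := by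
    intro ζ hζ hζη
    have h1 : DifferentiableAt ℂ (fun ζ : ℂ => cauchyTransform μ (1 / ζ)) ζ := by
      refine DifferentiableAt.comp (g := cauchyTransform μ) (f := fun ζ : ℂ => 1 / ζ) ζ
        (differentiableAt_cauchyTransform ?_) ((differentiableAt_const _).div differentiableAt_id hζ)
      intro x hx h0
      have h2 := hfar ζ hζ hζη
      rw [h0, Complex.norm_real, Real.norm_eq_abs] at h2
      linarith [hsupp x hx]
    refine h1.congr_of_eventuallyEq ?_
    filter_upwards [isOpen_ne.mem_nhds hζ] with y hy
    simp [hg, show y ≠ 0 from hy]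
  have hball : ∀ᶠ ζ : ℂ in 𝓝 0, ‖ζ‖ < η := by
    filter_upwards [Metric.ball_mem_nhds (0 : ℂ) hη0] with ζ hζ using mem_ball_zero_iff.1 hζ
  have hg0 : g 0 = 0 := by simp [hg]
  have hcont : ContinuousAt g 0 := by
    rw [ContinuousAt, hg0]
    have h1 : Tendsto (fun ζ : ℂ => 2 * B * ‖ζ‖ ^ 2 + ‖ζ‖) (𝓝 0) (𝓝 0) := by
      have : Continuous fun ζ : ℂ => 2 * B * ‖ζ‖ ^ 2 + ‖ζ‖ := by fun_prop
      simpa using this.tendsto 0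
    refine squeeze_zero_norm' ?_ h1
    filter_upwards [hball] with ζ hζ
    calc ‖g ζ‖ ≤ ‖g ζ - ζ‖ + ‖ζ‖ := by simpa using norm_add_le (g ζ - ζ) ζ
      _ ≤ _ := by gcongr; exact hest ζ hζ
  have hana : AnalyticAt ℂ g 0 := by
    refine Complex.analyticAt_of_differentiable_on_punctured_nhds_of_continuousAt ?_ hcont
    rw [eventually_nhdsWithin_iff]
    filter_upwards [hball] with ζ hζ hne using hdiff ζ hne hζ
  have hopen : 𝓝 (g 0) ≤ map g (𝓝 0) := by
    refine hana.eventually_constant_or_nhds_le_map_nhds.resolve_left fun hconst => ?_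
    rw [hg0] at hconst
    have h1 : ∀ᶠ ζ : ℂ in 𝓝[≠] 0, False := by
      filter_upwards [nhdsWithin_le_nhds hconst, nhdsWithin_le_nhds hball,
        self_mem_nhdsWithin] with ζ h0 hζ hne
      have h2 := hest ζ hζ
      have h3 : 0 < ‖ζ‖ := norm_pos_iff.2 hne
      rw [h0, zero_sub, norm_neg] at h2
      rw [hη, lt_div_iff₀ (by positivity)] at hζ
      nlinarith
    exact NormedField.nhdsNE_neBot (0 : ℂ) |>.ne (by simpa using h1)
  rw [hg0] at hopen
  have himg : g '' Metric.ball 0 η ∈ 𝓝 (0 : ℂ) :=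
    hopen (image_mem_map (Metric.ball_mem_nhds 0 hη0))
  obtain ⟨r, hr, hrsub⟩ := Metric.mem_nhds_iff.1 himg
  refine ⟨r, hr, 4 * B, fun w hw hwr => ?_⟩
  obtain ⟨ζ, hζ, hζw⟩ := hrsub (mem_ball_zero_iff.2 hwr)
  rw [mem_ball_zero_iff] at hζ
  have hw0 : w ≠ 0 := by rintro rfl; simp at hw
  have hζ0 : ζ ≠ 0 := by rintro rfl; exact hw0 (hζw ▸ hg0)
  have hz := hfar ζ hζ0 hζ
  have hgw : cauchyTransform μ (1 / ζ) = w := by rw [← hζw]; simp [hg, hζ0]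
  refine ⟨1 / ζ, ?_, hgw, ?_⟩
  · by_contra hcon
    have := im_cauchyTransform_nonneg hB (z := 1 / ζ) (by linarith) (one_div_ne_zero hζ0)
      (not_lt.1 hcon)
    rw [hgw] at this
    linarith
  · have h1 := hest ζ hζ
    rw [hζw] at h1
    have h0 : 0 < ‖ζ‖ := norm_pos_iff.2 hζ0
    have hwn : 0 < ‖w‖ := norm_pos_iff.2 hw0
    have h2 : ‖ζ‖ ≤ 2 * ‖w‖ := by
      have h3 : ‖ζ‖ ≤ ‖w - ζ‖ + ‖w‖ := by
        rw [norm_sub_rev]; simpa using norm_add_le (ζ - w) w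
      rw [hη, lt_div_iff₀ (by positivity)] at hζ
      nlinarith
    have h4 : 1 / ζ - 1 / w = (w - ζ) / (ζ * w) := by field_simp
    rw [h4, norm_div, norm_mul, div_le_iff₀ (by positivity)]
    nlinarith [mul_le_mul_of_nonneg_left h2 (mul_nonneg hB0 h0.le)]

/-- If the inverse of the Cauchy transform of a compactly supported probability measure extends to
a univalent function on the lower half-plane, then the measure is freely infinitely divisible:
`Im (1 / G_μ(z)) ≥ Im z` forces the Voiculescu transform into the closed lower half-plane. -/
theorem isUI_and_isFreelyInfinitelyDivisible (hB : ∀ᵐ x ∂μ, |x| ≤ B) {h : ℂ → ℂ}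
    (hh : AnalyticOnNhd ℂ h lowerHalfPlane) (hinj : InjOn h lowerHalfPlane)
    (hsec : ∀ w ∈ lowerHalfPlane, 0 < (h w).im → cauchyTransform μ (h w) = w)
    (hret : ∀ z : ℂ, 0 < z.im → h (cauchyTransform μ z) = z) :
    IsUI μ ∧ IsFreelyInfinitelyDivisible μ := by
  obtain ⟨r, hr, C, hC⟩ := exists_cauchyTransform_eq hB
  set φ : ℂ → ℂ := fun z => h (1 / z) - z with hφ
  have hmaps : ∀ z : ℂ, 0 < z.im → 1 / z ∈ lowerHalfPlane := by
    intro z hz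
    have hz0 : z ≠ 0 := by rintro rfl; simp at hz
    have : 0 < ‖z‖ := norm_pos_iff.2 hz0
    show (1 / z).im < 0
    rw [one_div_im]
    exact div_neg_of_neg_of_pos (by linarith) (by positivity)
  have hinjG : InjOn (cauchyTransform μ) {z | 0 < z.im} := by
    intro z₁ hz₁ z₂ hz₂ h12
    rw [← hret z₁ hz₁, ← hret z₂ hz₂, h12]
  have hφd : DifferentiableOn ℂ φ {z | 0 < z.im} := by
    intro z hz
    have hz0 : z ≠ 0 := by
      rintro rfl
      simp at hz
    refine DifferentiableAt.differentiableWithinAt (DifferentiableAt.sub ?_ differentiableAt_id)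
    exact DifferentiableAt.comp (g := h) (f := fun z : ℂ => 1 / z) z
      (hh _ (hmaps z hz)).differentiableAt ((differentiableAt_const _).div differentiableAt_id hz0)
  have hφim : ∀ z : ℂ, 0 < z.im → (φ z).im ≤ 0 := by
    intro z hz
    by_contra! hcon
    simp only [hφ, Complex.sub_im] at hcon
    have h1 : 0 < (h (1 / z)).im := by linarith
    have h2 := im_mul_norm_cauchyTransform_sq_le (μ := μ) h1
    rw [hsec _ (hmaps z hz) h1, one_div_im, norm_div, norm_one, div_pow, one_pow, mul_one_div,
      neg_div, neg_neg] at h2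
    have hz0 : z ≠ 0 := by rintro rfl; simp at hz
    have : 0 < ‖z‖ := norm_pos_iff.2 hz0
    rw [div_le_div_iff_of_pos_right (by positivity)] at h2
    linarith
  have hR : 0 < 2 / r := by positivity
  have hφb : ∀ z : ℂ, 0 < z.im → 2 / r ≤ ‖z‖ → ‖φ z‖ ≤ C := by
    intro z hz hzr
    have hzp : 0 < ‖z‖ := hR.trans_le hzr
    obtain ⟨z', hz', he, hle⟩ := hC (1 / z) (hmaps z hz) (by
      rw [norm_div, norm_one, div_lt_iff₀ hzp]
      rw [div_le_iff₀ hr] at hzr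
      linarith)
    rw [one_div_one_div] at hle
    simp only [hφ]
    rwa [← he, hret z' hz']
  have hC0 : 0 ≤ C := by
    refine (norm_nonneg _).trans (hφb (((2 / r : ℝ) : ℂ) * Complex.I) ?_ ?_)
    · rw [Complex.im_ofReal_mul, Complex.I_im, mul_one]; exact hR
    · rw [norm_mul, Complex.norm_I, mul_one, Complex.norm_real]
      exact le_abs_self _
  have hμφ : ∀ z : ℂ, 2 / r + 2 * C + 1 < z.im → cauchyTransform μ (z + φ z) = 1 / z := by
    intro z hz
    have hz0 : 0 < z.im := by linarith
    have h1 := (abs_le.1 ((Complex.abs_im_le_norm (φ z)).trans (hφb z hz0 (by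
      have := (le_abs_self _).trans (Complex.abs_im_le_norm z)
      linarith)))).1
    have h2 : z + φ z = h (1 / z) := by simp [hφ]
    have h3 : 0 < (z + φ z).im := by rw [Complex.add_im]; linarith
    rw [h2] at h3 ⊢
    exact hsec _ (hmaps z hz0) h3
  refine ⟨⟨inferInstance, h, hh, hinj, 1, one_pos,
    1 / (4 * (|2 / r + 2 * C + 1| + 5 * |C| + 2)), by positivity, ?_⟩,
    isFreelyInfinitelyDivisible_of_bounded_voiculescu hR hφd hφim hφb hinjG hμφ⟩
  have h1 := isRightInverseCauchy_of_bounded hinjG (T := 2 / r + 2 * C + 1) (C := C)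
    (fun z hz => hφb z (by linarith) (by
      have := (le_abs_self _).trans (Complex.abs_im_le_norm z)
      linarith)) hμφ
  have h2 : (fun w => 1 / w + φ (1 / w)) = h := funext fun w => by
    simp only [hφ, one_div_one_div, add_sub_cancel]
  rwa [h2] at h1

end CompactSupport

/-! ### Analytic continuation of the Cauchy transform across the support -/

/-- The complex plane cut along the two real half-lines `(-∞, A]` and `[B, ∞)`. -/
def cutPlane (A B : ℝ) : Set ℂ := {z | z.im ≠ 0 ∨ A < z.re ∧ z.re < B}

theorem isOpen_cutPlane (A B : ℝ) : IsOpen (cutPlane A B) :=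
  (isOpen_ne_fun Complex.continuous_im continuous_const).union
    ((isOpen_lt continuous_const Complex.continuous_re).inter
      (isOpen_lt Complex.continuous_re continuous_const))

theorem ofReal_mem_cutPlane {A B y : ℝ} (hy : y ∈ Ioo A B) : (y : ℂ) ∈ cutPlane A B :=
  Or.inr (by simpa using hy)

/-- The measure `μ` lives on `[A, B]`, with a continuous density `d` that vanishes at the endpoints
and extends from `(A, B)` to a holomorphic function `g` on the cut plane. The density enters only
through the Cauchy transform of `μ`. -/
structure HasContinuedDensity (μ : Measure ℝ) (A B : ℝ) (g : ℂ → ℂ) (d : ℝ → ℝ) : Prop where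
  lt : A < B
  differentiableOn : DifferentiableOn ℂ g (cutPlane A B)
  continuousOn : ContinuousOn d (Icc A B)
  left : d A = 0
  right : d B = 0
  nonneg : ∀ y, 0 ≤ d y
  eqOn : ∀ y ∈ Ioo A B, g y = d y
  cauchy : ∀ z : ℂ, z.im ≠ 0 → cauchyTransform μ z = ∫ y in Ioo A B, (d y : ℂ) / (z - y)
  support : ∀ᵐ x ∂μ, x ∈ Icc A B

theorem dslope_symm {g : ℂ → ℂ} (z w : ℂ) : dslope g z w = dslope g w z := by
  rcases eq_or_ne z w with rfl | h
  · rfl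
  · rw [dslope_of_ne _ h.symm, dslope_of_ne _ h, slope_comm]

theorem log_sub_ofReal_of_im_pos {z : ℂ} (B : ℝ) (hz : 0 < z.im) :
    Complex.log (z - B) = Complex.log (B - z) + Real.pi * Complex.I := by
  rw [← neg_sub (B : ℂ) z, Complex.log, Complex.log, norm_neg,
    Complex.arg_neg_eq_arg_add_pi_of_im_neg (by simpa using hz)]
  push_cast
  ring

theorem log_sub_ofReal_of_im_neg {z : ℂ} (B : ℝ) (hz : z.im < 0) :
    Complex.log (z - B) = Complex.log (B - z) - Real.pi * Complex.I := by
  rw [← neg_sub (B : ℂ) z, Complex.log, Complex.log, norm_neg,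
    Complex.arg_neg_eq_arg_sub_pi_of_im_pos (by simpa using hz)]
  push_cast
  ring

theorem integral_one_div_sub {A B : ℝ} (hAB : A < B) {z : ℂ} (hz : z.im ≠ 0) :
    ∫ y in Ioo A B, 1 / (z - (y : ℂ)) = Complex.log (z - A) - Complex.log (z - B) := by
  rw [← integral_Ioc_eq_integral_Ioo, ← intervalIntegral.integral_of_le hAB.le]
  have h : ∀ y ∈ uIcc A B, HasDerivAt (fun y : ℝ => -Complex.log (z - y)) (1 / (z - (y : ℂ))) y := by
    intro y _
    have h1 : HasDerivAt (fun y : ℝ => z - (y : ℂ)) (-1) y := by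
      simpa using (Complex.ofRealCLM.hasDerivAt (x := y)).const_sub z
    have h2 := (h1.clog_real (Or.inr (by simpa using hz))).neg
    refine h2.congr_deriv ?_
    ring
  rw [intervalIntegral.integral_eq_sub_of_hasDerivAt h
    ((continuous_one_div_sub hz).intervalIntegrable _ _)]
  ring

namespace HasContinuedDensity

variable {μ : Measure ℝ} {A B : ℝ} {g : ℂ → ℂ} {d : ℝ → ℝ}

theorem exists_bound (hd : HasContinuedDensity μ A B g d) :
    ∃ M, 0 ≤ M ∧ ∀ y ∈ Icc A B, d y ≤ M := by
  obtain ⟨M, hM⟩ := isCompact_Icc.exists_bound_of_continuousOn hd.continuousOn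
  refine ⟨M, (norm_nonneg _).trans (hM A (left_mem_Icc.2 hd.lt.le)), fun y hy => ?_⟩
  exact (le_abs_self _).trans (hM y hy)

theorem differentiableOn_dslope (hd : HasContinuedDensity μ A B g d) {z : ℂ}
    (hz : z ∈ cutPlane A B) : DifferentiableOn ℂ (dslope g z) (cutPlane A B) :=
  (Complex.differentiableOn_dslope ((isOpen_cutPlane A B).mem_nhds hz)).2 hd.differentiableOn

/-- Divided differences of `g` are bounded locally uniformly in one variable, although `(A, B)`
reaches the boundary of the cut plane: close to the base point the derivative of `g` bounds them,
and elsewhere the density does. -/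
theorem exists_dslope_bound (hd : HasContinuedDensity μ A B g d) {z₀ : ℂ}
    (hz₀ : z₀ ∈ cutPlane A B) : ∃ r > 0, ∃ C, Metric.closedBall z₀ r ⊆ cutPlane A B ∧
      ∀ z ∈ Metric.closedBall z₀ r, ∀ y ∈ Ioo A B, ‖dslope g z y‖ ≤ C := by
  obtain ⟨R, hR, hball⟩ := Metric.nhds_basis_closedBall.mem_iff.1
    ((isOpen_cutPlane A B).mem_nhds hz₀)
  obtain ⟨M, hM0, hM⟩ := hd.exists_bound
  have hcomp := isCompact_closedBall z₀ R
  obtain ⟨M₀, hM₀⟩ := hcomp.exists_bound_of_continuousOn (hd.differentiableOn.continuousOn.mono hball)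
  obtain ⟨M₁, hM₁⟩ := hcomp.exists_bound_of_continuousOn
    ((hd.differentiableOn.deriv (isOpen_cutPlane A B)).continuousOn.mono hball)
  refine ⟨R / 2, by positivity, max M₁ ((M₀ + M) / (R / 2)),
    (Metric.closedBall_subset_closedBall (by linarith)).trans hball, fun z hz y hy => ?_⟩
  have hzR : z ∈ Metric.closedBall z₀ R := Metric.closedBall_subset_closedBall (by linarith) hz
  by_cases hyR : (y : ℂ) ∈ Metric.closedBall z₀ R
  · refine le_trans ?_ (le_max_left _ _)
    rcases eq_or_ne (y : ℂ) z with h | h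
    · rw [h, dslope_same]
      exact hM₁ z hzR
    · have hlip := Convex.norm_image_sub_le_of_norm_deriv_le (f := g)
        (fun w hw => hd.differentiableOn.differentiableAt
          ((isOpen_cutPlane A B).mem_nhds (hball hw))) hM₁ (convex_closedBall z₀ R) hzR hyR
      rw [dslope_of_ne _ h, slope_def_field, norm_div,
        div_le_iff₀ (norm_pos_iff.2 (sub_ne_zero.2 h))]
      exact hlip
  · refine le_trans ?_ (le_max_right _ _)
    have h1 : R / 2 ≤ ‖(y : ℂ) - z‖ := by
      rw [mem_closedBall_iff_norm] at hz hyR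
      have := norm_sub_le_norm_sub_add_norm_sub (y : ℂ) z z₀
      linarith
    have h : (y : ℂ) ≠ z := by rintro rfl; exact hyR hzR
    rw [dslope_of_ne _ h, slope_def_field, norm_div]
    have h2 : ‖g y - g z‖ ≤ M₀ + M := by
      refine (norm_sub_le _ _).trans ?_
      rw [hd.eqOn y hy, Complex.norm_real, Real.norm_of_nonneg (hd.nonneg y), add_comm]
      exact add_le_add (hM₀ z hzR) (hM y (Ioo_subset_Icc_self hy))
    exact div_le_div₀ ((norm_nonneg _).trans h2) h2 (by positivity) h1

theorem aestronglyMeasurable_dslope (hd : HasContinuedDensity μ A B g d) {z : ℂ}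
    (hz : z ∈ cutPlane A B) :
    AEStronglyMeasurable (fun y : ℝ => dslope g z y) (volume.restrict (Ioo A B)) :=
  ((hd.differentiableOn_dslope hz).continuousOn.comp Complex.continuous_ofReal.continuousOn
    fun _ hy => ofReal_mem_cutPlane hy).aestronglyMeasurable measurableSet_Ioo

theorem differentiableOn_integral_dslope (hd : HasContinuedDensity μ A B g d) :
    DifferentiableOn ℂ (fun z => ∫ y in Ioo A B, dslope g z y) (cutPlane A B) := by
  intro z₀ hz₀
  obtain ⟨r, hr, C, hsub, hC⟩ := hd.exists_dslope_bound hz₀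
  have hdiff : ∀ y ∈ Ioo A B, DifferentiableOn ℂ (fun z => dslope g z (y : ℂ)) (cutPlane A B) := by
    intro y hy
    have h := hd.differentiableOn_dslope (ofReal_mem_cutPlane hy)
    exact h.congr fun z _ => dslope_symm _ _
  have hderiv : ∀ y ∈ Ioo A B, ∀ z ∈ Metric.ball z₀ (r / 2),
      HasDerivAt (fun z => dslope g z (y : ℂ)) (deriv (fun z => dslope g z (y : ℂ)) z) z := by
    intro y hy z hz
    refine ((hdiff y hy).differentiableAt ((isOpen_cutPlane A B).mem_nhds (hsub ?_))).hasDerivAt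
    exact Metric.ball_subset_closedBall (Metric.ball_subset_ball (by linarith) hz)
  have hz₀r : z₀ ∈ Metric.ball z₀ (r / 2) := Metric.mem_ball_self (by positivity)
  refine (hasDerivAt_integral_of_dominated_loc_of_deriv_le
    (F' := fun z y => deriv (fun z => dslope g z ((y : ℝ) : ℂ)) z) (bound := fun _ => C / (r / 2))
    (Metric.ball_mem_nhds z₀ (half_pos hr)) ?_ ?_ ?_ ?_ ?_ ?_).2.differentiableAt.differentiableWithinAt
  · filter_upwards [(isOpen_cutPlane A B).mem_nhds hz₀] with z hz
    exact hd.aestronglyMeasurable_dslope hz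
  · exact Integrable.of_bound (hd.aestronglyMeasurable_dslope hz₀) C
      ((ae_restrict_iff' measurableSet_Ioo).2 (ae_of_all _ fun y hy =>
        hC z₀ (Metric.mem_closedBall_self hr.le) y hy))
  · -- the derivative in the parameter is a pointwise limit of difference quotients
    have hlim : Tendsto (fun n : ℕ => z₀ + ((1 / ((n : ℝ) + 1) : ℝ) : ℂ)) atTop (𝓝[≠] z₀) := by
      refine tendsto_nhdsWithin_iff.2 ⟨?_, Eventually.of_forall fun n => ?_⟩
      · have := ((Complex.continuous_ofReal.tendsto 0).comp
          tendsto_one_div_add_atTop_nhds_zero_nat).const_add z₀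
        simpa using this
      · have h1 : (1 / ((n : ℝ) + 1)) ≠ 0 := by positivity
        have h2 : ((1 / ((n : ℝ) + 1) : ℝ) : ℂ) ≠ 0 := by exact_mod_cast h1
        rw [mem_compl_iff, mem_singleton_iff, add_eq_left]
        exact h2
    have hev : ∀ᶠ n : ℕ in atTop, z₀ + ((1 / ((n : ℝ) + 1) : ℝ) : ℂ) ∈ cutPlane A B :=
      (hlim.mono_right nhdsWithin_le_nhds).eventually ((isOpen_cutPlane A B).mem_nhds hz₀)
    obtain ⟨n₀, hn₀⟩ := eventually_atTop.1 hev
    refine aestronglyMeasurable_of_tendsto_ae atTop (f := fun (n : ℕ) (y : ℝ) =>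
      slope (fun z => dslope g z (y : ℂ)) z₀ (z₀ + ((1 / (((n + n₀ : ℕ) : ℝ) + 1) : ℝ) : ℂ))) ?_ ?_
    · intro n
      simp only [slope_def_field, div_eq_mul_inv _ (_ - z₀)]
      exact AEStronglyMeasurable.mul_const (AEStronglyMeasurable.sub
        (hd.aestronglyMeasurable_dslope (hn₀ (n + n₀) (Nat.le_add_left _ _)))
        (hd.aestronglyMeasurable_dslope hz₀)) _
    · refine (ae_restrict_iff' measurableSet_Ioo).2 (ae_of_all _ fun y hy => ?_)
      exact (hasDerivAt_iff_tendsto_slope.1 (hderiv y hy z₀ hz₀r)).comp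
        (hlim.comp (tendsto_add_atTop_nat n₀))
  · refine (ae_restrict_iff' measurableSet_Ioo).2 (ae_of_all _ fun y hy z hz => ?_)
    have hz' : Metric.closedBall z (r / 2) ⊆ Metric.closedBall z₀ r := by
      refine Metric.closedBall_subset_closedBall' ?_
      have := Metric.mem_ball.1 hz
      linarith
    refine Complex.norm_deriv_le_of_forall_mem_sphere_norm_le (half_pos hr) ?_ fun w hw =>
      hC w (hz' (Metric.sphere_subset_closedBall hw)) y hy
    refine DifferentiableOn.diffContOnCl ?_
    rw [closure_ball z (half_pos hr).ne']
    exact (hdiff y hy).mono (hz'.trans hsub)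
  · exact integrable_const _
  · exact (ae_restrict_iff' measurableSet_Ioo).2 (ae_of_all _ fun y hy => hderiv y hy)

/-- The Cauchy transform on the upper half-plane continues analytically through `(A, B)`; below the
real axis the continuation differs from the Cauchy transform by the jump `2πi g`. The density at
`y` is split as `g y = (g y - g z) + g z`: the divided difference integrates to a holomorphic
function, and the constant contributes a logarithm whose branch is chosen to be analytic across
`(A, B)`. -/
theorem exists_continuation (hd : HasContinuedDensity μ A B g d) :
    ∃ H : ℂ → ℂ, DifferentiableOn ℂ H (cutPlane A B) ∧
      (∀ z : ℂ, 0 < z.im → H z = cauchyTransform μ z) ∧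
      ∀ z : ℂ, z.im < 0 → H z = cauchyTransform μ z - 2 * Real.pi * Complex.I * g z := by
  set L : ℂ → ℂ := fun z => Complex.log (z - A) - Complex.log (B - z) - Real.pi * Complex.I with hL
  have hsplit : ∀ z : ℂ, z.im ≠ 0 → cauchyTransform μ z =
      -(∫ y in Ioo A B, dslope g z y) + g z * (Complex.log (z - A) - Complex.log (z - B)) := by
    intro z hz
    have hzE : z ∈ cutPlane A B := Or.inl hz
    obtain ⟨r, hr, C, -, hC⟩ := hd.exists_dslope_bound hzE
    have hi : Integrable (fun y : ℝ => dslope g z y) (volume.restrict (Ioo A B)) :=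
      Integrable.of_bound (hd.aestronglyMeasurable_dslope hzE) C
        ((ae_restrict_iff' measurableSet_Ioo).2 (ae_of_all _ fun y hy =>
          hC z (Metric.mem_closedBall_self hr.le) y hy))
    have hi' : Integrable (fun y : ℝ => -dslope g z y) (volume.restrict (Ioo A B)) := hi.neg
    rw [hd.cauchy z hz, ← integral_one_div_sub hd.lt hz, ← integral_const_mul, ← integral_neg,
      ← integral_add hi' ((integrable_one_div_sub _ hz).const_mul _)]
    refine setIntegral_congr_fun measurableSet_Ioo fun y hy => ?_
    have h1 := sub_ofReal_ne_zero hz y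
    have h2 : (y : ℂ) ≠ z := (sub_ne_zero.1 h1).symm
    rw [dslope_of_ne _ h2, slope_def_field, ← hd.eqOn y hy, ← neg_sub z (y : ℂ)]
    field_simp
    ring
  refine ⟨fun z => -(∫ y in Ioo A B, dslope g z y) + g z * L z, ?_, ?_, ?_⟩
  · refine hd.differentiableOn_integral_dslope.neg.add (hd.differentiableOn.mul ?_)
    intro z hz
    have h1 : z - A ∈ Complex.slitPlane := by
      rcases hz with h | h
      · exact Or.inr (by simpa using h)
      · exact Or.inl (by simpa using h.1)
    have h2 : B - z ∈ Complex.slitPlane := by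
      rcases hz with h | h
      · exact Or.inr (by simpa using h)
      · exact Or.inl (by simpa using h.2)
    exact ((((differentiableAt_id.sub_const _).clog h1).sub
      ((differentiableAt_id.const_sub _).clog h2)).sub_const _).differentiableWithinAt
  · intro z hz
    rw [hsplit z hz.ne', log_sub_ofReal_of_im_pos B hz]
    simp only [hL]
    ring
  · intro z hz
    rw [hsplit z hz.ne, log_sub_ofReal_of_im_neg B hz]
    simp only [hL]
    ring

theorem neg_im_cauchyTransform (hd : HasContinuedDensity μ A B g d) {z : ℂ} (hz : 0 < z.im) :
    -(cauchyTransform μ z).im =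
      ∫ y in Ioo A B, d y * (z.im / ((y - z.re) ^ 2 + z.im ^ 2)) := by
  obtain ⟨M, hM0, hM⟩ := hd.exists_bound
  have hint : Integrable (fun y : ℝ => (d y : ℂ) / (z - y)) (volume.restrict (Ioo A B)) := by
    refine Integrable.of_bound (ContinuousOn.aestronglyMeasurable ?_ measurableSet_Ioo)
      (M * (1 / |z.im|)) ((ae_restrict_iff' measurableSet_Ioo).2 (ae_of_all _ fun y hy => ?_))
    · exact (Complex.continuous_ofReal.comp_continuousOn
        (hd.continuousOn.mono Ioo_subset_Icc_self)).div (by fun_prop)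
        fun y _ => sub_ofReal_ne_zero hz.ne' y
    · rw [← mul_one_div, norm_mul, Complex.norm_real, Real.norm_of_nonneg (hd.nonneg y)]
      exact mul_le_mul (hM y (Ioo_subset_Icc_self hy)) (norm_one_div_sub_le hz.ne' y)
        (norm_nonneg _) hM0
  have h1 : (∫ y in Ioo A B, (d y : ℂ) / (z - y)).im = ∫ y in Ioo A B, ((d y : ℂ) / (z - y)).im :=
    (integral_im hint).symm
  rw [hd.cauchy z hz.ne', h1, ← integral_neg]
  refine integral_congr_ae (ae_of_all _ fun y => ?_)
  simp only
  have h2 : ‖z - (y : ℂ)‖ ^ 2 = (y - z.re) ^ 2 + z.im ^ 2 := by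
    rw [← Complex.normSq_eq_norm_sq, Complex.normSq_apply]
    simp
    ring
  rw [← mul_one_div, Complex.im_ofReal_mul, im_one_div_sub, h2]
  ring

theorem integrable_poisson_kernel (u : ℝ) {v : ℝ} (hv : 0 < v) :
    Integrable fun y : ℝ => v / ((y - u) ^ 2 + v ^ 2) := by
  by_contra h
  have := integral_undef h
  rw [integral_poisson_kernel u hv] at this
  exact Real.pi_ne_zero this

/-- A density that is at most `ε + K (y - Re z) ^ 2` on `(A, B)` has Poisson integral at most
`πε + K (B - A) Im z`. -/
theorem neg_im_cauchyTransform_le (hd : HasContinuedDensity μ A B g d) {z : ℂ} (hz : 0 < z.im)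
    {ε K : ℝ} (hε : 0 ≤ ε) (hK : 0 ≤ K)
    (h : ∀ y ∈ Ioo A B, d y ≤ ε + K * ((y - z.re) ^ 2 + z.im ^ 2)) :
    -(cauchyTransform μ z).im ≤ ε * Real.pi + K * (B - A) * z.im := by
  rw [hd.neg_im_cauchyTransform hz]
  set k : ℝ → ℝ := fun y => z.im / ((y - z.re) ^ 2 + z.im ^ 2) with hk
  have hki : Integrable k := integrable_poisson_kernel z.re hz
  have hk0 : ∀ y, 0 ≤ k y := fun y => by positivity
  have hpos : ∀ y : ℝ, 0 < (y - z.re) ^ 2 + z.im ^ 2 := fun y => by positivity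
  have hki' : Integrable (fun y => ε * k y + K * z.im) (volume.restrict (Ioo A B)) :=
    (hki.restrict.const_mul _).add (integrable_const _)
  have h1 : ∫ y in Ioo A B, d y * k y ≤ ∫ y in Ioo A B, (ε * k y + K * z.im) := by
    refine integral_mono_of_nonneg (ae_of_all _ fun y => mul_nonneg (hd.nonneg y) (hk0 y)) hki'
      ((ae_restrict_iff' measurableSet_Ioo).2 (ae_of_all _ fun y hy => ?_))
    have h2 := mul_le_mul_of_nonneg_right (h y hy) (hk0 y)
    have h3 : ((y - z.re) ^ 2 + z.im ^ 2) * k y = z.im := mul_div_cancel₀ _ (hpos y).ne'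
    simp only
    nlinarith
  refine h1.trans ?_
  have h4 : ∫ y in Ioo A B, k y ≤ Real.pi := by
    rw [← integral_poisson_kernel z.re hz]
    exact setIntegral_le_integral hki (ae_of_all _ hk0)
  rw [integral_add (hki.restrict.const_mul _) (integrable_const _), integral_const_mul]
  have h5 : ∫ _ in Ioo A B, K * z.im = K * (B - A) * z.im := by
    rw [setIntegral_const, Real.volume_real_Ioo_of_le hd.lt.le, smul_eq_mul]
    ring
  rw [h5]
  have := mul_le_mul_of_nonneg_left h4 hε
  linarith

variable {H : ℂ → ℂ}

/-- Lower bounds for `Im H` pass from the upper half-plane to the interval `(A, B)`. -/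
theorem le_im_of_le_im_cauchyTransform (hH : DifferentiableOn ℂ H (cutPlane A B))
    (hHu : ∀ z : ℂ, 0 < z.im → H z = cauchyTransform μ z) {U : Set ℂ} (hU : IsOpen U) {m : ℝ}
    (hm : ∀ z ∈ U, 0 < z.im → m ≤ (cauchyTransform μ z).im) {z : ℂ} (hzU : z ∈ U)
    (hz : 0 ≤ z.im) (hzE : z ∈ cutPlane A B) : m ≤ (H z).im := by
  have hc : ContinuousAt H z :=
    (hH.differentiableAt ((isOpen_cutPlane A B).mem_nhds hzE)).continuousAt
  have hlim : Tendsto (fun v : ℝ => z + (v : ℂ) * Complex.I) (𝓝[>] 0) (𝓝 z) := by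
    have : Continuous fun v : ℝ => z + (v : ℂ) * Complex.I := by fun_prop
    simpa using (this.tendsto 0).mono_left (nhdsWithin_le_nhds (s := Ioi (0 : ℝ)))
  refine ge_of_tendsto ((Complex.continuous_im.tendsto _).comp (hc.tendsto.comp hlim)) ?_
  filter_upwards [hlim (hU.mem_nhds hzU), self_mem_nhdsWithin] with v hv hv0
  have hpos : 0 < (z + (v : ℂ) * Complex.I).im := by
    have : 0 < v := hv0
    simp
    linarith
  simp only [Function.comp_apply]
  rw [hHu _ hpos]
  exact hm _ hv hpos

theorem exists_le_im_of_im_nonneg (hd : HasContinuedDensity μ A B g d)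
    (hH : DifferentiableOn ℂ H (cutPlane A B))
    (hHu : ∀ z : ℂ, 0 < z.im → H z = cauchyTransform μ z) :
    ∃ m, ∀ z ∈ cutPlane A B, 0 ≤ z.im → m ≤ (H z).im := by
  obtain ⟨M, hM0, hM⟩ := hd.exists_bound
  refine ⟨-(M * Real.pi), fun z hzE hz => le_im_of_le_im_cauchyTransform hH hHu isOpen_univ
    (fun w _ hw => ?_) (mem_univ z) hz hzE⟩
  have := hd.neg_im_cauchyTransform_le hw hM0 le_rfl
    (fun y hy => by simpa using hM y (Ioo_subset_Icc_self hy))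
  linarith

/-- As `z` tends from the closed upper half-plane to a real point outside `(A, B)`, the limiting
imaginary part of the continuation is nonnegative: the Poisson integral of the density, extended by
zero, tends to zero there. -/
theorem eventually_le_im_of_im_nonneg (hd : HasContinuedDensity μ A B g d)
    (hH : DifferentiableOn ℂ H (cutPlane A B))
    (hHu : ∀ z : ℂ, 0 < z.im → H z = cauchyTransform μ z) {x : ℝ} (hx : x ∉ Ioo A B) {ε : ℝ}
    (hε : 0 < ε) : ∀ᶠ z in 𝓝 (x : ℂ), z ∈ cutPlane A B → 0 ≤ z.im → -ε ≤ (H z).im := by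
  obtain ⟨M, hM0, hM⟩ := hd.exists_bound
  set e := IccExtend hd.lt.le ((Icc A B).domRestrict d) with he
  have hec : Continuous e := hd.continuousOn.domRestrict.Icc_extend'
  have hex : e x = 0 := by
    rcases le_or_gt x A with h | h
    · rw [he, IccExtend_of_le_left _ _ h]; exact hd.left
    · have hB : B ≤ x := by
        by_contra hcon
        exact hx ⟨h, not_le.1 hcon⟩
      rw [he, IccExtend_of_right_le _ _ hB]; exact hd.right
  have hed : ∀ y ∈ Ioo A B, d y = e y := fun y hy =>
    (IccExtend_of_mem hd.lt.le ((Icc A B).domRestrict d) (Ioo_subset_Icc_self hy)).symm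
  set ε' := ε / (2 * Real.pi) with hε'
  have hε'0 : 0 < ε' := by positivity
  obtain ⟨δ, hδ, hδe⟩ := Metric.continuousAt_iff.1 (hec.continuousAt (x := x)) ε' hε'0
  -- near `x` the density is at most `ε'`; farther away it is at most `M ≤ K |y - z| ^ 2`
  set K := M / (δ / 2) ^ 2 with hK
  have hK0 : 0 ≤ K := by positivity
  have hAB : 0 < B - A := sub_pos.2 hd.lt
  set U : Set ℂ := {z | |z.re - x| < δ / 2} ∩ {z | K * (B - A) * z.im < ε / 2} with hU
  have hUo : IsOpen U := by
    refine (isOpen_lt ?_ continuous_const).inter (isOpen_lt ?_ continuous_const)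
    · exact (Complex.continuous_re.sub continuous_const).abs
    · exact continuous_const.mul Complex.continuous_im
  have hxU : (x : ℂ) ∈ U := by
    refine ⟨?_, ?_⟩
    · simpa using hδ
    · simpa using hε
  filter_upwards [hUo.mem_nhds hxU] with z hzU hzE hz
  refine le_im_of_le_im_cauchyTransform hH hHu hUo (fun w hwU hw => ?_) hzU hz hzE
  have h1 := hd.neg_im_cauchyTransform_le hw hε'0.le hK0 (fun y hy => by
    by_cases hy' : |y - x| < δ
    · have h2 := hδe (x := y) (by rwa [Real.dist_eq])
      rw [hex, Real.dist_eq, sub_zero, ← hed y hy] at h2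
      have := (le_abs_self _).trans h2.le
      have h3 : 0 ≤ K * ((y - w.re) ^ 2 + w.im ^ 2) := by positivity
      linarith
    · have h2 : δ / 2 ≤ |y - w.re| := by
        have h3 := abs_sub_le y w.re x
        have h4 : |w.re - x| < δ / 2 := hwU.1
        linarith [not_lt.1 hy']
      have h5 : (δ / 2) ^ 2 ≤ (y - w.re) ^ 2 := by
        rw [← sq_abs (y - w.re)]
        exact pow_le_pow_left₀ (by positivity) h2 2
      have h6 : M ≤ K * ((y - w.re) ^ 2 + w.im ^ 2) := by
        rw [hK, div_mul_eq_mul_div, le_div_iff₀ (by positivity)]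
        exact mul_le_mul_of_nonneg_left (by nlinarith [sq_nonneg w.im]) hM0
      linarith [hM y (Ioo_subset_Icc_self hy)])
  have h2 : K * (B - A) * w.im < ε / 2 := hwU.2
  have h3 : ε' * Real.pi = ε / 2 := by
    rw [hε']
    field_simp
  linarith

end HasContinuedDensity

/-! ### Univalence of the continued Cauchy transform on a slit sector -/

/-- The open sector `-θ < arg z < 0`, for `0 < θ ≤ π`. -/
def lowerSector (θ : ℝ) : Set ℂ := {z | z.im < 0 ∧ 0 < z.re * Real.sin θ + z.im * Real.cos θ}

/-- The upper half-plane and the sector `-θ < arg z < 0`, joined through the interval `(A, B)`. -/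
def slitSector (A B θ : ℝ) : Set ℂ :=
  {z ∈ cutPlane A B | z.im < 0 → 0 < z.re * Real.sin θ + z.im * Real.cos θ}

theorem mem_slitSector_or {A B θ : ℝ} {z : ℂ} (hz : z ∈ slitSector A B θ) :
    (0 ≤ z.im ∧ z ∈ cutPlane A B) ∨ z ∈ lowerSector θ := by
  rcases lt_or_ge z.im 0 with h | h
  · exact Or.inr ⟨h, hz.2 h⟩
  · exact Or.inl ⟨h, hz.1⟩

theorem lowerSector_subset_slitSector {A B θ : ℝ} : lowerSector θ ⊆ slitSector A B θ :=
  fun _ hz => ⟨Or.inl hz.1.ne, fun _ => hz.2⟩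

theorem upperHalfPlane_subset_slitSector {A B θ : ℝ} {z : ℂ} (hz : 0 < z.im) :
    z ∈ slitSector A B θ := ⟨Or.inl hz.ne', fun h => absurd h hz.le.not_gt⟩

section Sector

variable {A B θ : ℝ}

theorem isOpen_slitSector (hA : 0 < A) (hθ0 : 0 < θ) (hθ : θ ≤ Real.pi) :
    IsOpen (slitSector A B θ) := by
  have hcont : Continuous fun z : ℂ => z.re * Real.sin θ + z.im * Real.cos θ :=
    (Complex.continuous_re.mul continuous_const).add (Complex.continuous_im.mul continuous_const)
  rw [isOpen_iff_mem_nhds]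
  intro z hz
  have hcut := (isOpen_cutPlane A B).mem_nhds hz.1
  rcases lt_trichotomy z.im 0 with h | h | h
  · filter_upwards [hcut, (isOpen_lt continuous_const hcont).mem_nhds (hz.2 h)] with w hw hw'
    exact ⟨hw, fun _ => hw'⟩
  · have hre : A < z.re := by
      rcases hz.1 with h' | h'
      · exact absurd h h'
      · exact h'.1
    rcases hθ.lt_or_eq with hlt | rfl
    · have hpos : 0 < z.re * Real.sin θ + z.im * Real.cos θ := by
        rw [h, zero_mul, add_zero]
        exact mul_pos (hA.trans hre) (Real.sin_pos_of_pos_of_lt_pi hθ0 hlt)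
      filter_upwards [hcut, (isOpen_lt continuous_const hcont).mem_nhds hpos] with w hw hw'
      exact ⟨hw, fun _ => hw'⟩
    · filter_upwards [hcut] with w hw
      exact ⟨hw, fun h' => by simpa using h'⟩
  · filter_upwards [hcut, isOpen_upperHalfPlane.mem_nhds h] with w hw hw'
    exact ⟨hw, fun h' => absurd h' (lt_asymm hw')⟩

/-- The slit sector is star-shaped about each point of `(A, B)`. -/
theorem isPreconnected_slitSector (hA : 0 < A) (hAB : A < B) (hθ0 : 0 < θ) (hθ : θ ≤ Real.pi) :
    IsPreconnected (slitSector A B θ) := by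
  obtain ⟨x, hx⟩ := exists_between hAB
  have hsin : 0 ≤ Real.sin θ := Real.sin_nonneg_of_nonneg_of_le_pi hθ0.le hθ
  have hxmem : (x : ℂ) ∈ slitSector A B θ := ⟨ofReal_mem_cutPlane hx, fun h => by simp at h⟩
  suffices h : StarConvex ℝ (x : ℂ) (slitSector A B θ) from
    (h.isPathConnected hxmem).isConnected.isPreconnected
  rw [starConvex_iff_forall_pos hxmem]
  intro z hz s t hs ht hst
  have hre : (s • (x : ℂ) + t • z).re = s * x + t * z.re := by simp
  have him : (s • (x : ℂ) + t • z).im = t * z.im := by simp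
  refine ⟨?_, fun h => ?_⟩
  · rcases hz.1 with h | h
    · exact Or.inl (by rw [him]; exact mul_ne_zero ht.ne' h)
    · refine Or.inr ?_
      rw [hre]
      obtain rfl : s = 1 - t := by linarith
      constructor <;> nlinarith [hx.1, hx.2, h.1, h.2]
  · rw [him] at h
    have h1 := hz.2 (by nlinarith)
    rw [hre, him]
    have h2 : 0 ≤ s * x * Real.sin θ := by
      have := hA.trans hx.1
      positivity
    nlinarith [mul_pos ht h1]

end Sector

namespace HasContinuedDensity

variable {μ : Measure ℝ} {A B θ : ℝ} {g H : ℂ → ℂ} {d : ℝ → ℝ}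

theorem ae_abs_le (hd : HasContinuedDensity μ A B g d) : ∀ᵐ x ∂μ, |x| ≤ max |A| |B| := by
  filter_upwards [hd.support] with x hx
  exact abs_le_max_abs_abs hx.1 hx.2

variable [IsProbabilityMeasure μ]

theorem tendsto_cauchyTransform_cobounded (hd : HasContinuedDensity μ A B g d) :
    Tendsto (cauchyTransform μ) (Bornology.cobounded ℂ) (𝓝 0) := by
  set M := max |A| |B| with hM
  have hn := tendsto_norm_cobounded_atTop (E := ℂ)
  have h1 : Tendsto (fun z : ℂ => 2 * M / ‖z‖ ^ 2 + 1 / ‖z‖) (Bornology.cobounded ℂ) (𝓝 0) := by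
    have := (tendsto_const_nhds (x := 2 * M)).div_atTop
      ((tendsto_pow_atTop two_ne_zero).comp hn)
    simpa using this.add ((tendsto_const_nhds (x := (1 : ℝ))).div_atTop hn)
  refine squeeze_zero_norm' ?_ h1
  filter_upwards [hn.eventually_ge_atTop (2 * M), hn.eventually_gt_atTop 0] with z hz hz0
  have h2 := norm_cauchyTransform_sub_le hd.ae_abs_le hz (norm_pos_iff.1 hz0)
  calc ‖cauchyTransform μ z‖ ≤ ‖cauchyTransform μ z - 1 / z‖ + ‖1 / z‖ := by
        simpa using norm_add_le (cauchyTransform μ z - 1 / z) (1 / z)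
    _ ≤ _ := by rw [norm_div, norm_one]; gcongr

theorem norm_cauchyTransform_le_of_norm_le (hd : HasContinuedDensity μ A B g d) (hA : 0 < A)
    {z : ℂ} (hz : ‖z‖ ≤ A / 2) : ‖cauchyTransform μ z‖ ≤ 2 / A := by
  refine (norm_integral_le_of_norm_le_const (C := 2 / A) ?_).trans (by simp)
  filter_upwards [hd.support] with x hx
  have h1 := norm_sub_norm_le (x : ℂ) z
  rw [Complex.norm_real, Real.norm_of_nonneg (hA.le.trans hx.1), norm_sub_rev] at h1
  rw [norm_div, norm_one, div_le_div_iff₀ (by linarith [hx.1]) hA]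
  linarith [hx.1]

theorem im_cauchyTransform_neg {z : ℂ} (hz : 0 < z.im) : (cauchyTransform μ z).im < 0 := by
  rw [im_cauchyTransform hz.ne']
  have h1 : 0 < ∫ x : ℝ, ‖1 / (z - (x : ℂ))‖ ^ 2 ∂μ := by
    rw [integral_pos_iff_support_of_nonneg (fun x => by positivity)
      (integrable_norm_one_div_sub_sq μ hz.ne')]
    have : (Function.support fun x : ℝ => ‖1 / (z - (x : ℂ))‖ ^ 2) = univ := by
      ext x
      simp [sub_ofReal_ne_zero hz.ne' x]
    rw [this]
    simp
  nlinarith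

/-- Below the real axis the Cauchy transform has nonnegative imaginary part, so the imaginary part of
the continuation is controlled by the real part of the density alone. -/
theorem im_continuation_ge {z : ℂ} (hz : z.im < 0)
    (hHl : ∀ z : ℂ, z.im < 0 → H z = cauchyTransform μ z - 2 * Real.pi * Complex.I * g z) :
    -(2 * Real.pi * (g z).re) ≤ (H z).im := by
  have h1 : 0 ≤ (cauchyTransform μ z).im := by
    rw [im_cauchyTransform hz.ne]
    have : 0 ≤ ∫ x : ℝ, ‖1 / (z - (x : ℂ))‖ ^ 2 ∂μ := integral_nonneg fun x => by positivity
    nlinarith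
  have h2 : (2 * Real.pi * Complex.I * g z).im = 2 * Real.pi * (g z).re := by
    have : (2 * Real.pi * Complex.I * g z) = ((2 * Real.pi : ℝ) : ℂ) * (Complex.I * g z) := by
      push_cast; ring
    rw [this, Complex.im_ofReal_mul]
    simp
  rw [hHl z hz, Complex.sub_im, h2]
  linarith

/-- The continued Cauchy transform is proper over the lower half-plane as soon as the continued
density has asymptotically nonpositive real part along the boundary of the sector and explodes at
the vertex. -/
theorem properOver_slitSector (hd : HasContinuedDensity μ A B g d) (hA : 0 < A)
    (hH : DifferentiableOn ℂ H (cutPlane A B))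
    (hHu : ∀ z : ℂ, 0 < z.im → H z = cauchyTransform μ z)
    (hHl : ∀ z : ℂ, z.im < 0 → H z = cauchyTransform μ z - 2 * Real.pi * Complex.I * g z)
    (hbdry : ∀ p : ℂ, p ≠ 0 → p ∉ slitSector A B θ → ∀ ε > 0,
      ∀ᶠ z in 𝓝 p, z ∈ lowerSector θ → (g z).re ≤ ε)
    (hinf : ∀ ε > 0, ∀ᶠ z in Bornology.cobounded ℂ, z ∈ lowerSector θ → (g z).re ≤ ε)
    (hzero : ∀ M, ∀ᶠ z in 𝓝 (0 : ℂ), z ∈ lowerSector θ → M ≤ ‖g z‖) :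
    ProperOver H (slitSector A B θ) lowerHalfPlane := by
  intro F hF w hw hlim
  have hw0 : w.im < 0 := hw
  have hpi := Real.pi_pos
  -- a limit in the open lower half-plane excludes asymptotically nonnegative imaginary parts
  have hcontra : ¬ ∀ ε > 0, ∀ᶠ z in (F : Filter ℂ), -ε ≤ (H z).im := by
    intro hcon
    have h1 : 0 ≤ w.im := by
      refine le_of_forall_pos_le_add fun ε hε => ?_
      have := ge_of_tendsto ((Complex.continuous_im.tendsto w).comp hlim) (hcon ε hε)
      linarith
    linarith
  have hlow : (∀ ε > 0, ∀ᶠ z in (F : Filter ℂ), z ∈ lowerSector θ → (g z).re ≤ ε) →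
      lowerSector θ ∈ F → False := by
    intro h hS
    refine hcontra fun ε hε => ?_
    filter_upwards [h (ε / (2 * Real.pi)) (by positivity), hS] with z hz hzS
    have h1 := im_continuation_ge (μ := μ) hzS.1 hHl
    have h2 := hz hzS
    rw [le_div_iff₀ (by positivity)] at h2
    linarith
  have hsplit : {z | 0 ≤ z.im ∧ z ∈ cutPlane A B} ∈ F ∨ lowerSector θ ∈ F := by
    rw [← Ultrafilter.union_mem_iff]
    exact mem_of_superset hF fun z hz => mem_slitSector_or hz
  by_cases hbdd : ∃ R, Metric.closedBall (0 : ℂ) R ∈ F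
  · obtain ⟨R, hR⟩ := hbdd
    obtain ⟨p, -, hp⟩ := (isCompact_closedBall (0 : ℂ) R).ultrafilter_le_nhds F
      (le_principal_iff.2 hR)
    by_cases hpD : p ∈ slitSector A B θ
    · exact ⟨p, hpD, hp⟩
    exfalso
    rcases hsplit with hup | hS
    · have hp0 : 0 ≤ p.im := ge_of_tendsto ((Complex.continuous_im.tendsto p).mono_left hp)
        (by filter_upwards [hup] with z hz using hz.1)
      have hp1 : p.im = 0 := by
        refine le_antisymm (not_lt.1 fun h => hpD (upperHalfPlane_subset_slitSector h)) hp0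
      obtain ⟨x, rfl⟩ : ∃ x : ℝ, (x : ℂ) = p := ⟨p.re, Complex.ext (by simp) (by simp [hp1])⟩
      have hx : x ∉ Ioo A B := fun h => hpD ⟨ofReal_mem_cutPlane h, fun h' => by simp at h'⟩
      refine hcontra fun ε hε => ?_
      filter_upwards [hup, hp (hd.eventually_le_im_of_im_nonneg hH hHu hx hε)] with z hz1 hz2
      exact hz2 hz1.2 hz1.1
    · rcases eq_or_ne p 0 with rfl | hp0
      · have h1 : ∀ᶠ z in (F : Filter ℂ), ‖H z‖ < ‖w‖ + 1 :=
          ((continuous_norm.tendsto w).comp hlim).eventually_lt_const (lt_add_one _)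
        have h2 : ∀ᶠ z in (F : Filter ℂ), ‖z‖ ≤ A / 2 := by
          refine hp ?_
          filter_upwards [Metric.closedBall_mem_nhds (0 : ℂ) (half_pos hA)] with z hz
          exact mem_closedBall_zero_iff.1 hz
        have h3 : ∀ᶠ z in (F : Filter ℂ), False := by
          filter_upwards [h1, h2, hS, hp (hzero (2 / A + ‖w‖ + 1))] with z hz1 hz2 hzS hz3
          have h4 := hd.norm_cauchyTransform_le_of_norm_le hA hz2
          have h5 : 2 * Real.pi * Complex.I * g z = cauchyTransform μ z - H z := by
            rw [hHl z hzS.1]; ring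
          have h6 : ‖2 * Real.pi * Complex.I * g z‖ = 2 * Real.pi * ‖g z‖ := by
            simp [abs_of_pos hpi]
          have h7 := norm_sub_le (cauchyTransform μ z) (H z)
          rw [← h5, h6] at h7
          have h8 := hz3 hzS
          have h9 : 1 ≤ 2 * Real.pi := by linarith [Real.two_le_pi]
          nlinarith [norm_nonneg (g z)]
        exact F.neBot.ne (by simpa using h3)
      · exact hlow (fun ε hε => hp (hbdry p hp0 hpD ε hε)) hS
  · exfalso
    push Not at hbdd
    have hcob : (F : Filter ℂ) ≤ Bornology.cobounded ℂ := by
      rw [← comap_norm_atTop, ← tendsto_iff_comap, tendsto_atTop]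
      intro R
      refine Filter.mem_of_superset (Ultrafilter.compl_mem_iff_notMem.2 (hbdd R)) fun z hz => ?_
      rw [mem_compl_iff, mem_closedBall_zero_iff, not_le] at hz
      exact hz.le
    rcases hsplit with hup | hS
    · have h0 := (hd.tendsto_cauchyTransform_cobounded).mono_left hcob
      refine hcontra fun ε hε => ?_
      have hre : ∀ᶠ z in (F : Filter ℂ), max |A| |B| < ‖z‖ :=
        hcob (tendsto_norm_cobounded_atTop.eventually_gt_atTop _)
      filter_upwards [hup, hre, h0 (Metric.ball_mem_nhds 0 hε)] with z hz1 hz2 hz3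
      have him : 0 < z.im := by
        refine lt_of_le_of_ne hz1.1 fun h => ?_
        rcases hz1.2 with h' | h'
        · exact h' h.symm
        · have h4 : z = (z.re : ℂ) := Complex.ext (by simp) (by simp [← h])
          rw [h4, Complex.norm_real, Real.norm_eq_abs] at hz2
          exact hz2.not_ge (abs_le_max_abs_abs h'.1.le h'.2.le)
      rw [hHu z him]
      rw [mem_preimage, mem_ball_zero_iff] at hz3
      exact (abs_le.1 ((Complex.abs_im_le_norm _).trans hz3.le)).1
    · exact hlow (fun ε hε => hcob (hinf ε hε)) hS

/-- Membership in UI from the behaviour of the continued density `g` on the sector: besides the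
conditions for properness, values far down the imaginary axis are taken at most once near the
vertex (`huniq`). By `hbd` and the bound for the density on `[A, B]`, such values are not taken
elsewhere. -/
theorem isUI_of_boundary_behaviour (hd : HasContinuedDensity μ A B g d) (hA : 0 < A)
    (hθ0 : 0 < θ) (hθ : θ ≤ Real.pi)
    (hbdry : ∀ p : ℂ, p ≠ 0 → p ∉ slitSector A B θ → ∀ ε > 0,
      ∀ᶠ z in 𝓝 p, z ∈ lowerSector θ → (g z).re ≤ ε)
    (hinf : ∀ ε > 0, ∀ᶠ z in Bornology.cobounded ℂ, z ∈ lowerSector θ → (g z).re ≤ ε)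
    (hzero : ∀ M, ∀ᶠ z in 𝓝 (0 : ℂ), z ∈ lowerSector θ → M ≤ ‖g z‖)
    (hbd : ∀ δ > 0, ∃ C, ∀ z ∈ lowerSector θ, δ ≤ ‖z‖ → (g z).re ≤ C)
    (huniq : ∃ δ > 0, ∀ y : ℝ, y < 0 → ∀ z₁ ∈ lowerSector θ, ∀ z₂ ∈ lowerSector θ,
      ‖z₁‖ < δ → ‖z₂‖ < δ →
      cauchyTransform μ z₁ - 2 * Real.pi * Complex.I * g z₁ = y * Complex.I →
      cauchyTransform μ z₂ - 2 * Real.pi * Complex.I * g z₂ = y * Complex.I → z₁ = z₂) :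
    IsUI μ ∧ IsFreelyInfinitelyDivisible μ := by
  obtain ⟨H, hH, hHu, hHl⟩ := hd.exists_continuation
  have hP := hd.properOver_slitSector hA hH hHu hHl hbdry hinf hzero
  obtain ⟨δ, hδ, huniq⟩ := huniq
  obtain ⟨C, hC⟩ := hbd δ hδ
  obtain ⟨m, hm⟩ := hd.exists_le_im_of_im_nonneg hH hHu
  have hpi := Real.pi_pos
  -- values `i y` with `y < Y` can only be attained in the sector within distance `δ` of the vertex
  set Y : ℝ := min (min m (-(2 * Real.pi * C))) 0 with hY
  set e : ℝ → ℂ := fun y => (y : ℂ) * Complex.I with he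
  have heim : ∀ y, (e y).im = y := fun y => by simp [he]
  have heinj : Function.Injective e := fun x y h => by rw [← heim x, ← heim y, h]
  have hconn : ∀ Z : Set ℂ, Z.Countable → IsPreconnected (lowerHalfPlane \ Z) := by
    intro Z hZ
    have h := isPreconnected_halfPlane_diff hZ (σ := -1) (by norm_num)
    have h2 : {z : ℂ | 0 < -1 * z.im} = lowerHalfPlane := by
      ext z
      simp [lowerHalfPlane]
    rwa [h2] at h
  have hsmall : ∀ z ∈ slitSector A B θ, ∀ y < Y, H z = e y → z ∈ lowerSector θ ∧ ‖z‖ < δ := by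
    intro z hz y hy hzy
    have h1 : (H z).im = y := by rw [hzy, heim]
    have hy1 : y < m := hy.trans_le ((min_le_left _ _).trans (min_le_left _ _))
    have hy2 : y < -(2 * Real.pi * C) := hy.trans_le ((min_le_left _ _).trans (min_le_right _ _))
    rcases mem_slitSector_or hz with h | h
    · have := hm z h.2 h.1
      linarith
    · refine ⟨h, ?_⟩
      by_contra! hcon
      have h2 := hC z h hcon
      have h3 := im_continuation_ge (μ := μ) h.1 hHl
      have h4 : 2 * Real.pi * (g z).re ≤ 2 * Real.pi * C := by gcongr
      linarith
  have hlowopen : IsOpen lowerHalfPlane := isOpen_lt Complex.continuous_im continuous_const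
  have hIup : (0 : ℝ) < (Complex.I).im := by simp
  obtain ⟨hinj, h, hh, hhH⟩ := hP.exists_inverse (T := e '' Iio Y)
    (isOpen_slitSector hA hθ0 hθ) (isPreconnected_slitSector hA hd.lt hθ0 hθ)
    (hH.mono fun z hz => hz.1) hlowopen hconn
    ⟨Complex.I, upperHalfPlane_subset_slitSector hIup, by
      rw [hHu _ hIup]; exact im_cauchyTransform_neg hIup⟩
    (by
      rintro ⟨c, hc⟩
      have h1 : ∀ z : ℂ, 0 < z.im → cauchyTransform μ z = c := fun z hz => by
        rw [← hHu z hz]; exact hc z (upperHalfPlane_subset_slitSector hz)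
      have h2 : Tendsto (fun y : ℝ => cauchyTransform μ (e y)) atTop (𝓝 0) := by
        refine hd.tendsto_cauchyTransform_cobounded.comp ?_
        rw [← tendsto_norm_atTop_iff_cobounded]
        refine tendsto_abs_atTop_atTop.congr fun y => ?_
        simp [he]
      have h3 : c = 0 := by
        refine tendsto_nhds_unique (tendsto_const_nhds.congr' ?_) h2
        filter_upwards [eventually_gt_atTop 0] with y hy
        exact (h1 _ (by rwa [heim])).symm
      have h4 := im_cauchyTransform_neg (μ := μ) hIup
      rw [h1 _ hIup, h3] at h4
      simp at h4)
    (by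
      intro hcount
      have h1 := (hcount.preimage_of_injOn heinj.injOn).measure_zero volume
      rw [preimage_image_eq _ heinj, Real.volume_Iio] at h1
      exact ENNReal.top_ne_zero h1)
    (by
      rintro _ ⟨y, hy, rfl⟩
      show (e y).im < 0
      rw [heim]
      exact lt_of_lt_of_le hy (min_le_right _ _))
    (by
      rintro z₁ hz₁ z₂ hz₂ ⟨y, hy, h1⟩ h12
      obtain ⟨hs1, hn1⟩ := hsmall z₁ hz₁ y hy h1.symm
      obtain ⟨hs2, hn2⟩ := hsmall z₂ hz₂ y hy (h12 ▸ h1.symm)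
      refine huniq y (lt_of_lt_of_le hy (min_le_right _ _)) z₁ hs1 z₂ hs2 hn1 hn2 ?_ ?_
      · rw [← hHl z₁ hs1.1, ← h1]
      · rw [← hHl z₂ hs2.1, ← h12, ← h1])
  refine isUI_and_isFreelyInfinitelyDivisible hd.ae_abs_le hh ?_ ?_ ?_
  · intro w₁ hw₁ w₂ hw₂ h12
    rw [← (hhH w₁ hw₁).2, ← (hhH w₂ hw₂).2, h12]
  · intro w hw hpos
    rw [← hHu _ hpos, (hhH w hw).2]
  · intro z hz
    have hGl : cauchyTransform μ z ∈ lowerHalfPlane := im_cauchyTransform_neg hz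
    have hHz := hHu z hz
    refine hinj ⟨(hhH _ hGl).1, ?_⟩ ⟨upperHalfPlane_subset_slitSector hz, ?_⟩ ?_
    · rw [mem_preimage, (hhH _ hGl).2]; exact hGl
    · rw [mem_preimage, hHz]; exact hGl
    · rw [(hhH _ hGl).2, hHz]

end HasContinuedDensity

/-! ### The continued density of a power of the variable -/

/-- The principal square root of a complex number. -/
noncomputable def rootTwo (u : ℂ) : ℂ := u ^ (2 : ℂ)⁻¹

theorem rootTwo_sq (u : ℂ) : rootTwo u ^ 2 = u := by
  simp [rootTwo]

theorem norm_rootTwo (u : ℂ) : ‖rootTwo u‖ = √‖u‖ := by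
  rw [eq_comm, Real.sqrt_eq_iff_eq_sq (norm_nonneg _) (norm_nonneg _), ← norm_pow, rootTwo_sq]

theorem rootTwo_eq (u : ℂ) :
    rootTwo u = (√‖u‖ : ℝ) * Complex.exp ((u.arg / 2 : ℝ) * Complex.I) := by
  rcases eq_or_ne u 0 with rfl | hu
  · simp [rootTwo]
  · have hpos : 0 < ‖u‖ := norm_pos_iff.2 hu
    have h1 : ((√‖u‖ : ℝ) : ℂ) = Complex.exp ((Real.log ‖u‖ / 2 : ℝ) : ℂ) := by
      rw [← Complex.ofReal_exp, Complex.ofReal_inj, ← Real.log_sqrt hpos.le,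
        Real.exp_log (Real.sqrt_pos.2 hpos)]
    rw [rootTwo, Complex.cpow_def_of_ne_zero hu, h1, ← Complex.exp_add, Complex.log]
    congr 1
    push_cast
    ring

theorem rootTwo_ofReal {x : ℝ} (hx : 0 ≤ x) : rootTwo x = (√x : ℝ) := by
  rw [rootTwo_eq, Complex.arg_ofReal_of_nonneg hx, Complex.norm_real, Real.norm_of_nonneg hx]
  simp

/-- The square roots of `u` and `-u` differ by a constant factor on the upper half-plane. -/
theorem rootTwo_neg {u : ℂ} (hu : 0 < u.im) : rootTwo (-u) = -Complex.I * rootTwo u := by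
  rw [rootTwo_eq, rootTwo_eq u, norm_neg, Complex.arg_neg_eq_arg_sub_pi_of_im_pos hu]
  have h : Complex.exp (((u.arg - Real.pi) / 2 : ℝ) * Complex.I) =
      Complex.exp ((u.arg / 2 : ℝ) * Complex.I) * -Complex.I := by
    rw [← Complex.exp_neg_pi_div_two_mul_I, ← Complex.exp_add]
    congr 1
    push_cast
    ring
  rw [h]
  ring

theorem differentiableAt_rootTwo {u : ℂ} (hu : u ∈ Complex.slitPlane) :
    DifferentiableAt ℂ rootTwo u :=
  differentiableAt_id.cpow_const hu

/-- The principal square root is continuous on the closed upper half-plane, the negative real axis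
included. -/
theorem continuousOn_rootTwo : ContinuousOn rootTwo {u | 0 ≤ u.im} := by
  intro u hu
  rcases eq_or_ne u 0 with rfl | hu0
  · have h0 : rootTwo 0 = 0 := by simp [rootTwo]
    rw [ContinuousWithinAt, h0]
    refine squeeze_zero_norm (fun w => (norm_rootTwo w).le) ?_
    have : Continuous fun w : ℂ => √‖w‖ := by fun_prop
    simpa using (this.tendsto 0).mono_left (nhdsWithin_le_nhds (s := {u : ℂ | 0 ≤ u.im}))
  · have harg : ContinuousWithinAt Complex.arg {u | 0 ≤ u.im} u := by
      by_cases hs : u ∈ Complex.slitPlane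
      · exact (Complex.continuousAt_arg hs).continuousWithinAt
      · rw [Complex.mem_slitPlane_iff, not_or, not_lt, not_not] at hs
        refine Complex.continuousWithinAt_arg_of_re_neg_of_im_zero (lt_of_le_of_ne hs.1 fun h => ?_)
          hs.2
        exact hu0 (Complex.ext h hs.2)
    have h1 : rootTwo = fun u : ℂ =>
        ((√‖u‖ : ℝ) : ℂ) * Complex.exp ((u.arg / 2 : ℝ) * Complex.I) := funext rootTwo_eq
    rw [h1]
    refine ContinuousWithinAt.mul ?_ ?_
    · have : Continuous fun w : ℂ => ((√‖w‖ : ℝ) : ℂ) := by fun_prop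
      exact this.continuousWithinAt
    · refine (Complex.continuous_exp.continuousAt).comp_continuousWithinAt ?_
      exact ((Complex.continuous_ofReal.continuousAt).comp_continuousWithinAt
        (harg.div_const 2)).mul continuousWithinAt_const

/-- Parameters of the law of `X ^ (1 / q)`: the exponent `q ∈ (0, 1]`, and `l k ∈ [t, t + 1]`. -/
structure PowerParams (a b q t : ℝ) {N : ℕ} (α l : Fin N → ℝ) : Prop where
  a_pos : 0 < a
  a_lt_b : a < b
  q_pos : 0 < q
  q_le_one : q ≤ 1
  t_nonneg : 0 ≤ t
  α_pos : ∀ k, 0 < α k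
  le_l : ∀ k, t ≤ l k
  l_le : ∀ k, l k ≤ t + 1

/-- The holomorphic extension of the density of `X ^ (1 / q)` to the cut plane. -/
noncomputable def powerDensity (a b q : ℝ) {N : ℕ} (α l : Fin N → ℝ) (z : ℂ) : ℂ :=
  q * (rootTwo (b - z ^ (q : ℂ)) * rootTwo (z ^ (q : ℂ) - a)) *
    ∑ k, α k * z ^ ((-(1 + q * l k) : ℝ) : ℂ)

/-- The extended density in the lower half-plane in the coordinate `log z`. The branch of the
square root of `ζ - a`, where `ζ = z ^ q`, is expressed by that of `a - ζ`, since both `a - ζ` and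
`b - ζ` lie in the upper half-plane. -/
noncomputable def logDensity (a b q : ℝ) {N : ℕ} (α l : Fin N → ℝ) (ω : ℂ) : ℂ :=
  q * (-Complex.I * (rootTwo (b - Complex.exp (q * ω)) * rootTwo (a - Complex.exp (q * ω)))) *
    ∑ k, α k * Complex.exp ((-(1 + q * l k) : ℝ) * ω)

/-- The angle `θ = π / (1 + q t)` of the sector, at which the leading exponent of the density turns
by `π`. -/
noncomputable def sectorAngle (q t : ℝ) : ℝ := Real.pi / (1 + q * t)

namespace PowerParams

variable {a b q t : ℝ} {N : ℕ} {α l : Fin N → ℝ}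

theorem b_pos (h : PowerParams a b q t α l) : 0 < b := h.a_pos.trans h.a_lt_b

theorem one_add_pos (h : PowerParams a b q t α l) : 0 < 1 + q * t := by
  have := mul_nonneg h.q_pos.le h.t_nonneg
  linarith

theorem sectorAngle_pos (h : PowerParams a b q t α l) : 0 < sectorAngle q t :=
  div_pos Real.pi_pos h.one_add_pos

theorem sectorAngle_le_pi (h : PowerParams a b q t α l) : sectorAngle q t ≤ Real.pi := by
  rw [sectorAngle, div_le_iff₀ h.one_add_pos]
  nlinarith [Real.pi_pos, mul_nonneg h.q_pos.le h.t_nonneg]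

theorem sectorAngle_mul (h : PowerParams a b q t α l) : (1 + q * t) * sectorAngle q t = Real.pi :=
  mul_div_cancel₀ _ h.one_add_pos.ne'

theorem exp_im_nonpos (h : PowerParams a b q t α l) {ω : ℂ} (h1 : -Real.pi ≤ ω.im)
    (h2 : ω.im ≤ 0) : (Complex.exp (q * ω)).im ≤ 0 := by
  rw [Complex.exp_im, Complex.im_ofReal_mul]
  refine mul_nonpos_of_nonneg_of_nonpos (Real.exp_pos _).le
    (Real.sin_nonpos_of_nonpos_of_neg_pi_le ?_ ?_)
  · exact mul_nonpos_of_nonneg_of_nonpos h.q_pos.le h2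
  · nlinarith [h.q_pos, h.q_le_one, Real.pi_pos]

theorem exp_im_neg (h : PowerParams a b q t α l) {ω : ℂ} (h1 : -Real.pi < ω.im)
    (h2 : ω.im < 0) : (Complex.exp (q * ω)).im < 0 := by
  rw [Complex.exp_im, Complex.im_ofReal_mul]
  refine mul_neg_of_pos_of_neg (Real.exp_pos _) (Real.sin_neg_of_neg_of_neg_pi_lt ?_ ?_)
  · exact mul_neg_of_pos_of_neg h.q_pos h2
  · nlinarith [h.q_pos, h.q_le_one, Real.pi_pos]

theorem powerDensity_eq_logDensity (h : PowerParams a b q t α l) {z : ℂ} (hz : z.im < 0) :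
    powerDensity a b q α l z = logDensity a b q α l (Complex.log z) := by
  have hz0 : z ≠ 0 := by rintro rfl; simp at hz
  have him : (Complex.log z).im < 0 := by rw [Complex.log_im]; exact Complex.arg_neg_iff.2 hz
  have him' : -Real.pi < (Complex.log z).im := Complex.neg_pi_lt_log_im z
  have hneg := h.exp_im_neg him' him
  have h1 : rootTwo (Complex.exp (q * Complex.log z) - a) =
      -Complex.I * rootTwo (a - Complex.exp (q * Complex.log z)) := by
    rw [← rootTwo_neg (by simpa using hneg), neg_sub]
  simp only [powerDensity, logDensity, Complex.cpow_def_of_ne_zero hz0]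
  simp_rw [mul_comm (Complex.log z)]
  rw [h1]
  ring

theorem continuousOn_logDensity (h : PowerParams a b q t α l) :
    ContinuousOn (logDensity a b q α l) {ω | -Real.pi ≤ ω.im ∧ ω.im ≤ 0} := by
  have hroot : ∀ c : ℝ, ContinuousOn (fun ω : ℂ => rootTwo (c - Complex.exp (q * ω)))
      {ω | -Real.pi ≤ ω.im ∧ ω.im ≤ 0} := fun c =>
    continuousOn_rootTwo.comp (Continuous.continuousOn (by fun_prop)) fun ω hω => by
      have := h.exp_im_nonpos hω.1 hω.2
      simpa using this
  refine ContinuousOn.mul (continuousOn_const.mul (continuousOn_const.mul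
    ((hroot b).mul (hroot a)))) (Continuous.continuousOn (by fun_prop))

/-- Polar form of the real part of the extended density. -/
theorem re_logDensity (a b q : ℝ) {N : ℕ} (α l : Fin N → ℝ) (ω : ℂ) :
    (logDensity a b q α l ω).re =
      ∑ k, q * (√‖(b - Complex.exp (q * ω))‖ * √‖(a - Complex.exp (q * ω))‖) *
        (α k * Real.exp (-(1 + q * l k) * ω.re)) *
        Real.cos (((b - Complex.exp (q * ω)).arg + (a - Complex.exp (q * ω)).arg) / 2
          - Real.pi / 2 - (1 + q * l k) * ω.im) := by
  rw [logDensity, Finset.mul_sum, Complex.re_sum]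
  refine Finset.sum_congr rfl fun k _ => ?_
  rw [rootTwo_eq, rootTwo_eq (a - _)]
  set φ := (b - Complex.exp (q * ω)).arg
  set ψ := (a - Complex.exp (q * ω)).arg
  set m := √‖(b - Complex.exp (q * ω))‖
  set n := √‖(a - Complex.exp (q * ω))‖
  have h1 : Complex.exp ((-(1 + q * l k) : ℝ) * ω) =
      (Real.exp (-(1 + q * l k) * ω.re) : ℝ) *
        Complex.exp ((-(1 + q * l k) * ω.im : ℝ) * Complex.I) := by
    rw [Complex.ofReal_exp, ← Complex.exp_add]
    congr 1
    conv_lhs => rw [← Complex.re_add_im ω]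
    push_cast
    ring
  have h2 : -Complex.I = Complex.exp ((-(Real.pi / 2) : ℝ) * Complex.I) := by
    rw [← Complex.exp_neg_pi_div_two_mul_I]
    congr 1
    push_cast
    ring
  have h3 : (q : ℂ) * (-Complex.I * ((m : ℂ) * Complex.exp ((φ / 2 : ℝ) * Complex.I) *
      ((n : ℂ) * Complex.exp ((ψ / 2 : ℝ) * Complex.I)))) *
      ((α k : ℂ) * Complex.exp ((-(1 + q * l k) : ℝ) * ω)) =
      ((q * (m * n) * (α k * Real.exp (-(1 + q * l k) * ω.re)) : ℝ) : ℂ) *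
        Complex.exp (((φ + ψ) / 2 - Real.pi / 2 - (1 + q * l k) * ω.im : ℝ) * Complex.I) := by
    have h4 : Complex.exp (((φ + ψ) / 2 - Real.pi / 2 - (1 + q * l k) * ω.im : ℝ) * Complex.I) =
        Complex.exp ((-(Real.pi / 2) : ℝ) * Complex.I) * Complex.exp ((φ / 2 : ℝ) * Complex.I) *
          Complex.exp ((ψ / 2 : ℝ) * Complex.I) *
          Complex.exp ((-(1 + q * l k) * ω.im : ℝ) * Complex.I) := by
      rw [← Complex.exp_add, ← Complex.exp_add, ← Complex.exp_add]
      congr 1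
      push_cast
      ring
    rw [h4, h1, ← h2]
    push_cast
    ring
  rw [h3, Complex.re_ofReal_mul, Complex.exp_ofReal_mul_I_re]

theorem arg_sub_exp_nonneg (h : PowerParams a b q t α l) {ω : ℂ} (h1 : -Real.pi ≤ ω.im)
    (h2 : ω.im ≤ 0) (c : ℝ) : 0 ≤ ((c : ℂ) - Complex.exp (q * ω)).arg := by
  rw [Complex.arg_nonneg_iff]
  simpa using h.exp_im_nonpos h1 h2

/-- A positive real number minus a complex number of argument `q Im ω ∈ [-π, 0)` has argument at
most `π + q Im ω`. -/
theorem arg_sub_exp_le (h : PowerParams a b q t α l) {ω : ℂ} (h1 : -Real.pi ≤ ω.im)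
    (h2 : ω.im < 0) {c : ℝ} (hc : 0 < c) :
    ((c : ℂ) - Complex.exp (q * ω)).arg ≤ Real.pi + q * ω.im := by
  set u : ℂ := (c : ℂ) - Complex.exp (q * ω) with hu
  set κ : ℝ := Real.pi + q * ω.im with hκ
  have hqim : q * ω.im < 0 := mul_neg_of_pos_of_neg h.q_pos h2
  have hκπ : κ < Real.pi := by linarith
  have hκ0 : 0 ≤ κ := by nlinarith [h.q_pos, h.q_le_one, Real.pi_pos]
  by_contra! hcon
  have harg := Complex.arg_le_pi u
  have hu0 : u ≠ 0 := by
    intro h0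
    rw [h0, Complex.arg_zero] at hcon
    linarith
  have hupos : 0 < ‖u‖ := norm_pos_iff.2 hu0
  -- `‖u‖ sin (arg u - κ) = Im (u e^{-iκ}) = -c sin κ`
  have him : ‖u‖ * Real.sin (u.arg - κ) = -(c * Real.sin κ) := by
    have e1 : ‖u‖ * Real.cos u.arg = c - Real.exp (q * ω.re) * Real.cos (q * ω.im) := by
      rw [Complex.norm_mul_cos_arg]
      simp [hu, Complex.exp_re]
    have e2 : ‖u‖ * Real.sin u.arg = -(Real.exp (q * ω.re) * Real.sin (q * ω.im)) := by
      rw [Complex.norm_mul_sin_arg]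
      simp [hu, Complex.exp_im]
    have e3 : Real.sin (q * ω.im) = -Real.sin κ := by
      rw [hκ, add_comm, Real.sin_add_pi, neg_neg]
    have e4 : Real.cos (q * ω.im) = -Real.cos κ := by
      rw [hκ, add_comm, Real.cos_add_pi, neg_neg]
    rw [e4] at e1
    rw [e3] at e2
    rw [Real.sin_sub]
    linear_combination Real.cos κ * e2 - Real.sin κ * e1
  have hsin : 0 ≤ Real.sin κ := Real.sin_nonneg_of_nonneg_of_le_pi hκ0 hκπ.le
  rcases (harg.trans (by linarith : Real.pi ≤ Real.pi + κ)).lt_or_eq with hlt | heq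
  · have hpos : 0 < Real.sin (u.arg - κ) :=
      Real.sin_pos_of_pos_of_lt_pi (by linarith) (by linarith)
    have : 0 < ‖u‖ * Real.sin (u.arg - κ) := mul_pos hupos hpos
    nlinarith
  · have hκ00 : κ = 0 := by linarith
    have h3 : q * ω.im = -Real.pi := by linarith
    have h4 : u = ((c + Real.exp (q * ω.re) : ℝ) : ℂ) := by
      apply Complex.ext
      · simp [hu, Complex.exp_re, h3]
      · simp [hu, Complex.exp_im, h3]
    have h5 : u.arg = 0 := by
      rw [h4]
      exact Complex.arg_ofReal_of_nonneg (by positivity)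
    rw [h5, hκ00] at hcon
    exact lt_irrefl _ hcon

/-- On the ray `arg z = -θ` the extended density has nonpositive real part. With `φ, ψ` the arguments
of `b - ζ` and `a - ζ`, which lie in `[0, π - qθ]`, the argument of the `k`-th term is
`(φ + ψ) / 2 - π / 2 + (1 + q l k) θ`. This lies in `[π / 2, 3 π / 2]`, because
`(1 + q t) θ = π` and `t ≤ l k ≤ t + 1`. -/
theorem re_logDensity_nonpos_of_ray (h : PowerParams a b q t α l) {ω : ℂ}
    (hω : ω.im = -sectorAngle q t) : (logDensity a b q α l ω).re ≤ 0 := by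
  have hθ0 := h.sectorAngle_pos
  have hθπ := h.sectorAngle_le_pi
  have hθ := h.sectorAngle_mul
  rw [re_logDensity]
  refine Finset.sum_nonpos fun k _ => mul_nonpos_of_nonneg_of_nonpos ?_ ?_
  · have := h.α_pos k
    have := h.q_pos
    positivity
  · have h1 := h.arg_sub_exp_nonneg (ω := ω) (by linarith) (by linarith) b
    have h2 := h.arg_sub_exp_nonneg (ω := ω) (by linarith) (by linarith) a
    have h3 := h.arg_sub_exp_le (ω := ω) (by linarith) (by linarith) h.b_pos
    have h4 := h.arg_sub_exp_le (ω := ω) (by linarith) (by linarith) h.a_pos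
    have hq := h.q_pos
    have h5 : 0 ≤ q * (l k - t) * sectorAngle q t :=
      mul_nonneg (mul_nonneg hq.le (by linarith [h.le_l k])) hθ0.le
    have h6 : q * (l k - t) * sectorAngle q t ≤ q * sectorAngle q t := by
      have : q * (l k - t) ≤ q * 1 := by
        gcongr
        linarith [h.l_le k]
      rw [mul_one] at this
      gcongr
    have h7 : (1 + q * l k) * sectorAngle q t = Real.pi + q * (l k - t) * sectorAngle q t := by
      rw [← hθ]; ring
    rw [hω] at h3 h4 ⊢
    refine Real.cos_nonpos_of_pi_div_two_le_of_le ?_ ?_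
    · linarith
    · linarith

/-- On the real axis outside `(a ^ (1 / q), b ^ (1 / q))` the extended density is purely
imaginary. -/
theorem re_logDensity_eq_zero_of_real (h : PowerParams a b q t α l) {s : ℝ}
    (hs : Real.exp (q * s) ∉ Ioo a b) : (logDensity a b q α l s).re = 0 := by
  rw [re_logDensity]
  have he : Complex.exp (q * s) = (Real.exp (q * s) : ℝ) := by push_cast; rfl
  refine Finset.sum_eq_zero fun k _ => ?_
  rw [he, ← Complex.ofReal_sub, ← Complex.ofReal_sub, Complex.ofReal_im, mul_zero, sub_zero]
  rcases le_or_gt (Real.exp (q * s)) a with h1 | h1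
  · rw [Complex.arg_ofReal_of_nonneg (by linarith [h.a_lt_b]),
      Complex.arg_ofReal_of_nonneg (by linarith)]
    simp
  · have h2 : b ≤ Real.exp (q * s) := by
      by_contra hcon
      exact hs ⟨h1, not_le.1 hcon⟩
    rcases h2.eq_or_lt with h3 | h3
    · rw [← h3]
      simp
    · rw [Complex.arg_ofReal_of_neg (by linarith), Complex.arg_ofReal_of_neg (by linarith)]
      have : (Real.pi + Real.pi) / 2 - Real.pi / 2 = Real.pi / 2 := by ring
      rw [this, Real.cos_pi_div_two, mul_zero]

end PowerParams

/-! ### Boundary behaviour of the continued density on the sector -/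

theorem log_im_mem_of_mem_lowerSector {θ : ℝ} (hθ0 : 0 < θ) {z : ℂ}
    (hz : z ∈ lowerSector θ) : -θ < (Complex.log z).im ∧ (Complex.log z).im < 0 := by
  rw [Complex.log_im]
  have harg : z.arg < 0 := Complex.arg_neg_iff.2 hz.1
  refine ⟨?_, harg⟩
  by_contra! hcon
  have h1 : 0 < ‖z‖ * Real.sin (θ + z.arg) := by
    have := hz.2
    rw [← Complex.norm_mul_cos_arg z, ← Complex.norm_mul_sin_arg z] at this
    rw [Real.sin_add]
    linarith
  have h2 : Real.sin (θ + z.arg) ≤ 0 :=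
    Real.sin_nonpos_of_nonpos_of_neg_pi_le (by linarith) (by linarith [Complex.neg_pi_lt_arg z])
  nlinarith [norm_nonneg z]

theorem exp_mem_lowerSector {θ : ℝ} (hθ : θ ≤ Real.pi) {ω : ℂ} (h1 : -θ < ω.im)
    (h2 : ω.im < 0) : Complex.exp ω ∈ lowerSector θ := by
  refine ⟨?_, ?_⟩
  · rw [Complex.exp_im]
    exact mul_neg_of_pos_of_neg (Real.exp_pos _)
      (Real.sin_neg_of_neg_of_neg_pi_lt h2 (by linarith))
  · rw [Complex.exp_im, Complex.exp_re]
    have h3 : 0 < Real.sin (θ + ω.im) :=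
      Real.sin_pos_of_pos_of_lt_pi (by linarith) (by linarith)
    rw [Real.sin_add] at h3
    have := mul_pos (Real.exp_pos ω.re) h3
    linarith

/-- Along an ultrafilter on the sector that converges to `p ≠ 0`, the logarithm converges, possibly
to a logarithm of `p` with imaginary part outside `(-π, π]`. -/
theorem exists_tendsto_log {θ : ℝ} (hθ0 : 0 < θ) {p : ℂ} (hp : p ≠ 0)
    {F : Ultrafilter ℂ} (hF : (F : Filter ℂ) ≤ 𝓝 p) (hS : lowerSector θ ∈ F) :
    ∃ ω : ℂ, -θ ≤ ω.im ∧ ω.im ≤ 0 ∧ Complex.exp ω = p ∧ Tendsto Complex.log F (𝓝 ω) := by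
  have hS' : ∀ᶠ z in (F : Filter ℂ), z ∈ lowerSector θ := hS
  have hmem : Icc (-θ) 0 ∈ F.map Complex.arg := by
    rw [Ultrafilter.mem_map]
    filter_upwards [hS'] with z hz
    have := log_im_mem_of_mem_lowerSector hθ0 hz
    rw [Complex.log_im] at this
    exact ⟨this.1.le, this.2.le⟩
  obtain ⟨β, hβ, hlim⟩ := isCompact_Icc.ultrafilter_le_nhds' (F.map Complex.arg) hmem
  have harg : Tendsto Complex.arg F (𝓝 β) := hlim
  have hnorm : Tendsto (fun z : ℂ => Real.log ‖z‖) F (𝓝 (Real.log ‖p‖)) :=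
    ((Real.continuousAt_log (norm_ne_zero_iff.2 hp)).tendsto.comp
      (continuous_norm.tendsto p)).mono_left hF
  have hlog : Tendsto Complex.log F (𝓝 ((Real.log ‖p‖ : ℝ) + (β : ℝ) * Complex.I)) := by
    have h1 := (Complex.continuous_ofReal.tendsto _).comp hnorm
    have h2 := ((Complex.continuous_ofReal.tendsto _).comp harg).mul_const Complex.I
    exact h1.add h2
  refine ⟨_, by simpa using hβ.1, by simpa using hβ.2, ?_, hlog⟩
  have hexp := (Complex.continuous_exp.tendsto _).comp hlog
  refine tendsto_nhds_unique hexp ?_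
  have hid : Tendsto (fun z : ℂ => z) F (𝓝 p) := hF
  refine hid.congr' ?_
  filter_upwards [hS'] with z hz
  have hz0 : z ≠ 0 := by rintro rfl; simpa using hz.1
  exact (Complex.exp_log hz0).symm

namespace PowerParams

variable {a b q t : ℝ} {N : ℕ} {α l : Fin N → ℝ}

/-- At the finite boundary points of the sector other than the origin, the extended density has
nonpositive limiting real part. -/
theorem eventually_re_powerDensity_le (h : PowerParams a b q t α l) {A B : ℝ}
    (hab : ∀ s : ℝ, a < Real.exp (q * s) → Real.exp (q * s) < b →
      A < Real.exp s ∧ Real.exp s < B) {p : ℂ} (hp : p ≠ 0)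
    (hpS : p ∉ slitSector A B (sectorAngle q t)) {ε : ℝ} (hε : 0 < ε) :
    ∀ᶠ z in 𝓝 p, z ∈ lowerSector (sectorAngle q t) → (powerDensity a b q α l z).re ≤ ε := by
  have hθ0 := h.sectorAngle_pos
  have hθπ := h.sectorAngle_le_pi
  refine mem_iff_ultrafilter.2 fun F hF => ?_
  by_contra hcon
  have hcon' := Ultrafilter.compl_mem_iff_notMem.2 hcon
  have hev : ∀ᶠ z in (F : Filter ℂ), z ∈ lowerSector (sectorAngle q t) ∧
      ε < (powerDensity a b q α l z).re := by
    filter_upwards [hcon'] with z hz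
    by_contra hz'
    refine hz fun h1 => ?_
    by_contra h2
    exact hz' ⟨h1, not_le.1 h2⟩
  obtain ⟨ω, hω1, hω2, hωp, hlog⟩ := exists_tendsto_log hθ0 hp hF
    (hev.mono fun _ hz => hz.1)
  have hcont := h.continuousOn_logDensity ω ⟨by linarith, hω2⟩
  have hlim : Tendsto (fun z => (logDensity a b q α l (Complex.log z)).re) F
      (𝓝 (logDensity a b q α l ω).re) := by
    refine (Complex.continuous_re.tendsto _).comp (hcont.tendsto.comp ?_)
    refine tendsto_nhdsWithin_iff.2 ⟨hlog, ?_⟩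
    filter_upwards [hev] with z hz
    have := log_im_mem_of_mem_lowerSector hθ0 hz.1
    exact ⟨by linarith [this.1], this.2.le⟩
  have hge : ε ≤ (logDensity a b q α l ω).re := by
    refine ge_of_tendsto hlim ?_
    filter_upwards [hev] with z hz
    rw [← h.powerDensity_eq_logDensity hz.1.1]
    exact hz.2.le
  rcases hω1.eq_or_lt with h1 | h1
  · linarith [h.re_logDensity_nonpos_of_ray h1.symm]
  rcases hω2.eq_or_lt with h2 | h2
  · have hωre : ω = (ω.re : ℝ) := Complex.ext rfl (by simpa using h2)
    have hzero : (logDensity a b q α l ω).re = 0 := by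
      rw [hωre]
      refine h.re_logDensity_eq_zero_of_real fun hmem => hpS ?_
      have hp' : p = (Real.exp ω.re : ℝ) := by
        rw [← hωp, hωre]
        simp
      obtain ⟨h3, h4⟩ := hab ω.re hmem.1 hmem.2
      rw [hp']
      exact ⟨Or.inr ⟨by rw [Complex.ofReal_re]; exact h3, by rw [Complex.ofReal_re]; exact h4⟩,
        fun him => absurd him (by simp)⟩
    linarith
  · exact hpS (hωp ▸ lowerSector_subset_slitSector (exp_mem_lowerSector hθπ h1 h2))

theorem exponent_nonneg (h : PowerParams a b q t α l) (k : Fin N) : 0 ≤ 1 - q + q * l k := by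
  have := mul_nonneg h.q_pos.le (h.t_nonneg.trans (h.le_l k))
  linarith [h.q_le_one]

/-- A bound for the factor of the extended density that has modulus tending to `1` at infinity. -/
theorem norm_ratio_le (h : PowerParams a b q t α l) (ω : ℂ) :
    ‖rootTwo (b - Complex.exp (q * ω)) * rootTwo (a - Complex.exp (q * ω)) /
      Complex.exp (q * ω)‖ ≤ b * Real.exp (-(q * ω.re)) + 1 := by
  have hb := h.b_pos
  have ha := h.a_pos
  have hab := h.a_lt_b
  set ρ := Real.exp (q * ω.re) with hρ
  have hρpos : 0 < ρ := Real.exp_pos _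
  have hn : ‖Complex.exp (q * ω)‖ = ρ := by
    rw [Complex.norm_exp, Complex.re_ofReal_mul]
  have key : ∀ c : ℝ, 0 < c → c ≤ b → √‖(c : ℂ) - Complex.exp (q * ω)‖ ≤ √(b + ρ) := by
    intro c hc hcb
    refine Real.sqrt_le_sqrt ((norm_sub_le _ _).trans ?_)
    rw [hn, Complex.norm_real, Real.norm_of_nonneg hc.le]
    linarith
  rw [norm_div, norm_mul, norm_rootTwo, norm_rootTwo, hn, div_le_iff₀ hρpos, Real.exp_neg, ← hρ]
  calc √‖(b : ℂ) - Complex.exp (q * ω)‖ * √‖(a : ℂ) - Complex.exp (q * ω)‖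
      ≤ √(b + ρ) * √(b + ρ) :=
        mul_le_mul (key b hb le_rfl) (key a ha hab.le) (Real.sqrt_nonneg _) (Real.sqrt_nonneg _)
    _ = b + ρ := Real.mul_self_sqrt (by positivity)
    _ = (b * ρ⁻¹ + 1) * ρ := by field_simp

/-- The extended density with the growth of the square roots at infinity moved into the exponents,
which become `-(1 - q + q l k) ≤ 0`. -/
theorem logDensity_eq_sum (a b q : ℝ) {N : ℕ} (α l : Fin N → ℝ) (ω : ℂ) :
    logDensity a b q α l ω = ∑ k, ((q * α k : ℝ) : ℂ) *
      (-Complex.I * (rootTwo (b - Complex.exp (q * ω)) * rootTwo (a - Complex.exp (q * ω)) /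
        Complex.exp (q * ω)) * Complex.exp ((-(1 - q + q * l k) : ℝ) * ω)) := by
  rw [logDensity, Finset.mul_sum]
  refine Finset.sum_congr rfl fun k _ => ?_
  have h1 : Complex.exp ((-(1 + q * l k) : ℝ) * ω) =
      Complex.exp ((-(1 - q + q * l k) : ℝ) * ω) / Complex.exp (q * ω) := by
    rw [← Complex.exp_sub]
    congr 1
    push_cast
    ring
  rw [h1]
  push_cast
  ring

theorem exists_re_powerDensity_le (h : PowerParams a b q t α l) {δ : ℝ} (hδ : 0 < δ) :
    ∃ C, ∀ z ∈ lowerSector (sectorAngle q t), δ ≤ ‖z‖ → (powerDensity a b q α l z).re ≤ C := by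
  refine ⟨∑ k, q * α k * ((b * Real.exp (-(q * Real.log δ)) + 1) *
    Real.exp (-(1 - q + q * l k) * Real.log δ)), fun z hz hδz => ?_⟩
  have hb := h.b_pos
  have hq := h.q_pos
  have hlog : Real.log δ ≤ (Complex.log z).re := by
    rw [Complex.log_re]
    exact Real.log_le_log hδ hδz
  rw [h.powerDensity_eq_logDensity hz.1, logDensity_eq_sum]
  refine (Complex.re_le_norm _).trans ((norm_sum_le _ _).trans (Finset.sum_le_sum fun k _ => ?_))
  have hα := h.α_pos k
  rw [norm_mul, norm_mul, norm_mul, norm_neg, Complex.norm_I, one_mul, Complex.norm_real,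
    Real.norm_of_nonneg (by positivity), Complex.norm_exp, Complex.re_ofReal_mul]
  have h1 := h.norm_ratio_le (Complex.log z)
  have h2 : b * Real.exp (-(q * (Complex.log z).re)) + 1 ≤
      b * Real.exp (-(q * Real.log δ)) + 1 := by gcongr
  have h3 : -(1 - q + q * l k) * (Complex.log z).re ≤ -(1 - q + q * l k) * Real.log δ := by
    have := mul_le_mul_of_nonneg_left hlog (h.exponent_nonneg k)
    linarith
  have h4 := Real.exp_le_exp.2 h3
  have h5 : 0 ≤ b * Real.exp (-(q * Real.log δ)) + 1 := by positivity
  gcongr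
  exact h1.trans h2

/-- An approximate square root of `-1` has small real part. -/
theorem sq_re_le_norm_sq_add_one (v : ℂ) : v.re ^ 2 ≤ ‖v ^ 2 + 1‖ := by
  have h1 : v ^ 2 + 1 = (v - Complex.I) * (v + Complex.I) := by
    ring_nf
    rw [Complex.I_sq]
    ring
  have h2 : |v.re| ≤ ‖v - Complex.I‖ := by simpa using Complex.abs_re_le_norm (v - Complex.I)
  have h3 : |v.re| ≤ ‖v + Complex.I‖ := by simpa using Complex.abs_re_le_norm (v + Complex.I)
  rw [h1, norm_mul, ← sq_abs, sq]
  exact mul_le_mul h2 h3 (abs_nonneg _) (norm_nonneg _)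

/-- At infinity the terms with `1 - q + q l k > 0` decay. A term with exponent zero, which occurs only
for `q = 1` and `l k = 0`, tends to a multiple of a square root of `-1`, so its real part decays
too. -/
theorem eventually_re_powerDensity_le_cobounded (h : PowerParams a b q t α l) {ε : ℝ}
    (hε : 0 < ε) : ∀ᶠ z in Bornology.cobounded ℂ, z ∈ lowerSector (sectorAngle q t) →
      (powerDensity a b q α l z).re ≤ ε := by
  have hb := h.b_pos
  have hq := h.q_pos
  have hre : Tendsto (fun z => (Complex.log z).re) (Bornology.cobounded ℂ) atTop := by
    simp only [Complex.log_re]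
    exact Real.tendsto_log_atTop.comp tendsto_norm_cobounded_atTop
  have hexpneg : ∀ c : ℝ, 0 < c →
      Tendsto (fun z => Real.exp (-(c * (Complex.log z).re))) (Bornology.cobounded ℂ) (𝓝 0) :=
    fun c hc => Real.tendsto_exp_neg_atTop_nhds_zero.comp (hre.const_mul_atTop hc)
  set v : ℂ → ℂ := fun z => -Complex.I * (rootTwo (b - Complex.exp (q * Complex.log z)) *
    rootTwo (a - Complex.exp (q * Complex.log z)) / Complex.exp (q * Complex.log z)) with hv
  have hinv : Tendsto (fun z : ℂ => (Complex.exp (q * Complex.log z))⁻¹)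
      (Bornology.cobounded ℂ) (𝓝 0) := by
    rw [tendsto_zero_iff_norm_tendsto_zero]
    refine (hexpneg q hq).congr fun z => ?_
    rw [norm_inv, Complex.norm_exp, Complex.re_ofReal_mul, Real.exp_neg]
  have hvsq : ∀ z, v z ^ 2 + 1 = ((a + b : ℝ) : ℂ) * (Complex.exp (q * Complex.log z))⁻¹ -
      ((a * b : ℝ) : ℂ) * (Complex.exp (q * Complex.log z))⁻¹ ^ 2 := by
    intro z
    have h0 := Complex.exp_ne_zero (q * Complex.log z)
    simp only [hv]
    rw [mul_pow, div_pow, mul_pow, rootTwo_sq, rootTwo_sq, neg_sq, Complex.I_sq]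
    field_simp
    push_cast
    ring
  have hvlim : Tendsto (fun z => ‖v z ^ 2 + 1‖) (Bornology.cobounded ℂ) (𝓝 0) := by
    have := ((hinv.const_mul ((a + b : ℝ) : ℂ)).sub ((hinv.pow 2).const_mul ((a * b : ℝ) : ℂ))).norm
    simp only [hvsq]
    simpa using this
  have hvre : Tendsto (fun z => (v z).re) (Bornology.cobounded ℂ) (𝓝 0) := by
    have hsq : Tendsto (fun z => √‖v z ^ 2 + 1‖) (Bornology.cobounded ℂ) (𝓝 0) := by
      simpa [Function.comp_def] using (Real.continuous_sqrt.tendsto 0).comp hvlim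
    refine squeeze_zero_norm (fun z => ?_) hsq
    exact Real.abs_le_sqrt (sq_re_le_norm_sq_add_one _)
  have hvnorm : ∀ᶠ z in Bornology.cobounded ℂ, ‖v z‖ ≤ b + 1 := by
    filter_upwards [hre.eventually_ge_atTop 0] with z hz
    simp only [hv]
    rw [norm_mul, norm_neg, Complex.norm_I, one_mul]
    refine (h.norm_ratio_le _).trans ?_
    have : Real.exp (-(q * (Complex.log z).re)) ≤ 1 :=
      Real.exp_le_one_iff.2 (neg_nonpos.2 (mul_nonneg hq.le hz))
    nlinarith
  have hterm : ∀ k, Tendsto (fun z => (v z * Complex.exp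
      ((-(1 - q + q * l k) : ℝ) * Complex.log z)).re) (Bornology.cobounded ℂ) (𝓝 0) := by
    intro k
    rcases (h.exponent_nonneg k).eq_or_lt with h0 | hpos
    · simpa [← h0] using hvre
    · refine squeeze_zero_norm' ?_ (by simpa using (hexpneg _ hpos).const_mul (b + 1))
      filter_upwards [hvnorm] with z hz
      refine (Complex.abs_re_le_norm _).trans ?_
      rw [norm_mul, Complex.norm_exp, Complex.re_ofReal_mul, neg_mul]
      gcongr
  have hsum : Tendsto (fun z => ∑ k, q * α k * (v z * Complex.exp
      ((-(1 - q + q * l k) : ℝ) * Complex.log z)).re) (Bornology.cobounded ℂ) (𝓝 0) := by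
    simpa using tendsto_finsetSum Finset.univ fun k _ => (hterm k).const_mul (q * α k)
  filter_upwards [hsum.eventually_lt_const hε] with z hz hzS
  rw [h.powerDensity_eq_logDensity hzS.1, logDensity_eq_sum, Complex.re_sum]
  simp only [Complex.re_ofReal_mul]
  exact hz.le

end PowerParams

/-! ### Uniqueness of preimages near the vertex -/

/-- A function close to `exp (-p ω)` for `Re ω` very negative takes each value on the positive
imaginary axis at most once on a strip on which `-p Im ω` stays in `[0, 2π]`: the logarithm of the
perturbing factor is a contraction, and the branch of the logarithm of the value is determined. -/
theorem eq_of_exp_mul_eq {Φ : ℂ → ℂ} {x₀ p c : ℝ} (hp : 1 ≤ p) (hc : 0 < c)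
    (hd : DifferentiableOn ℂ Φ {ω | ω.re < x₀}) (hΦ : ∀ ω : ℂ, ω.re < x₀ → ‖Φ ω - 1‖ ≤ 1 / 3)
    {ω₁ ω₂ : ℂ} (h₁ : ω₁.re < x₀ - 1) (h₂ : ω₂.re < x₀ - 1)
    (hi₁ : 0 ≤ -p * ω₁.im) (hi₁' : -p * ω₁.im ≤ 2 * Real.pi)
    (hi₂ : 0 ≤ -p * ω₂.im) (hi₂' : -p * ω₂.im ≤ 2 * Real.pi)
    (he₁ : Complex.exp (-p * ω₁) * Φ ω₁ = c * Complex.I)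
    (he₂ : Complex.exp (-p * ω₂) * Φ ω₂ = c * Complex.I) : ω₁ = ω₂ := by
  set Q : ℂ → ℂ := fun ω => Complex.log (Φ ω) with hQ
  have hslit : ∀ ω : ℂ, ω.re < x₀ → Φ ω ∈ Complex.slitPlane := by
    intro ω hω
    left
    have := (abs_le.1 ((Complex.abs_re_le_norm _).trans (hΦ ω hω))).1
    rw [Complex.sub_re, Complex.one_re] at this
    linarith
  have hQb : ∀ ω : ℂ, ω.re < x₀ → ‖Q ω‖ ≤ 1 / 2 := by
    intro ω hω
    have h := Complex.norm_log_one_add_half_le_self (z := Φ ω - 1) ((hΦ ω hω).trans (by norm_num))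
    rw [add_sub_cancel] at h
    linarith [hΦ ω hω]
  have hopen : IsOpen {ω : ℂ | ω.re < x₀} := isOpen_lt Complex.continuous_re continuous_const
  have hQd : DifferentiableOn ℂ Q {ω | ω.re < x₀} := fun ω hω =>
    (hd ω hω).clog (hslit ω hω)
  have hderiv : ∀ ω ∈ {ω : ℂ | ω.re < x₀ - 1}, ‖deriv Q ω‖ ≤ 1 / 2 := by
    intro ω hω
    have hω' : ω.re < x₀ - 1 := hω
    have hsub : Metric.closedBall ω 1 ⊆ {ω : ℂ | ω.re < x₀} := by
      intro w hw
      rw [Metric.mem_closedBall, dist_eq_norm] at hw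
      have := (abs_le.1 ((Complex.abs_re_le_norm _).trans hw)).2
      rw [Complex.sub_re] at this
      show w.re < x₀
      linarith
    have := Complex.norm_deriv_le_of_forall_mem_sphere_norm_le (f := Q) (c := ω) (C := 1 / 2)
      one_pos ((hQd.mono hsub).diffContOnCl_ball subset_rfl)
      fun w hw => hQb w (hsub (Metric.sphere_subset_closedBall hw))
    simpa using this
  have hlip : ‖Q ω₂ - Q ω₁‖ ≤ 1 / 2 * ‖ω₂ - ω₁‖ := by
    refine Convex.norm_image_sub_le_of_norm_deriv_le (fun ω hω => ?_) hderiv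
      (convex_halfSpace_re_lt (x₀ - 1)) h₁ h₂
    exact (hQd ω (show ω.re < x₀ by linarith [show ω.re < x₀ - 1 from hω])).differentiableAt
      (hopen.mem_nhds (show ω.re < x₀ by linarith [show ω.re < x₀ - 1 from hω]))
  have hsolve : ∀ ω : ℂ, ω.re < x₀ - 1 → 0 ≤ -p * ω.im → -p * ω.im ≤ 2 * Real.pi →
      Complex.exp (-p * ω) * Φ ω = c * Complex.I →
      -p * ω + Q ω = (Real.log c : ℝ) + (Real.pi / 2 : ℝ) * Complex.I := by
    intro ω hω hi hi' he
    have hΦ0 : Φ ω ≠ 0 := Complex.slitPlane_ne_zero (hslit ω (by linarith))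
    have h1 : Complex.exp (-p * ω + Q ω) =
        Complex.exp ((Real.log c : ℝ) + (Real.pi / 2 : ℝ) * Complex.I) := by
      rw [Complex.exp_add, Complex.exp_log hΦ0, he, Complex.exp_add, ← Complex.ofReal_exp,
        Real.exp_log hc]
      push_cast
      rw [Complex.exp_pi_div_two_mul_I]
    obtain ⟨n, hn⟩ := Complex.exp_eq_exp_iff_exists_int.1 h1
    have him := congrArg Complex.im hn
    have hQi := abs_le.1 ((Complex.abs_im_le_norm (Q ω)).trans (hQb ω (by linarith)))
    have hpi := Real.pi_gt_three
    have him' : -p * ω.im + (Q ω).im = Real.pi / 2 + n * (2 * Real.pi) := by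
      simpa using him
    have hn1 : n < 1 := by
      by_contra! h
      have : (1 : ℝ) ≤ n := by exact_mod_cast h
      nlinarith [hQi.1, hQi.2]
    have hn2 : -1 < n := by
      by_contra! h
      have : (n : ℝ) ≤ -1 := by exact_mod_cast h
      nlinarith [hQi.1, hQi.2]
    -- `Im (-p ω + Q ω) ∈ [-1/2, 2π + 1/2]` leaves only the branch `π / 2`
    have hn0 : n = 0 := by omega
    rw [hn, hn0]
    simp
  have h3 := (hsolve ω₁ h₁ hi₁ hi₁' he₁).trans (hsolve ω₂ h₂ hi₂ hi₂' he₂).symm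
  have h4 : (p : ℂ) * (ω₂ - ω₁) = Q ω₂ - Q ω₁ := by linear_combination h3
  rw [← h4, norm_mul, Complex.norm_real, Real.norm_of_nonneg (by linarith)] at hlip
  have h5 : ‖ω₂ - ω₁‖ = 0 := by nlinarith [norm_nonneg (ω₂ - ω₁)]
  exact (sub_eq_zero.1 (norm_eq_zero.1 h5)).symm

namespace PowerParams

variable {a b q t : ℝ} {N : ℕ} {α l : Fin N → ℝ}

theorem tendsto_exp_mul_comap_re {c : ℝ} (hc : 0 < c) :
    Tendsto (fun ω : ℂ => Complex.exp (c * ω)) (comap Complex.re atBot) (𝓝 0) := by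
  rw [tendsto_zero_iff_norm_tendsto_zero]
  simp only [Complex.norm_exp, Complex.re_ofReal_mul]
  exact Real.tendsto_exp_atBot.comp (tendsto_comap.const_mul_atBot hc)

/-- The leading term of the extended density at the origin comes from the largest exponent. -/
theorem tendsto_exp_mul_logDensity (h : PowerParams a b q t α l) {K : Fin N}
    (hK : ∀ k, k ≠ K → l k < l K) :
    Tendsto (fun ω : ℂ => Complex.exp ((1 + q * l K : ℝ) * ω) * logDensity a b q α l ω)
      (comap Complex.re atBot) (𝓝 (-Complex.I * (q * (√b * √a) * α K : ℝ))) := by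
  have hroot : ∀ c : ℝ, 0 < c → Tendsto (fun ω : ℂ => rootTwo (c - Complex.exp (q * ω)))
      (comap Complex.re atBot) (𝓝 (√c : ℝ)) := by
    intro c hc
    have h1 : ContinuousAt rootTwo c :=
      (differentiableAt_rootTwo (Complex.ofReal_mem_slitPlane.2 hc)).continuousAt
    rw [← rootTwo_ofReal hc.le]
    refine h1.tendsto.comp ?_
    simpa using (tendsto_exp_mul_comap_re h.q_pos).const_sub (c : ℂ)
  have hterm : ∀ k, Tendsto (fun ω : ℂ => (α k : ℂ) * Complex.exp ((q * (l K - l k) : ℝ) * ω))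
      (comap Complex.re atBot) (𝓝 (if k = K then (α K : ℂ) else 0)) := by
    intro k
    split_ifs with hk
    · subst hk
      simpa using tendsto_const_nhds
    · have := mul_pos h.q_pos (sub_pos.2 (hK k hk))
      simpa using (tendsto_exp_mul_comap_re this).const_mul (α k : ℂ)
  have hsum := tendsto_finsetSum Finset.univ fun k _ => hterm k
  rw [Finset.sum_ite_eq' Finset.univ K, if_pos (Finset.mem_univ _)] at hsum
  have hall := (((((hroot b h.b_pos).mul (hroot a h.a_pos)).const_mul (-Complex.I)).const_mul
    (q : ℂ)).mul hsum)
  have hval : (q : ℂ) * (-Complex.I * (((√b : ℝ) : ℂ) * ((√a : ℝ) : ℂ))) * (α K : ℂ) =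
      -Complex.I * (q * (√b * √a) * α K : ℝ) := by
    push_cast
    ring
  rw [hval] at hall
  refine hall.congr fun ω => ?_
  rw [logDensity, mul_left_comm (Complex.exp ((1 + q * l K : ℝ) * ω))]
  congr 1
  rw [Finset.mul_sum]
  refine Finset.sum_congr rfl fun k _ => ?_
  rw [mul_left_comm, ← Complex.exp_add]
  congr 2
  push_cast
  ring

theorem tendsto_log_comap_re : Tendsto Complex.log (𝓝[≠] 0) (comap Complex.re atBot) := by
  refine tendsto_comap_iff.2 ?_
  have h1 : Tendsto (fun z : ℂ => ‖z‖) (𝓝[≠] 0) (𝓝[≠] 0) := by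
    refine tendsto_nhdsWithin_iff.2 ⟨?_, ?_⟩
    · simpa using (continuous_norm.tendsto (0 : ℂ)).mono_left nhdsWithin_le_nhds
    · filter_upwards [self_mem_nhdsWithin] with z hz
      simpa using hz
  refine (Real.tendsto_log_nhdsNE_zero.comp h1).congr fun z => ?_
  simp [Complex.log_re]

/-- The extended density explodes at the vertex of the sector. -/
theorem eventually_le_norm_powerDensity (h : PowerParams a b q t α l) {K : Fin N}
    (hK : ∀ k, k ≠ K → l k < l K) (M : ℝ) :
    ∀ᶠ z in 𝓝 (0 : ℂ), z ∈ lowerSector (sectorAngle q t) → M ≤ ‖powerDensity a b q α l z‖ := by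
  have hp : 0 < 1 + q * l K := by
    have := mul_nonneg h.q_pos.le (h.t_nonneg.trans (h.le_l K))
    linarith
  have ha := h.a_pos
  have hb := h.b_pos
  have hq := h.q_pos
  have hα := h.α_pos K
  set κ := q * (√b * √a) * α K with hκ
  have hκpos : 0 < κ := by positivity
  have hlim := (h.tendsto_exp_mul_logDensity hK).norm
  have hval : ‖-Complex.I * (κ : ℂ)‖ = κ := by
    rw [norm_mul, norm_neg, Complex.norm_I, one_mul, Complex.norm_real,
      Real.norm_of_nonneg hκpos.le]
  rw [hval] at hlim
  have hexp : Tendsto (fun ω : ℂ => ‖Complex.exp ((1 + q * l K : ℝ) * ω)‖)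
      (comap Complex.re atBot) (𝓝 0) := by
    simpa using (tendsto_exp_mul_comap_re hp).norm
  have hM : ∀ᶠ ω : ℂ in comap Complex.re atBot, M ≤ ‖logDensity a b q α l ω‖ := by
    filter_upwards [hlim.eventually_const_lt (half_lt_self hκpos),
      hexp.eventually_lt_const (show 0 < κ / (2 * (|M| + 1)) by positivity)] with ω h1 h2
    rw [norm_mul] at h1
    by_contra! hcon
    have h3 : ‖logDensity a b q α l ω‖ ≤ |M| + 1 := by linarith [le_abs_self M]
    have h4 := mul_le_mul h2.le h3 (norm_nonneg _) (by positivity)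
    have h5 : κ / (2 * (|M| + 1)) * (|M| + 1) = κ / 2 := by
      field_simp
    linarith
  have hev := tendsto_log_comap_re.eventually hM
  rw [eventually_nhdsWithin_iff] at hev
  filter_upwards [hev] with z hz hzS
  rw [h.powerDensity_eq_logDensity hzS.1]
  exact hz (by rintro rfl; simpa using hzS.1)

/-- Near the origin the continued Cauchy transform takes each value on the negative imaginary axis
at most once. -/
theorem exists_unique_preimage (h : PowerParams a b q t α l) {K : Fin N}
    (hK : ∀ k, k ≠ K → l k < l K) {μ : Measure ℝ} [IsProbabilityMeasure μ] {A B : ℝ} {d : ℝ → ℝ}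
    (hA : 0 < A) (hd : HasContinuedDensity μ A B (powerDensity a b q α l) d) :
    ∃ δ > 0, ∀ y : ℝ, y < 0 → ∀ z₁ ∈ lowerSector (sectorAngle q t),
      ∀ z₂ ∈ lowerSector (sectorAngle q t), ‖z₁‖ < δ → ‖z₂‖ < δ →
      cauchyTransform μ z₁ - 2 * Real.pi * Complex.I * powerDensity a b q α l z₁ =
        y * Complex.I →
      cauchyTransform μ z₂ - 2 * Real.pi * Complex.I * powerDensity a b q α l z₂ =
        y * Complex.I → z₁ = z₂ := by
  have ha := h.a_pos
  have hb := h.b_pos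
  have hq := h.q_pos
  have hα := h.α_pos K
  have hpi := Real.pi_pos
  have hlK : 0 ≤ q * l K := mul_nonneg hq.le (h.t_nonneg.trans (h.le_l K))
  set p : ℝ := 1 + q * l K with hp
  have hp1 : 1 ≤ p := by linarith
  set κ := q * (√b * √a) * α K with hκ
  have hκpos : 0 < κ := by positivity
  -- `-c₀` is the limit of `e^{pω}` times the continued Cauchy transform at `e^ω`
  set c₀ : ℝ := 2 * Real.pi * κ with hc₀
  have hc₀pos : 0 < c₀ := by positivity
  set Φ : ℂ → ℂ := fun ω => Complex.exp (p * ω) *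
    (cauchyTransform μ (Complex.exp ω) - 2 * Real.pi * Complex.I * logDensity a b q α l ω) /
      (-c₀ : ℂ) with hΦ
  have hre : ∀ R : ℝ, ∀ᶠ ω : ℂ in comap Complex.re atBot, ω.re < R := fun R =>
    tendsto_comap.eventually (eventually_lt_atBot R)
  have hGexp : Tendsto (fun ω : ℂ => Complex.exp (p * ω) * cauchyTransform μ (Complex.exp ω))
      (comap Complex.re atBot) (𝓝 0) := by
    have h1 := (tendsto_exp_mul_comap_re (show 0 < p by linarith)).norm.mul_const (2 / A)
    rw [norm_zero, zero_mul] at h1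
    refine squeeze_zero_norm' ?_ h1
    filter_upwards [hre (Real.log (A / 2))] with ω hω
    rw [norm_mul]
    gcongr
    refine hd.norm_cauchyTransform_le_of_norm_le hA ?_
    rw [Complex.norm_exp, ← Real.le_log_iff_exp_le (by positivity)]
    exact hω.le
  have hlim : Tendsto Φ (comap Complex.re atBot) (𝓝 1) := by
    have h1 := (hGexp.sub ((h.tendsto_exp_mul_logDensity hK).const_mul
      (2 * Real.pi * Complex.I))).div_const (-c₀ : ℂ)
    have hval : (0 - 2 * Real.pi * Complex.I * (-Complex.I * (κ : ℂ))) / (-c₀ : ℂ) = 1 := by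
      have h2 : (0 - 2 * Real.pi * Complex.I * (-Complex.I * (κ : ℂ))) = (-c₀ : ℂ) := by
        rw [hc₀]
        push_cast
        linear_combination (2 * Real.pi * κ : ℂ) * Complex.I_sq
      rw [h2, div_self]
      simpa using hc₀pos.ne'
    rw [hval] at h1
    refine h1.congr fun ω => ?_
    simp only [hΦ]
    ring
  obtain ⟨x₁, hx₁⟩ : ∃ x₁ : ℝ, ∀ ω : ℂ, ω.re < x₁ → ‖Φ ω - 1‖ ≤ 1 / 3 := by
    have h1 := hlim.eventually (Metric.closedBall_mem_nhds (1 : ℂ) (show (0 : ℝ) < 1 / 3 by norm_num))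
    rw [eventually_comap, eventually_atBot] at h1
    obtain ⟨x₁, h1⟩ := h1
    refine ⟨x₁, fun ω hω => ?_⟩
    have := h1 ω.re hω.le ω rfl
    rwa [dist_eq_norm] at this
  set x₀ : ℝ := min x₁ (min (Real.log A) (Real.log a / q)) with hx₀
  have hsupp : ∀ x ∈ μ.support, x ∈ Icc A B := fun x hx =>
    Measure.support_subset_of_isClosed isClosed_Icc hd.support hx
  have hroot : ∀ c : ℝ, a ≤ c → ∀ ω : ℂ, ω.re < x₀ →
      DifferentiableAt ℂ (fun ω : ℂ => rootTwo (c - Complex.exp (q * ω))) ω := by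
    intro c hc ω hω
    refine DifferentiableAt.comp (g := rootTwo) (f := fun ω : ℂ => (c : ℂ) - Complex.exp (q * ω)) ω
      (differentiableAt_rootTwo (Or.inl ?_)) (by fun_prop)
    have h1 : ω.re < Real.log a / q :=
      lt_of_lt_of_le hω ((min_le_right _ _).trans (min_le_right _ _))
    have h2 : ‖Complex.exp (q * ω)‖ < a := by
      rw [Complex.norm_exp, Complex.re_ofReal_mul, ← Real.lt_log_iff_exp_lt ha]
      rwa [lt_div_iff₀' hq] at h1
    have h3 := Complex.re_le_norm (Complex.exp (q * ω))
    rw [Complex.sub_re, Complex.ofReal_re]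
    linarith
  have hdiff : DifferentiableOn ℂ Φ {ω | ω.re < x₀} := by
    intro ω hω
    have hω' : ω.re < x₀ := hω
    have h1 : DifferentiableAt ℂ (fun ω => cauchyTransform μ (Complex.exp ω)) ω := by
      refine DifferentiableAt.comp (g := cauchyTransform μ) (f := Complex.exp) ω
        (differentiableAt_cauchyTransform fun x hx h0 => ?_) Complex.differentiableAt_exp
      have h2 := congrArg norm h0
      have h3 := (hsupp x hx).1
      rw [Complex.norm_exp, Complex.norm_real, Real.norm_of_nonneg (hA.le.trans h3)] at h2
      have h4 : ω.re < Real.log A :=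
        lt_of_lt_of_le hω' ((min_le_right _ _).trans (min_le_left _ _))
      rw [Real.lt_log_iff_exp_lt hA] at h4
      linarith
    have h2 : DifferentiableAt ℂ (logDensity a b q α l) ω := by
      refine DifferentiableAt.mul (((DifferentiableAt.mul (hroot b h.a_lt_b.le ω hω')
        (hroot a le_rfl ω hω')).const_mul _).const_mul _) (by fun_prop)
    refine DifferentiableAt.differentiableWithinAt ?_
    exact ((DifferentiableAt.mul (by fun_prop) (h1.sub (h2.const_mul _))).div_const _)
  refine ⟨Real.exp (x₀ - 1), Real.exp_pos _, fun y hy z₁ hz₁ z₂ hz₂ hn₁ hn₂ he₁ he₂ => ?_⟩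
  have hpt : ∀ z ∈ lowerSector (sectorAngle q t), ‖z‖ < Real.exp (x₀ - 1) →
      cauchyTransform μ z - 2 * Real.pi * Complex.I * powerDensity a b q α l z = y * Complex.I →
      z ≠ 0 ∧ (Complex.log z).re < x₀ - 1 ∧ 0 ≤ -p * (Complex.log z).im ∧
      -p * (Complex.log z).im ≤ 2 * Real.pi ∧
      Complex.exp (-p * Complex.log z) * Φ (Complex.log z) = (-y / c₀ : ℝ) * Complex.I := by
    intro z hzS hn he
    have hz0 : z ≠ 0 := by rintro rfl; simpa using hzS.1
    have hlog := log_im_mem_of_mem_lowerSector h.sectorAngle_pos hzS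
    refine ⟨hz0, ?_, by nlinarith [hlog.2], ?_, ?_⟩
    · rw [Complex.log_re]
      exact (Real.log_lt_iff_lt_exp (norm_pos_iff.2 hz0)).2 hn
    · have h1 : q * l K ≤ q * (t + 1) := by
        gcongr
        exact h.l_le K
      -- `l K ≤ t + 1` and `q ≤ 1` give `p θ ≤ 2π`
      have h2 : p ≤ 2 * (1 + q * t) := by
        have := mul_nonneg hq.le h.t_nonneg
        linarith [h.q_le_one]
      have h3 := mul_le_mul_of_nonneg_right h2 h.sectorAngle_pos.le
      have h4 : -p * (Complex.log z).im ≤ p * sectorAngle q t := by nlinarith [hlog.1]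
      linarith [h.sectorAngle_mul]
    · simp only [hΦ]
      rw [← h.powerDensity_eq_logDensity hzS.1, Complex.exp_log hz0, he, mul_div_assoc',
        ← mul_assoc, ← Complex.exp_add]
      have : -(p : ℂ) * Complex.log z + p * Complex.log z = 0 := by ring
      rw [this, Complex.exp_zero, one_mul]
      push_cast
      rw [div_neg, neg_div]
      ring
  obtain ⟨h01, h11, h21, h31, h41⟩ := hpt z₁ hz₁ hn₁ he₁
  obtain ⟨h02, h12, h22, h32, h42⟩ := hpt z₂ hz₂ hn₂ he₂
  have := eq_of_exp_mul_eq hp1 (div_pos (neg_pos.2 hy) hc₀pos) hdiff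
    (fun ω hω => hx₁ ω (lt_of_lt_of_le hω (min_le_left _ _))) h11 h12 h21 h31 h22 h32 h41 h42
  rw [← Complex.exp_log h01, this, Complex.exp_log h02]

end PowerParams

/-! ### The law of the power and its density -/

/-- The density of `X ^ (1 / q)` between `a ^ (1 / q)` and `b ^ (1 / q)`. The absolute value makes
it nonnegative on the whole line. -/
noncomputable def realPowerDensity (a b q : ℝ) {N : ℕ} (α l : Fin N → ℝ) (y : ℝ) : ℝ :=
  q * √((b - y ^ q) * (y ^ q - a)) * ∑ k, α k * |y| ^ (-(1 + q * l k))

theorem measurable_gpfpDensity (a b : ℝ) (N : ℕ) (α l : Fin N → ℝ) :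
    Measurable (gpfpDensity a b N α l) := by
  unfold gpfpDensity
  refine Measurable.indicator ?_ measurableSet_Ioo
  fun_prop

theorem gpfpDensity_nonneg {a b : ℝ} (ha : 0 < a) {N : ℕ} {α l : Fin N → ℝ} (hα : ∀ k, 0 < α k)
    (x : ℝ) : 0 ≤ gpfpDensity a b N α l x := by
  refine indicator_nonneg (fun y hy => ?_) x
  have hy0 : 0 < y := ha.trans hy.1
  refine mul_nonneg (by positivity) (Finset.sum_nonneg fun k _ => ?_)
  have := hα k
  positivity

theorem integral_gpfp {a b : ℝ} (ha : 0 < a) {N : ℕ} {α l : Fin N → ℝ} (hα : ∀ k, 0 < α k)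
    (F : ℝ → ℂ) :
    ∫ x, F x ∂(gpfp a b N α l) = ∫ x in Ioo a b, gpfpDensity a b N α l x • F x := by
  rw [gpfp, integral_withDensity_eq_integral_toReal_smul
    (measurable_gpfpDensity a b N α l).ennreal_ofReal (by simp),
    ← integral_indicator measurableSet_Ioo]
  congr 1
  funext x
  rw [ENNReal.toReal_ofReal (gpfpDensity_nonneg ha hα x)]
  by_cases hx : x ∈ Ioo a b
  · rw [indicator_of_mem hx]
  · rw [indicator_of_notMem hx, gpfpDensity, indicator_of_notMem hx, zero_smul]

theorem ae_mem_Ioo_gpfp (a b : ℝ) (N : ℕ) (α l : Fin N → ℝ) :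
    ∀ᵐ x ∂(gpfp a b N α l), x ∈ Ioo a b := by
  rw [gpfp, ae_withDensity_iff (measurable_gpfpDensity a b N α l).ennreal_ofReal]
  refine ae_of_all _ fun x hx => ?_
  by_contra hcon
  simp [gpfpDensity, indicator_of_notMem hcon] at hx

namespace PowerParams

variable {a b q t : ℝ} {N : ℕ} {α l : Fin N → ℝ}

theorem rpow_mem_Ioo_iff (h : PowerParams a b q t α l) {y : ℝ} (hy : 0 < y) :
    y ^ q ∈ Ioo a b ↔ y ∈ Ioo (a ^ q⁻¹) (b ^ q⁻¹) := by
  rw [mem_Ioo, mem_Ioo, Real.rpow_inv_lt_iff_of_pos h.a_pos.le hy.le h.q_pos,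
    Real.lt_rpow_inv_iff_of_pos hy.le h.b_pos.le h.q_pos]

theorem image_rpow_Ioo (h : PowerParams a b q t α l) :
    (fun x : ℝ => x ^ q⁻¹) '' Ioo a b = Ioo (a ^ q⁻¹) (b ^ q⁻¹) := by
  have ha := h.a_pos
  ext y
  constructor
  · rintro ⟨x, hx, rfl⟩
    have hx0 : 0 < x := ha.trans hx.1
    have : (x ^ q⁻¹) ^ q = x := by
      rw [← Real.rpow_mul hx0.le, inv_mul_cancel₀ h.q_pos.ne', Real.rpow_one]
    exact (h.rpow_mem_Ioo_iff (Real.rpow_pos_of_pos hx0 _)).1 (by rwa [this])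
  · intro hy
    have hy0 : 0 < y := (Real.rpow_pos_of_pos ha _).trans hy.1
    refine ⟨y ^ q, (h.rpow_mem_Ioo_iff hy0).2 hy, ?_⟩
    show (y ^ q) ^ q⁻¹ = y
    rw [← Real.rpow_mul hy0.le, mul_inv_cancel₀ h.q_pos.ne', Real.rpow_one]

theorem powerDensity_ofReal (h : PowerParams a b q t α l) {y : ℝ}
    (hy : y ∈ Ioo (a ^ q⁻¹) (b ^ q⁻¹)) :
    powerDensity a b q α l y = realPowerDensity a b q α l y := by
  have hy0 : 0 < y := (Real.rpow_pos_of_pos h.a_pos _).trans hy.1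
  have hyq := (h.rpow_mem_Ioo_iff hy0).2 hy
  rw [powerDensity, realPowerDensity, ← Complex.ofReal_cpow hy0.le, ← Complex.ofReal_sub,
    ← Complex.ofReal_sub, rootTwo_ofReal (by linarith [hyq.2]), rootTwo_ofReal (by linarith [hyq.1]),
    Real.sqrt_mul (by linarith [hyq.2]), abs_of_pos hy0]
  push_cast
  congr 1
  refine Finset.sum_congr rfl fun k _ => ?_
  rw [Complex.ofReal_cpow hy0.le]
  push_cast
  rfl

theorem im_cpow_ne_zero (h : PowerParams a b q t α l) {z : ℂ} (hz : z.im ≠ 0) :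
    (z ^ (q : ℂ)).im ≠ 0 := by
  have hz0 : z ≠ 0 := by rintro rfl; simp at hz
  have hq := h.q_pos
  have hq1 := h.q_le_one
  rw [Complex.cpow_def_of_ne_zero hz0, mul_comm, Complex.exp_im, Complex.im_ofReal_mul,
    Complex.log_im]
  refine mul_ne_zero (Real.exp_pos _).ne' ?_
  rcases lt_or_gt_of_ne hz with h1 | h1
  · have h2 := Complex.arg_neg_iff.2 h1
    have h3 := Complex.neg_pi_lt_arg z
    refine (Real.sin_neg_of_neg_of_neg_pi_lt (mul_neg_of_pos_of_neg hq h2) ?_).ne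
    nlinarith
  · have h2 : 0 < z.arg := by
      refine lt_of_le_of_ne (Complex.arg_nonneg_iff.2 h1.le) fun h0 => ?_
      exact hz (Complex.arg_eq_zero_iff.1 h0.symm).2
    have h3 : z.arg < Real.pi := lt_of_le_of_ne (Complex.arg_le_pi z) fun h0 =>
      hz (Complex.arg_eq_pi_iff.1 h0).2
    refine (Real.sin_pos_of_pos_of_lt_pi (mul_pos hq h2) ?_).ne'
    nlinarith

theorem differentiableOn_powerDensity (h : PowerParams a b q t α l) :
    DifferentiableOn ℂ (powerDensity a b q α l) (cutPlane (a ^ q⁻¹) (b ^ q⁻¹)) := by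
  intro z hz
  have hA : 0 < a ^ q⁻¹ := Real.rpow_pos_of_pos h.a_pos _
  have hslit : z ∈ Complex.slitPlane := by
    rcases hz with h1 | h1
    · exact Or.inr h1
    · exact Or.inl (hA.trans h1.1)
  have hroots : (b : ℂ) - z ^ (q : ℂ) ∈ Complex.slitPlane ∧
      z ^ (q : ℂ) - a ∈ Complex.slitPlane := by
    by_cases him : z.im = 0
    · have hre := hz.resolve_left (not_not.2 him)
      have hzre : z = (z.re : ℝ) := Complex.ext rfl (by simpa using him)
      have hz0 : 0 < z.re := hA.trans hre.1
      have hmem := (h.rpow_mem_Ioo_iff hz0).2 hre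
      rw [hzre, ← Complex.ofReal_cpow hz0.le, ← Complex.ofReal_sub, ← Complex.ofReal_sub,
        Complex.ofReal_mem_slitPlane, Complex.ofReal_mem_slitPlane]
      exact ⟨sub_pos.2 hmem.2, sub_pos.2 hmem.1⟩
    · have := h.im_cpow_ne_zero him
      exact ⟨Or.inr (by simpa using this), Or.inr (by simpa using this)⟩
  have hpow : ∀ c : ℂ, DifferentiableAt ℂ (fun z : ℂ => z ^ c) z := fun c =>
    differentiableAt_id.cpow_const hslit
  have h1 : DifferentiableAt ℂ (fun z : ℂ => rootTwo (b - z ^ (q : ℂ))) z :=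
    DifferentiableAt.comp (g := rootTwo) (f := fun z : ℂ => (b : ℂ) - z ^ (q : ℂ)) z
      (differentiableAt_rootTwo hroots.1) ((hpow q).const_sub _)
  have h2 : DifferentiableAt ℂ (fun z : ℂ => rootTwo (z ^ (q : ℂ) - a)) z :=
    DifferentiableAt.comp (g := rootTwo) (f := fun z : ℂ => z ^ (q : ℂ) - a) z
      (differentiableAt_rootTwo hroots.2) ((hpow q).sub_const _)
  refine DifferentiableAt.differentiableWithinAt ?_
  refine DifferentiableAt.mul ((h1.mul h2).const_mul _) ?_
  exact DifferentiableAt.fun_sum fun k _ => (hpow _).const_mul _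

/-- The change of variables `y = x ^ (1 / q)` at the level of densities. -/
theorem jacobian_mul_realPowerDensity (h : PowerParams a b q t α l) {x : ℝ} (hx : x ∈ Ioo a b) :
    |q⁻¹ * x ^ (q⁻¹ - 1)| * realPowerDensity a b q α l (x ^ q⁻¹) = gpfpDensity a b N α l x := by
  have hx0 : 0 < x := h.a_pos.trans hx.1
  have hq := h.q_pos
  have h1 : (x ^ q⁻¹) ^ q = x := by
    rw [← Real.rpow_mul hx0.le, inv_mul_cancel₀ hq.ne', Real.rpow_one]
  rw [gpfpDensity, indicator_of_mem hx, realPowerDensity, h1,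
    abs_of_pos (Real.rpow_pos_of_pos hx0 _), abs_of_pos (by positivity), Finset.mul_sum,
    Finset.mul_sum, Finset.mul_sum]
  refine Finset.sum_congr rfl fun k _ => ?_
  have h2 : x ^ (q⁻¹ - 1) * (x ^ q⁻¹) ^ (-(1 + q * l k)) = x⁻¹ * (x ^ l k)⁻¹ := by
    rw [← Real.rpow_mul hx0.le, ← Real.rpow_add hx0, ← Real.rpow_neg hx0.le, ← Real.rpow_neg_one x,
      ← Real.rpow_add hx0]
    congr 1
    field_simp
    ring
  calc q⁻¹ * x ^ (q⁻¹ - 1) * (q * √((b - x) * (x - a)) *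
        (α k * (x ^ q⁻¹) ^ (-(1 + q * l k))))
      = q⁻¹ * q * √((b - x) * (x - a)) * α k *
        (x ^ (q⁻¹ - 1) * (x ^ q⁻¹) ^ (-(1 + q * l k))) := by ring
    _ = √((b - x) * (x - a)) / x * (α k / x ^ l k) := by
        rw [h2, inv_mul_cancel₀ hq.ne']
        ring

theorem hasContinuedDensity (h : PowerParams a b q t α l) :
    HasContinuedDensity ((gpfp a b N α l).map fun x => x ^ q⁻¹) (a ^ q⁻¹) (b ^ q⁻¹)
      (powerDensity a b q α l) (realPowerDensity a b q α l) where
  lt := Real.rpow_lt_rpow h.a_pos.le h.a_lt_b (inv_pos.2 h.q_pos)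
  differentiableOn := h.differentiableOn_powerDensity
  continuousOn := by
    intro y hy
    have hy0 : y ≠ 0 := ((Real.rpow_pos_of_pos h.a_pos _).trans_le hy.1).ne'
    refine ContinuousAt.continuousWithinAt ?_
    have h1 : ContinuousAt (fun y : ℝ => y ^ q) y := Real.continuousAt_rpow_const _ _ (Or.inl hy0)
    have h2 : ∀ c : ℝ, ContinuousAt (fun y : ℝ => |y| ^ c) y := fun c =>
      continuous_abs.continuousAt.rpow_const (Or.inl (abs_ne_zero.2 hy0))
    have h3 : ContinuousAt (fun y : ℝ => √((b - y ^ q) * (y ^ q - a))) y :=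
      ((continuousAt_const.sub h1).mul (h1.sub continuousAt_const)).sqrt
    refine (continuousAt_const.mul h3).mul ?_
    exact tendsto_finsetSum _ fun k _ => continuousAt_const.mul (h2 _)
  left := by
    rw [realPowerDensity, ← Real.rpow_mul h.a_pos.le, inv_mul_cancel₀ h.q_pos.ne', Real.rpow_one]
    simp
  right := by
    rw [realPowerDensity, ← Real.rpow_mul h.b_pos.le, inv_mul_cancel₀ h.q_pos.ne', Real.rpow_one]
    simp
  nonneg y := by
    refine mul_nonneg (mul_nonneg h.q_pos.le (Real.sqrt_nonneg _)) (Finset.sum_nonneg fun k _ => ?_)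
    exact mul_nonneg (h.α_pos k).le (Real.rpow_nonneg (abs_nonneg _) _)
  eqOn _ hy := h.powerDensity_ofReal hy
  cauchy z hz := by
    have ha := h.a_pos
    rw [cauchyTransform, integral_map (by fun_prop)
      (continuous_one_div_sub hz).aestronglyMeasurable, integral_gpfp ha h.α_pos,
      ← h.image_rpow_Ioo, integral_image_eq_integral_abs_deriv_smul (f := fun x : ℝ => x ^ q⁻¹)
        (f' := fun x : ℝ => q⁻¹ * x ^ (q⁻¹ - 1)) measurableSet_Ioo]
    · refine setIntegral_congr_fun measurableSet_Ioo fun x hx => ?_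
      simp only [← h.jacobian_mul_realPowerDensity hx, Complex.real_smul]
      push_cast
      ring
    · intro x hx
      exact (Real.hasDerivAt_rpow_const (Or.inl (ha.trans hx.1).ne')).hasDerivWithinAt
    · intro x hx y hy hxy
      exact (Real.rpow_left_inj (ha.trans hx.1).le (ha.trans hy.1).le
        (inv_pos.2 h.q_pos).ne').1 hxy
  support := by
    refine (ae_map_iff (p := (· ∈ Icc (a ^ q⁻¹) (b ^ q⁻¹))) (by fun_prop) measurableSet_Icc).2 ?_
    filter_upwards [ae_mem_Ioo_gpfp a b N α l] with x hx
    exact Ioo_subset_Icc_self (h.image_rpow_Ioo ▸ mem_image_of_mem _ hx)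

end PowerParams

end FreeProb

theorem theorem4p1 {Ω : Type*} [MeasurableSpace Ω] (P : Measure Ω) [IsProbabilityMeasure P]
    (X : Ω → ℝ) (a b : ℝ) (ha : 0 < a) (hab : a < b)
    (N : ℕ) (α l : Fin N → ℝ) (hα : ∀ k, 0 < α k) (hl : StrictMono l)
    (hmass : ∫ x in a..b, FreeProb.gpfpDensity a b N α l x = 1)
    (hX : HasLaw X (FreeProb.gpfp a b N α l) P)
    (t : ℝ) (ht : 0 ≤ t) (hlt : ∀ k, l k ∈ Icc t (t + 1))
    (r : ℝ) (hr : 1 ≤ r) :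
    FreeProb.IsUI (P.map fun ω => X ω ^ r) ∧
      FreeProb.IsFreelyInfinitelyDivisible (P.map fun ω => X ω ^ r) := by
  have hr0 : 0 < r := by linarith
  have hparams : FreeProb.PowerParams a b r⁻¹ t α l :=
    ⟨ha, hab, inv_pos.2 hr0, inv_le_one_of_one_le₀ hr, ht, hα, fun k => (hlt k).1,
      fun k => (hlt k).2⟩
  obtain ⟨K, hK⟩ : ∃ K : Fin N, ∀ k, k ≠ K → l k < l K := by
    cases N with
    -- with no terms the total mass would be zero
    | zero => simp [FreeProb.gpfpDensity] at hmass
    | succ n => exact ⟨Fin.last n, fun k hk => hl (Fin.lt_last_iff_ne_last.2 hk)⟩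
  have hmeas : Measurable fun x : ℝ => x ^ r := by fun_prop
  have hprob : IsProbabilityMeasure (P.map fun ω => X ω ^ r) :=
    Measure.isProbabilityMeasure_map (hmeas.comp_aemeasurable hX.aemeasurable)
  have hlaw : P.map (fun ω => X ω ^ r) =
      (FreeProb.gpfp a b N α l).map fun x => x ^ (r⁻¹)⁻¹ := by
    rw [inv_inv, ← hX.map_eq, AEMeasurable.map_map_of_aemeasurable hmeas.aemeasurable hX.aemeasurable]
    rfl
  have hd := hparams.hasContinuedDensity
  rw [← hlaw] at hd
  have hA : 0 < a ^ (r⁻¹)⁻¹ := Real.rpow_pos_of_pos ha _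
  refine hd.isUI_of_boundary_behaviour hA hparams.sectorAngle_pos hparams.sectorAngle_le_pi
    (fun p hp hpS ε hε => hparams.eventually_re_powerDensity_le (fun s h1 h2 => ?_) hp hpS hε)
    (fun ε hε => hparams.eventually_re_powerDensity_le_cobounded hε)
    (hparams.eventually_le_norm_powerDensity hK)
    (fun δ hδ => hparams.exists_re_powerDensity_le hδ)
    (hparams.exists_unique_preimage hK hA hd)
  have h3 : Real.exp (r⁻¹ * s) = Real.exp s ^ r⁻¹ := by rw [mul_comm, Real.exp_mul]
  exact (hparams.rpow_mem_Ioo_iff (Real.exp_pos s)).1 (by rw [← h3]; exact ⟨h1, h2⟩)
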